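/- **Definitions.** For $\xi\in\mathbb R$ and $\underline x=(x_0,x_1,x_2)\in\mathbb Z^3$ put $L(\underline x)=\max(|x_0\xi-x_1|,|x_0\xi^2-x_2|)$; a capital letter denotes the sup norm of the point with the same underlined letter, e.g. $X=\max(|x_0|,|x_1|,|x_2|)$. For $0<\varepsilon\le 1$ let $\beta_\varepsilon(\xi)\in[0,+\infty]$ be the infimum of the real $\beta>0$ such that for every sufficiently large $B$ there is $\underline x\in\mathbb Z^3$ with $1\le|x_0|\le B$ and $L(\underline x)\le\min(B^{-1/\beta},|x_0|^{\varepsilon-1})$ (with $\inf\emptyset=+\infty$), and let $\beta_0(\xi)=\sup_{0<\varepsilon<1}\beta_\varepsilon(\xi)$. If $\beta_0(\xi)<2$, put $$\varepsilon_1=(2-\beta_1(\xi))\bigl(2-\beta_1(\xi)+(2-\beta_0(\xi))\beta_1(\xi)\bigr).$$ For $0<\varepsilon<1$ let $\mathcal A_\varepsilon=\{\underline x\in\mathbb Z^3\setminus\{0\}: L(\underline x)\le X^{-(1-\varepsilon)}\}$, and $\mathcal A_\varepsilon=\mathbb Z^3\setminus\{0\}$ for $\varepsilon\ge1$. A *minimal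 point* is a point $\underline a\in\mathbb Z^3$ that, for some real $X\ge1$, minimizes $L$ among the points with $1\le a_0\le X$ and $L(\underline a)\le1$. Identify $\underline x$ with the symmetric matrix $\begin{pmatrix}x_0&x_1\\x_1&x_2\end{pmatrix}$, and for linearly dependent $\underline x,\underline y,\underline z$ let $[\underline x,\underline y,\underline z]$ be the point identified with the symmetric matrix $-\underline xJ\underline zJ\underline y$, where $J=\begin{pmatrix}0&1\\-1&0\end{pmatrix}$. Two points are *collinear* if they are linearly dependent. For $\psi:\{1,2,\dots\}\to\{0,1,2,\dots\}$ with $\psi(n)\le n-1$ for all $n\geq 1$, let $\vartheta_0<\vartheta_1<\cdots$ be the indices $n\ge1$ with $\psi(n)\le n-2$. Let $\mathcal F$ be the set of such $\psi$ for which there are infinitely many $\vartheta_k$, there is $c$ with $i-c\le\psi(i)\le i-1$ for all $i\ge1$, and $\psi(\vartheta_k)<\vartheta_{k-1}$ and $\psi(\vartheta_k)\ne\psi(\vartheta_{k-1})$ for all sufficiently large $k$. For $\psi,\psi'\in\mathcal F$ write $\psi\,\mathcal R\,\psi'$ if there are $\delta\in\mathbb Z$ and $i_1$ such that $\psi(i)-i=\psi'(i-\delta)-(i-\delta)$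 for all $i\ge i_1$. Two sequences *coincide up to finitely many terms* if they become equal after omitting finitely many initial terms of each. **Theorem.** Let $\xi$ be an irrational, non-quadratic real number (that is, $[\mathbb Q(\xi):\mathbb Q]\ge3$). (a) Suppose $\beta_0(\xi)<2$. For every $\varepsilon$ with $0<\varepsilon<\varepsilon_1$, the minimal points in $\mathcal A_\varepsilon$, ordered according to their norms, form an infinite sequence $(\underline u_i)_{i\ge1}$, and $$L(\underline u_i)=U_i^{-1+o(1)},\qquad \liminf_{i\to\infty}\frac{\log U_{i+1}}{\log U_i}>1,\qquad \beta_0(\xi)=\beta_\varepsilon(\xi)=\limsup_{i\to\infty}\frac{\log U_{i+1}}{\log U_i}.$$ Moreover there is $\psi\in\mathcal F$ such that $[\underline u_i,\underline u_i,\underline u_{i+1}]$ is collinear to $\underline u_{\psi(i)}$ for every sufficiently large $i$. Finally, $(\underline u_i)$ (up to finitely many terms) and $\psi$ (modulo $\mathcal R$) do not depend on the choice of $\varepsilon$: if $0<\varepsilon,\varepsilon'<\varepsilon_1$, the corresponding sequences coincide up to finitely many terms, and any $\psi,\psi'\in\mathcal F$ with the above property for $\varepsilon$ and $\varepsilon'$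 respectively satisfy $\psi\,\mathcal R\,\psi'$. (b) Conversely, let $(\underline v_i)_{i\ge1}$ be a sequence of primitive points of $\mathbb Z^3$ such that: - the sequence of first coordinates $(v_{i,0})_{i\ge1}$ is positive and (strictly) increasing; - $L(\underline v_i)=V_i^{-1+o(1)}$ as $i\to\infty$; - $\beta=\limsup_{i\to\infty}(\log V_{i+1})/(\log V_i)$ satisfies $\beta<2$; - for every sufficiently large $i$, if $\underline v_{i-1},\underline v_i,\underline v_{i+1}$ are linearly dependent, then $[\underline v_i,\underline v_i,\underline v_{i-1}]$ is collinear to $\underline v_{i+1}$. Then $\beta_0(\xi)=\beta<2$, and for every $\varepsilon$ with $0<\varepsilon<\varepsilon_1$ the sequence $(\underline v_i)$ coincides up to finitely many terms with the sequence $(\underline u_i)$ of part (a). -/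

import Mathlib

open Filter Topology Set

namespace SimApprox

/-- `ξ` is irrational and non-quadratic, i.e. `[ℚ(ξ) : ℚ] ≥ 3` (possibly infinite). -/
def IrrationalNonQuadratic (ξ : ℝ) : Prop :=
  ∀ p : Polynomial ℚ, p ≠ 0 → p.natDegree ≤ 2 → Polynomial.aeval ξ p ≠ 0

/-- Points `x = (x₀, x₁, x₂)` of `ℤ³`. The norm `‖x‖` on this type is the sup norm
`max (|x₀|, |x₁|, |x₂|)`, denoted by the corresponding capital letter in the text. -/
abbrev Point : Type := Fin 3 → ℤ

/-- `L(x) = max (|x₀ ξ - x₁|, |x₀ ξ² - x₂|)`. -/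
noncomputable def L (ξ : ℝ) (x : Point) : ℝ :=
  max |(x 0 : ℝ) * ξ - x 1| |(x 0 : ℝ) * ξ ^ 2 - x 2|

/-- The real numbers `β > 0` such that for any sufficiently large `B` there is `x ∈ ℤ³` with
`1 ≤ |x₀| ≤ B` and `L(x) ≤ min (B ^ (-1/β), |x₀| ^ (ε - 1))`. -/
def betaSet (ξ ε : ℝ) : Set ℝ :=
  {b : ℝ | 0 < b ∧ ∀ᶠ B : ℝ in atTop, ∃ x : Point,
    1 ≤ |(x 0 : ℝ)| ∧ |(x 0 : ℝ)| ≤ B ∧ L ξ x ≤ min (B ^ (-1 / b)) (|(x 0 : ℝ)| ^ (ε - 1))}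

/-- The exponent `β_ε(ξ)` for `0 < ε ≤ 1`: an infimum, equal to `+∞` if the set is empty. -/
noncomputable def beta (ξ ε : ℝ) : EReal :=
  sInf ((fun b : ℝ => (b : EReal)) '' betaSet ξ ε)

/-- The exponent `β₀(ξ) = sup_{0 < ε < 1} β_ε(ξ)`. -/
noncomputable def beta0 (ξ : ℝ) : EReal :=
  ⨆ ε ∈ Ioo (0 : ℝ) 1, beta ξ ε

/-- `ε₁ = (2 - β₁(ξ)) (2 - β₁(ξ) + (2 - β₀(ξ)) β₁(ξ))`. It is used only when `β₀(ξ) < 2`, in which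
case `β₁(ξ) ≤ β₀(ξ)` are both (nonnegative) real numbers. -/
noncomputable def epsilon1 (ξ : ℝ) : ℝ :=
  (2 - (beta ξ 1).toReal) *
    (2 - (beta ξ 1).toReal + (2 - (beta0 ξ).toReal) * (beta ξ 1).toReal)

/-- The set `𝓐_ε` of the nonzero `x ∈ ℤ³` with `L(x) ≤ X ^ (-(1 - ε))`; it consists of all nonzero
points if `ε ≥ 1`. -/
def A (ξ ε : ℝ) : Set Point :=
  {x : Point | x ≠ 0 ∧ (ε < 1 → L ξ x ≤ ‖x‖ ^ (-(1 - ε)))}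

/-- `a` is the minimal point corresponding to the real number `X ≥ 1`: it minimizes `L` among the
points with `1 ≤ a₀ ≤ X` and `L(a) ≤ 1`. -/
def IsMinimalPointFor (ξ X : ℝ) (a : Point) : Prop :=
  (1 ≤ (a 0 : ℝ) ∧ (a 0 : ℝ) ≤ X ∧ L ξ a ≤ 1) ∧
    ∀ b : Point, 1 ≤ (b 0 : ℝ) → (b 0 : ℝ) ≤ X → L ξ b ≤ 1 → L ξ a ≤ L ξ b

/-- `a` is a minimal point. -/
def IsMinimalPoint (ξ : ℝ) (a : Point) : Prop :=
  ∃ X : ℝ, 1 ≤ X ∧ IsMinimalPointFor ξ X a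

/-- `(u i)_{i ≥ 1}` is the sequence of all minimal points in `𝓐_ε`, ordered according to their
norms. (The value `u 0` is irrelevant.) -/
def IsMinimalSequence (ξ ε : ℝ) (u : ℕ → Point) : Prop :=
  StrictMonoOn (fun i => ‖u i‖) (Ici 1) ∧ u '' Ici 1 = {a | IsMinimalPoint ξ a ∧ a ∈ A ξ ε}

/-- `L(u_i) = U_i ^ (-1 + o(1))` as `i → ∞`. -/
def HasExponentNegOne (ξ : ℝ) (u : ℕ → Point) : Prop :=
  ∃ η : ℕ → ℝ, Tendsto η atTop (𝓝 0) ∧ ∀ᶠ i in atTop, L ξ (u i) = ‖u i‖ ^ (-1 + η i)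

/-- The ratio `log U_{i+1} / log U_i`, as an extended real number (so that upper and lower limits
always exist). -/
noncomputable def logRatio (u : ℕ → Point) (i : ℕ) : EReal :=
  ((Real.log ‖u (i + 1)‖ / Real.log ‖u i‖ : ℝ) : EReal)

/-- The symmetric matrix identified with a point of `ℤ³`. -/
def symMatrix (x : Point) : Matrix (Fin 2) (Fin 2) ℤ := !![x 0, x 1; x 1, x 2]

/-- The matrix `J`. -/
def J : Matrix (Fin 2) (Fin 2) ℤ := !![0, 1; -1, 0]

/-- The matrix `-x J z J y`, symmetric if `x`, `y`, `z` are linearly dependent. -/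
def bracketMatrix (x y z : Point) : Matrix (Fin 2) (Fin 2) ℤ :=
  -(symMatrix x * J * symMatrix z * J * symMatrix y)

/-- Roy's bracket `[x, y, z]`: the point identified with the matrix `-x J z J y`. -/
def bracket (x y z : Point) : Point :=
  ![bracketMatrix x y z 0 0, bracketMatrix x y z 0 1, bracketMatrix x y z 1 1]

/-- For linearly dependent `x`, `y`, `z` the matrix `-x J z J y` is symmetric, and it is the matrix
identified with the point `[x, y, z]`. -/
theorem symMatrix_bracket (x y z : Point) (h : (Matrix.of ![x, y, z]).det = 0) :
    symMatrix (bracket x y z) = bracketMatrix x y z := by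
  rw [Matrix.det_fin_three] at h
  simp at h
  ext i j
  fin_cases i <;> fin_cases j <;>
    simp [symMatrix, bracket, bracketMatrix, J, Matrix.mul_apply, Fin.sum_univ_two]
  all_goals linear_combination h

/-- Two points of `ℤ³` are collinear if they are linearly dependent. -/
def IsCollinear (x y : Point) : Prop := ¬ LinearIndependent ℤ ![x, y]

/-- A primitive point: its coordinates are globally coprime. -/
def IsPrimitivePoint (x : Point) : Prop := ∀ d : ℤ, (∀ j, d ∣ x j) → IsUnit d

/-- The indices `n ≥ 1` with `ψ(n) ≤ n - 2`. -/
def IsJump (ψ : ℕ → ℕ) (n : ℕ) : Prop := 1 ≤ n ∧ ψ n + 2 ≤ n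

/-- The increasing sequence `(ϑ_k)_{k ≥ 0}` of all indices `n ≥ 1` with `ψ(n) ≤ n - 2`
(meaningful for all `k` if there are infinitely many of them). -/
noncomputable def theta (ψ : ℕ → ℕ) (k : ℕ) : ℕ := Nat.nth (IsJump ψ) k

/-- Asymptotically reduced functions. Functions on the positive integers are represented by
functions on `ℕ` whose value at `0` is irrelevant. -/
def AsymptoticallyReduced (ψ : ℕ → ℕ) : Prop :=
  (∀ n, 1 ≤ n → ψ n + 1 ≤ n) ∧
    ({n | IsJump ψ n}.Finite ∨
      ∀ᶠ k in atTop, ψ (theta ψ (k + 1)) < theta ψ k ∧ ψ (theta ψ (k + 1)) ≠ ψ (theta ψ k))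

/-- The set `𝓕`. -/
def F : Set (ℕ → ℕ) :=
  {ψ | AsymptoticallyReduced ψ ∧
    (∃ c : ℤ, ∀ i : ℕ, 1 ≤ i → (i : ℤ) - c ≤ ψ i ∧ (ψ i : ℤ) ≤ i - 1) ∧
    {i | IsJump ψ i}.Infinite}

/-- The relation `𝓡`: there are `δ ∈ ℤ` and `i₁` such that
`ψ(i) - i = ψ'(i - δ) - (i - δ)` for any `i ≥ i₁` (where `i - δ ≥ 1`). -/
def R (ψ ψ' : ℕ → ℕ) : Prop :=
  ∃ (δ : ℤ) (i₁ : ℕ), ∀ i : ℕ, i₁ ≤ i →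
    1 ≤ (i : ℤ) - δ ∧ (ψ i : ℤ) - i = (ψ' ((i : ℤ) - δ).toNat : ℤ) - ((i : ℤ) - δ)

/-- `ψ` describes the brackets of `(u_i)`: `[u_i, u_i, u_{i+1}]` is collinear to `u_{ψ(i)}` for any
sufficiently large `i`. -/
def Describes (ψ : ℕ → ℕ) (u : ℕ → Point) : Prop :=
  ∀ᶠ i in atTop, IsCollinear (bracket (u i) (u i) (u (i + 1))) (u (ψ i))

/-- The sequences `(u i)_{i ≥ 1}` and `(v i)_{i ≥ 1}` coincide up to a finite number of terms:
they become equal after omitting finitely many initial terms of each. -/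
def SameTail (u v : ℕ → Point) : Prop :=
  ∃ a b : ℕ, ∀ i : ℕ, 1 ≤ i → u (a + i) = v (b + i)

end SimApprox

open SimApprox

/-! Write `lsize x = log x₀` and `qual ξ x = -log L(x)`, and call `lsize x - qual ξ x` the defect of
a minimal point `x`. Up to constants, `𝓐_ε` singles out the minimal points of defect at most
`ε * lsize x` (`Good`), and planes of `ℤ³` are handled through their integral normal vectors.

**Heights of planes.** If `β₁ < 2`, an integral normal vector `p` of a plane is long in two ways:
`‖p‖ ≫ y₀ ^ (2 - β₁)` for every minimal point `y` of the plane (`exists_escape`), and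
`‖p‖ ≫ s₀ ^ (1 / β₁)` if the minimal points enter the plane at `s` (`exists_entry`). On the other
hand the plane of minimal points `x`, `y` with `x₀ < y₀` has a normal vector of norm `≪ y₀ L(x)`,
and if this bound comes with `log y₀ ≤ b * qual ξ x + O(1)` for some `b < 2`, all the minimal points
between `x` and `y` lie in their plane (`exists_coplanar`).

**Multiplicative coordinates on a plane.** On a plane spanned by two very good points, the
determinant `x₀ x₂ - x₁²` factors into two linear forms, one comparable to `x₀` and the other to
`L(x)`, and both are multiplicative for the bracket `[x, y, z]`. Their logarithms `α` (size) and
minus `β` (quality) therefore make `[x, y, z]` behave like `x + y - z` (`PlaneCoords`,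
`exists_logCoords`).

**Improvement of the defect.** The heart of the proof is `exists_good_subset`: for `ε < ε₁`, large
minimal points of defect at most `ε * lsize` have defect `o(lsize)`. Such a point `a` lies in the
plane of the two neighbouring points `u`, `y` of very small defect. Let `s`, `n` be the first two
very good points of that plane. Brackets yield points of the plane of sizes `S, N, 2 N - S, …`,
where `S`, `N` are the sizes of `s`, `n`. If `a` is collinear to one of them, its determinant is
small and so is its defect. Otherwise the cross products of `a` with the two of them around `a` are
normal vectors of the plane; the product of their norms is at most
`exp ((N - S) + (defect of a) + o(T))` with `T = lsize y` and `N ≤ β₀ S + o(T)`, and the lower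
bounds for heights give `(2 - β₁) (2 + β₁ - β₀ β₁) T ≤ ε T + o(T)`, contrary to `ε < ε₁`.

**Structure of the sequence.** The minimal points in `𝓐_ε` thus form a set `G` of points of defect
`o(lsize)` that contains all large minimal points of sufficiently small relative defect and has gaps
of exponent less than `2` (`GoodSet`, `goodSet_minimalIn`); in particular two choices of `ε` give
the same large points. Brackets of elements of such a set in a common plane are collinear to
elements of it, as long as their size is in the right range (`exists_mem_bracket`). Hence
`[u, u, y]`, for consecutive `u`, `y`, is collinear to an element below `u` (`reflect_down`), which
is the one just before `u` if these three points are dependent (`cross_bracket_eq_zero`). This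
defines `ψ` (`exists_psi`), and the conditions defining `𝓕` express that successive planes meet in a
line only (`psi_mem_F`). The equalities of exponents hold for any sequence of points of defect
`o(lsize)` with the required gaps (`ApproxSeq`).

**The converse.** The terms of a sequence as in the second part are eventually minimal points
(`exists_isMinimalPoint_of_defect`) and elements of `G`. If the sequence skips an element of `G`,
then three consecutive terms are dependent (`coplanar_of_skip`), and by reflection the sequence also
skips an element one step earlier. As infinitely many skips would propagate backwards and confine a
tail of the sequence to a plane, there are only finitely many (`eventually_consec`). -/

namespace SimApprox

open Matrix

/-! ### Linear algebra in `ℤ³` -/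

/-- The determinant `x₀ x₂ - x₁²` of the symmetric matrix identified with `x`. -/
def pdet (x : Point) : ℤ := x 0 * x 2 - x 1 ^ 2

lemma point_ext {x y : Point} (h0 : x 0 = y 0) (h1 : x 1 = y 1) (h2 : x 2 = y 2) : x = y := by
  ext i; fin_cases i <;> assumption

lemma cross_eq_zero_iff (x y : Point) : x ⨯₃ y = 0 ↔ ∀ i j, x i * y j = x j * y i := by
  constructor
  · intro h i j
    have h0 := congrFun h 0
    have h1 := congrFun h 1
    have h2 := congrFun h 2
    simp only [cross_apply, cons_val, Pi.zero_apply] at h0 h1 h2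
    fin_cases i <;> fin_cases j <;> simp <;> linarith
  · intro h
    apply point_ext <;> simp only [cross_apply, cons_val, Pi.zero_apply]
    · linarith [h 1 2]
    · linarith [h 2 0]
    · linarith [h 0 1]

lemma exists_ne_zero {x : Point} (h : x ≠ 0) : ∃ i, x i ≠ 0 := Function.ne_iff.mp h

lemma isCollinear_iff (x y : Point) : IsCollinear x y ↔ x ⨯₃ y = 0 := by
  rw [IsCollinear, LinearIndependent.pair_iff, cross_eq_zero_iff]
  constructor
  · intro h i j
    push Not at h
    obtain ⟨s, t, hst, hne⟩ := h
    have hi := congrFun hst i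
    have hj := congrFun hst j
    simp only [Pi.add_apply, Pi.smul_apply, smul_eq_mul, Pi.zero_apply] at hi hj
    have hs : s * (x i * y j - x j * y i) = 0 := by linear_combination y j * hi - y i * hj
    have ht : t * (x i * y j - x j * y i) = 0 := by linear_combination x i * hj - x j * hi
    by_cases h0 : s = 0
    · rcases mul_eq_zero.mp ht with h1 | h1
      · exact absurd h1 (hne h0)
      · linarith
    · rcases mul_eq_zero.mp hs with h1 | h1
      · exact absurd h1 h0
      · linarith
  · intro h hind
    by_cases hx : x = 0
    · have := hind 1 0 (by simp [hx])
      simp at this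
    · obtain ⟨i, hi⟩ := exists_ne_zero hx
      have := hind (y i) (-x i) (by
        ext j
        simp only [Pi.add_apply, Pi.smul_apply, smul_eq_mul, Pi.zero_apply]
        linarith [h i j])
      exact hi (neg_eq_zero.mp this.2)

lemma not_linearIndependent_triple_iff (x y z : Point) :
    ¬ LinearIndependent ℤ ![x, y, z] ↔ (x ⨯₃ y) ⬝ᵥ z = 0 := by
  have hdet : (Matrix.of ![x, y, z]).det = (x ⨯₃ y) ⬝ᵥ z := by
    rw [Matrix.det_fin_three]
    simp only [Matrix.of_apply, cross_apply, vec3_dotProduct, cons_val]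
    ring
  rw [← hdet, ← Matrix.exists_vecMul_eq_zero_iff, Fintype.linearIndependent_iff]
  push Not
  have key : ∀ g : Fin 3 → ℤ, g ᵥ* (Matrix.of ![x, y, z]) = ∑ i, g i • ![x, y, z] i := by
    intro g
    ext j
    simp [Matrix.vecMul, dotProduct, Fin.sum_univ_three]
  constructor
  · rintro ⟨g, hg, i, hi⟩
    exact ⟨g, fun h => hi (by simp [h]), by rw [key, hg]⟩
  · rintro ⟨g, hg, hg'⟩
    exact ⟨g, by rw [← key, hg'], exists_ne_zero hg⟩

/-- If `q` is orthogonal to two independent points of the plane with normal vector `p`, then it is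
orthogonal to the whole plane. -/
lemma dot_eq_zero_of_normal {p q x y z : Point} (hp : p ≠ 0) (hpx : p ⬝ᵥ x = 0)
    (hpy : p ⬝ᵥ y = 0) (hxy : x ⨯₃ y ≠ 0) (hqx : q ⬝ᵥ x = 0) (hqy : q ⬝ᵥ y = 0)
    (hpz : p ⬝ᵥ z = 0) : q ⬝ᵥ z = 0 := by
  have key : ∀ r : Point, r ⬝ᵥ x = 0 → r ⬝ᵥ y = 0 → r ⨯₃ (x ⨯₃ y) = 0 := by
    intro r h1 h2
    simp only [vec3_dotProduct] at h1 h2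
    apply point_ext <;> simp only [cross_apply, cons_val, Pi.zero_apply]
    · linear_combination x 0 * h2 - y 0 * h1
    · linear_combination x 1 * h2 - y 1 * h1
    · linear_combination x 2 * h2 - y 2 * h1
  have h1 := (cross_eq_zero_iff _ _).mp (key p hpx hpy)
  have h2 := (cross_eq_zero_iff _ _).mp (key q hqx hqy)
  set n := x ⨯₃ y
  obtain ⟨i, hi⟩ := exists_ne_zero hxy
  have hpi : p i ≠ 0 := by
    intro h0
    apply hp
    ext j
    have := h1 j i
    rw [h0, zero_mul] at this
    exact (mul_eq_zero.mp this).resolve_right hi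
  have hn : n ⬝ᵥ z = 0 := by
    have : p i * (n ⬝ᵥ z) = n i * (p ⬝ᵥ z) := by
      simp only [vec3_dotProduct]
      linear_combination z 0 * h1 i 0 + z 1 * h1 i 1 + z 2 * h1 i 2
    rw [hpz, mul_zero] at this
    exact (mul_eq_zero.mp this).resolve_left hpi
  have : n i * (q ⬝ᵥ z) = q i * (n ⬝ᵥ z) := by
    simp only [vec3_dotProduct]
    linear_combination - z 0 * h2 i 0 - z 1 * h2 i 1 - z 2 * h2 i 2
  rw [hn, mul_zero] at this
  exact (mul_eq_zero.mp this).resolve_left hi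

lemma cross_dot_left (x y : Point) : (x ⨯₃ y) ⬝ᵥ x = 0 := by
  simp only [cross_apply, vec3_dotProduct, cons_val]; ring

lemma cross_dot_right (x y : Point) : (x ⨯₃ y) ⬝ᵥ y = 0 := by
  simp only [cross_apply, vec3_dotProduct, cons_val]; ring

lemma cross_dot_rotate (x y z : Point) : (x ⨯₃ y) ⬝ᵥ z = (y ⨯₃ z) ⬝ᵥ x := by
  simp only [cross_apply, vec3_dotProduct, cons_val]; ring

lemma cross_comm_eq_zero {x y : Point} (h : x ⨯₃ y = 0) : y ⨯₃ x = 0 := by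
  rw [cross_eq_zero_iff] at h ⊢
  intro i j
  linarith [h j i]

lemma cross_trans {x y z : Point} (hy : y ≠ 0) (h1 : x ⨯₃ y = 0) (h2 : y ⨯₃ z = 0) :
    x ⨯₃ z = 0 := by
  rw [cross_eq_zero_iff] at h1 h2 ⊢
  obtain ⟨k, hk⟩ := exists_ne_zero hy
  intro i j
  apply mul_left_cancel₀ (mul_ne_zero hk hk)
  have e1 := h1 i k
  have e2 := h1 j k
  have e3 := h2 k j
  have e4 := h2 k i
  calc y k * y k * (x i * z j) = (x i * y k) * (y k * z j) := by ring
    _ = (x k * y i) * (y j * z k) := by rw [e1, e3]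
    _ = (x k * y j) * (y i * z k) := by ring
    _ = (x j * y k) * (y k * z i) := by rw [← e2, ← e4]
    _ = _ := by ring

/-- A plane through a nonzero point `x` contains every point collinear to `x`. -/
lemma dot_eq_zero_of_cross {p x y : Point} (hx : x ≠ 0) (h : x ⨯₃ y = 0) (hp : p ⬝ᵥ x = 0) :
    p ⬝ᵥ y = 0 := by
  rw [cross_eq_zero_iff] at h
  obtain ⟨k, hk⟩ := exists_ne_zero hx
  have : x k * (p ⬝ᵥ y) = y k * (p ⬝ᵥ x) := by
    simp only [vec3_dotProduct]
    linear_combination p 0 * h k 0 + p 1 * h k 1 + p 2 * h k 2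
  rw [hp, mul_zero] at this
  exact (mul_eq_zero.mp this).resolve_left hk

lemma IsPrimitivePoint.exists_dot_eq_one {x : Point} (hx : IsPrimitivePoint x) :
    ∃ t : Point, t ⬝ᵥ x = 1 := by
  have hu := hx (Int.gcd (Int.gcd (x 0) (x 1)) (x 2)) (by
    have h1 := Int.gcd_dvd_left (a := (Int.gcd (x 0) (x 1) : ℤ)) (b := x 2)
    have h2 := Int.gcd_dvd_right (a := (Int.gcd (x 0) (x 1) : ℤ)) (b := x 2)
    intro j
    fin_cases j
    · exact h1.trans (Int.gcd_dvd_left ..)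
    · exact h1.trans (Int.gcd_dvd_right ..)
    · exact h2)
  have h1 : Int.gcd (Int.gcd (x 0) (x 1)) (x 2) = 1 := by
    rcases Int.isUnit_iff.mp hu with h | h <;> omega
  have e1 := Int.gcd_eq_gcd_ab (Int.gcd (x 0) (x 1)) (x 2)
  rw [h1] at e1
  have e2 := Int.gcd_eq_gcd_ab (x 0) (x 1)
  set a := Int.gcdA (Int.gcd (x 0) (x 1)) (x 2)
  set b := Int.gcdB (Int.gcd (x 0) (x 1)) (x 2)
  refine ⟨![a * Int.gcdA (x 0) (x 1), a * Int.gcdB (x 0) (x 1), b], ?_⟩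
  simp only [vec3_dotProduct, cons_val]
  push_cast at e1
  linear_combination -e1 - a * e2

lemma IsPrimitivePoint.ne_zero {x : Point} (hx : IsPrimitivePoint x) : x ≠ 0 := by
  rintro rfl
  obtain ⟨t, ht⟩ := hx.exists_dot_eq_one
  simp at ht

lemma IsPrimitivePoint.exists_eq_smul {x w : Point} (hx : IsPrimitivePoint x)
    (h : x ⨯₃ w = 0) : ∃ m : ℤ, w = m • x := by
  obtain ⟨t, ht⟩ := hx.exists_dot_eq_one
  rw [cross_eq_zero_iff] at h
  refine ⟨t ⬝ᵥ w, ?_⟩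
  ext j
  simp only [vec3_dotProduct, Pi.smul_apply, smul_eq_mul] at ht ⊢
  linear_combination - w j * ht + t 0 * h 0 j + t 1 * h 1 j + t 2 * h 2 j

lemma IsPrimitivePoint.eq_of_cross {x y : Point} (hx : IsPrimitivePoint x)
    (hy : IsPrimitivePoint y) (hx0 : 0 < x 0) (hy0 : 0 < y 0) (h : x ⨯₃ y = 0) : x = y := by
  obtain ⟨m, rfl⟩ := hx.exists_eq_smul h
  have hm : IsUnit m := hy m (fun j => ⟨x j, by simp⟩)
  have : 0 < m := by
    simp only [Pi.smul_apply, smul_eq_mul] at hy0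
    exact pos_of_mul_pos_left hy0 hx0.le
  rcases Int.isUnit_iff.mp hm with h | h
  · simp [h]
  · omega

/-- The primitive point with positive first coordinate on the line spanned by `w`. -/
lemma exists_primitive {w : Point} (hw : w 0 ≠ 0) :
    ∃ (m : ℤ) (x : Point), IsPrimitivePoint x ∧ 0 < x 0 ∧ m ≠ 0 ∧ w = m • x := by
  obtain ⟨n, ⟨x, hx0, hxw, hxn⟩, hmin⟩ := Int.exists_least_of_bdd
    (P := fun n => ∃ x : Point, 0 < x 0 ∧ x ⨯₃ w = 0 ∧ x 0 = n)
    ⟨0, fun z ⟨x, h, _, h'⟩ => by omega⟩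
    (by
      rcases lt_or_gt_of_ne hw with h | h
      · exact ⟨_, -w, by simpa using h, by simp, rfl⟩
      · exact ⟨_, w, h, by simp, rfl⟩)
  have hprim : IsPrimitivePoint x := by
    intro d hd
    have hd0 : d ≠ 0 := by
      rintro rfl
      have := hd 0
      rw [zero_dvd_iff] at this
      omega
    choose c hc using hd
    have key : ∀ e : ℤ, e ≠ 0 → ∀ c : Point, (∀ j, x j = e * c j) → 0 < c 0 → x 0 ≤ c 0 := by
      intro e he c hc hc0
      rw [hxn]
      refine hmin _ ⟨c, hc0, ?_, rfl⟩
      rw [cross_eq_zero_iff] at hxw ⊢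
      intro i j
      apply mul_left_cancel₀ he
      have := hxw i j
      rw [hc i, hc j] at this
      linarith
    rw [Int.isUnit_iff]
    have hx0' := hc 0
    rcases lt_or_gt_of_ne hd0 with h | h
    · have h1 : 0 < -c 0 := by
        by_contra hcon
        have : d * c 0 ≤ 0 := mul_nonpos_of_nonpos_of_nonneg h.le (by omega)
        omega
      have := key (-d) (by omega) (-c) (fun j => by simp [hc j]) h1
      simp only [Pi.neg_apply] at this
      right
      nlinarith
    · have h1 : 0 < c 0 := by
        by_contra hcon
        have : d * c 0 ≤ 0 := mul_nonpos_of_nonneg_of_nonpos h.le (by omega)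
        omega
      have := key d hd0 c hc h1
      left
      nlinarith
  obtain ⟨m, hm⟩ := hprim.exists_eq_smul hxw
  refine ⟨m, x, hprim, hx0, ?_, hm⟩
  rintro rfl
  apply hw
  rw [hm]; simp

/-! ### Elementary estimates -/

/-- The value `p₀ + p₁ ξ + p₂ ξ²`. -/
noncomputable def evalAt (ξ : ℝ) (p : Point) : ℝ := p 0 + p 1 * ξ + p 2 * ξ ^ 2

/-- A constant that bounds `1`, `|ξ|` and `ξ²`. -/
noncomputable def bnd (ξ : ℝ) : ℝ := 1 + |ξ| + ξ ^ 2

lemma one_le_bnd (ξ : ℝ) : 1 ≤ bnd ξ := by unfold bnd; nlinarith [abs_nonneg ξ, sq_nonneg ξ]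

lemma abs_le_L_one (ξ : ℝ) (x : Point) : |(x 0 : ℝ) * ξ - x 1| ≤ L ξ x := le_max_left _ _

lemma abs_le_L_two (ξ : ℝ) (x : Point) : |(x 0 : ℝ) * ξ ^ 2 - x 2| ≤ L ξ x := le_max_right _ _

lemma L_nonneg (ξ : ℝ) (x : Point) : 0 ≤ L ξ x := (abs_nonneg _).trans (abs_le_L_one ξ x)

lemma L_smul (ξ : ℝ) (m : ℤ) (x : Point) : L ξ (m • x) = |(m : ℝ)| * L ξ x := by
  simp only [L, Pi.smul_apply, smul_eq_mul, Int.cast_mul]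
  rw [mul_max_of_nonneg _ _ (abs_nonneg _), ← abs_mul, ← abs_mul]
  ring_nf

lemma evalAt_ne_zero {ξ : ℝ} (hξ : IrrationalNonQuadratic ξ) {p : Point} (hp : p ≠ 0) :
    evalAt ξ p ≠ 0 := by
  have h := hξ (Polynomial.C (p 2 : ℚ) * Polynomial.X ^ 2 + Polynomial.C (p 1 : ℚ) * Polynomial.X
    + Polynomial.C (p 0 : ℚ)) ?_ Polynomial.natDegree_quadratic_le
  · intro h0
    apply h
    simp only [map_add, map_mul, map_pow, Polynomial.aeval_X, Polynomial.aeval_C, eq_ratCast,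
      Rat.cast_intCast]
    rw [← h0, evalAt]; ring
  · intro h0
    apply hp
    have c0 := congrArg (fun q => Polynomial.coeff q 0) h0
    have c1 := congrArg (fun q => Polynomial.coeff q 1) h0
    have c2 := congrArg (fun q => Polynomial.coeff q 2) h0
    simp only [Polynomial.coeff_add, Polynomial.coeff_C_mul, Polynomial.coeff_X_pow,
      Polynomial.coeff_X, Polynomial.coeff_C, Polynomial.coeff_zero] at c0 c1 c2
    norm_num at c0 c1 c2
    exact point_ext c0 c1 c2

lemma L_pos {ξ : ℝ} (hξ : IrrationalNonQuadratic ξ) {x : Point} (hx : x ≠ 0) : 0 < L ξ x := by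
  refine lt_of_le_of_ne (L_nonneg _ _) fun h => ?_
  have h1 := abs_le_L_one ξ x
  have h2 := abs_le_L_two ξ x
  rw [← h, abs_nonpos_iff] at h1 h2
  have hz : ![-x 1, x 0, 0] = (0 : Point) := by
    by_contra hne
    apply evalAt_ne_zero hξ hne
    simp only [evalAt, cons_val]
    push_cast; linarith
  have e0 : x 0 = 0 := by simpa using congrFun hz 1
  have e1 : x 1 = 0 := by simpa using congrFun hz 0
  have e2 : x 2 = 0 := by
    rw [e0] at h2; simpa using h2
  exact hx (point_ext e0 e1 e2)

lemma abs_coord_le_norm (p : Point) (i : Fin 3) : |(p i : ℝ)| ≤ ‖p‖ := by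
  have := norm_le_pi_norm p i
  rwa [Int.norm_eq_abs] at this

lemma norm_le_of_coords {p : Point} {r : ℝ} (h : ∀ i, |(p i : ℝ)| ≤ r) : ‖p‖ ≤ r := by
  rw [pi_norm_le_iff_of_nonneg ((abs_nonneg _).trans (h 0))]
  intro i
  rw [Int.norm_eq_abs]; exact h i

lemma one_le_norm {p : Point} (hp : p ≠ 0) : 1 ≤ ‖p‖ := by
  obtain ⟨i, hi⟩ := exists_ne_zero hp
  refine le_trans ?_ (abs_coord_le_norm p i)
  rw [← Int.cast_abs]
  exact_mod_cast Int.one_le_abs hi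

/-- `p · x` is close to `x₀ (p₀ + p₁ ξ + p₂ ξ²)`. -/
lemma abs_dot_sub_le (ξ : ℝ) (p x : Point) :
    |((p ⬝ᵥ x : ℤ) : ℝ) - x 0 * evalAt ξ p| ≤ 2 * ‖p‖ * L ξ x := by
  have e : ((p ⬝ᵥ x : ℤ) : ℝ) - x 0 * evalAt ξ p
      = -(p 1 * (x 0 * ξ - x 1)) - p 2 * (x 0 * ξ ^ 2 - x 2) := by
    simp only [vec3_dotProduct, evalAt]; push_cast; ring
  rw [e]
  have h1 : |(p 1 : ℝ) * (x 0 * ξ - x 1)| ≤ ‖p‖ * L ξ x := by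
    rw [abs_mul]
    exact mul_le_mul (abs_coord_le_norm p 1) (abs_le_L_one ξ x) (abs_nonneg _) (norm_nonneg _)
  have h2 : |(p 2 : ℝ) * (x 0 * ξ ^ 2 - x 2)| ≤ ‖p‖ * L ξ x := by
    rw [abs_mul]
    exact mul_le_mul (abs_coord_le_norm p 2) (abs_le_L_two ξ x) (abs_nonneg _) (norm_nonneg _)
  have := abs_sub (-((p 1 : ℝ) * (x 0 * ξ - x 1))) (p 2 * (x 0 * ξ ^ 2 - x 2))
  rw [abs_neg] at this
  linarith

lemma abs_evalAt_le (ξ : ℝ) {p x : Point} (h : p ⬝ᵥ x = 0) :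
    |(x 0 : ℝ)| * |evalAt ξ p| ≤ 2 * ‖p‖ * L ξ x := by
  have := abs_dot_sub_le ξ p x
  rw [h, Int.cast_zero, zero_sub, abs_neg, abs_mul] at this
  exact this

lemma one_le_of_dot_ne_zero (ξ : ℝ) {p x : Point} (h : p ⬝ᵥ x ≠ 0) :
    1 ≤ |(x 0 : ℝ)| * |evalAt ξ p| + 2 * ‖p‖ * L ξ x := by
  have h1 : (1 : ℝ) ≤ |((p ⬝ᵥ x : ℤ) : ℝ)| := by
    rw [← Int.cast_abs]; exact_mod_cast Int.one_le_abs h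
  have h2 := abs_dot_sub_le ξ p x
  have h3 := abs_sub_abs_le_abs_sub ((p ⬝ᵥ x : ℤ) : ℝ) (x 0 * evalAt ξ p)
  rw [abs_mul] at h3
  linarith

/-- Two approximation points `x`, `y` span a plane whose height is governed by
`X L(y) + Y L(x)`. -/
lemma norm_cross_le (ξ : ℝ) (x y : Point) :
    ‖x ⨯₃ y‖ ≤ bnd ξ * (|(x 0 : ℝ)| * L ξ y + |(y 0 : ℝ)| * L ξ x) + 2 * (L ξ x * L ξ y) := by
  have hb : bnd ξ = 1 + |ξ| + ξ ^ 2 := rfl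
  obtain ⟨d1, hd1⟩ : ∃ d : ℝ, d = x 0 * ξ - x 1 := ⟨_, rfl⟩
  obtain ⟨d2, hd2⟩ : ∃ d : ℝ, d = x 0 * ξ ^ 2 - x 2 := ⟨_, rfl⟩
  obtain ⟨e1, he1⟩ : ∃ d : ℝ, d = y 0 * ξ - y 1 := ⟨_, rfl⟩
  obtain ⟨e2, he2⟩ : ∃ d : ℝ, d = y 0 * ξ ^ 2 - y 2 := ⟨_, rfl⟩
  have a1 : |d1| ≤ L ξ x := hd1 ▸ abs_le_L_one ξ x
  have a2 : |d2| ≤ L ξ x := hd2 ▸ abs_le_L_two ξ x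
  have b1 : |e1| ≤ L ξ y := he1 ▸ abs_le_L_one ξ y
  have b2 : |e2| ≤ L ξ y := he2 ▸ abs_le_L_two ξ y
  have x1 : (x 1 : ℝ) = x 0 * ξ - d1 := by rw [hd1]; ring
  have x2 : (x 2 : ℝ) = x 0 * ξ ^ 2 - d2 := by rw [hd2]; ring
  have y1 : (y 1 : ℝ) = y 0 * ξ - e1 := by rw [he1]; ring
  have y2 : (y 2 : ℝ) = y 0 * ξ ^ 2 - e2 := by rw [he2]; ring
  have hx := L_nonneg ξ x
  have hy := L_nonneg ξ y
  have bd : ∀ s t S T : ℝ, |s| ≤ S → |t| ≤ T → |s * t| ≤ S * T := by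
    intro s t S T h1 h2
    rw [abs_mul]; exact mul_le_mul h1 h2 (abs_nonneg _) ((abs_nonneg _).trans h1)
  have A1 := bd _ _ _ _ (le_refl |(x 0 : ℝ)|) b1
  have A2 := bd _ _ _ _ (le_refl |(x 0 : ℝ)|) b2
  have B1 := bd _ _ _ _ (le_refl |(y 0 : ℝ)|) a1
  have B2 := bd _ _ _ _ (le_refl |(y 0 : ℝ)|) a2
  have P12 := bd _ _ _ _ a1 b2
  have P21 := bd _ _ _ _ a2 b1
  have P11 := bd _ _ _ _ a1 b1
  set X := |(x 0 : ℝ)| * L ξ y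
  set Y := |(y 0 : ℝ)| * L ξ x
  have hX : 0 ≤ X := by positivity
  have hY : 0 ≤ Y := by positivity
  have hP : 0 ≤ L ξ x * L ξ y := by positivity
  have m1 : ∀ s S : ℝ, |s| ≤ S → |ξ * s| ≤ |ξ| * S := fun s S h => bd _ _ _ _ le_rfl h
  have m2 : ∀ s S : ℝ, |s| ≤ S → |ξ ^ 2 * s| ≤ ξ ^ 2 * S := fun s S h =>
    bd _ _ _ _ (abs_of_nonneg (sq_nonneg ξ)).le h
  apply norm_le_of_coords
  intro i
  fin_cases i
  · have e : (((x ⨯₃ y) 0 : ℤ) : ℝ) = ξ ^ 2 * (x 0 * e1) - ξ * (x 0 * e2) + ξ * (y 0 * d2)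
        - ξ ^ 2 * (y 0 * d1) + d1 * e2 - d2 * e1 := by
      simp only [cross_apply, cons_val]; push_cast
      rw [x1, x2, y1, y2]; ring
    change |(((x ⨯₃ y) 0 : ℤ) : ℝ)| ≤ _
    rw [e, hb]
    obtain ⟨l1, r1⟩ := abs_le.mp (m2 _ _ A1)
    obtain ⟨l2, r2⟩ := abs_le.mp (m1 _ _ A2)
    obtain ⟨l3, r3⟩ := abs_le.mp (m1 _ _ B2)
    obtain ⟨l4, r4⟩ := abs_le.mp (m2 _ _ B1)
    obtain ⟨l5, r5⟩ := abs_le.mp P12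
    obtain ⟨l6, r6⟩ := abs_le.mp P21
    rw [abs_le]
    constructor <;> linarith
  · have e : (((x ⨯₃ y) 1 : ℤ) : ℝ) = x 0 * e2 - y 0 * d2 := by
      simp only [cross_apply, cons_val]; push_cast
      rw [x2, y2]; ring
    change |(((x ⨯₃ y) 1 : ℤ) : ℝ)| ≤ _
    rw [e, hb]
    have z1 : 0 ≤ (|ξ| + ξ ^ 2) * (X + Y) := by positivity
    obtain ⟨l1, r1⟩ := abs_le.mp A2
    obtain ⟨l2, r2⟩ := abs_le.mp B2
    rw [abs_le]
    constructor <;> linarith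
  · have e : (((x ⨯₃ y) 2 : ℤ) : ℝ) = y 0 * d1 - x 0 * e1 := by
      simp only [cross_apply, cons_val]; push_cast
      rw [x1, y1]; ring
    change |(((x ⨯₃ y) 2 : ℤ) : ℝ)| ≤ _
    rw [e, hb]
    have z1 : 0 ≤ (|ξ| + ξ ^ 2) * (X + Y) := by positivity
    obtain ⟨l1, r1⟩ := abs_le.mp A1
    obtain ⟨l2, r2⟩ := abs_le.mp B1
    rw [abs_le]
    constructor <;> linarith

lemma abs_pdet_le (ξ : ℝ) (x : Point) :
    |(pdet x : ℝ)| ≤ 2 * bnd ξ * |(x 0 : ℝ)| * L ξ x + L ξ x ^ 2 := by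
  have hb : bnd ξ = 1 + |ξ| + ξ ^ 2 := rfl
  have e : (pdet x : ℝ) = x 0 * (2 * (ξ * (x 0 * ξ - x 1)) - (x 0 * ξ ^ 2 - x 2))
      - (x 0 * ξ - x 1) ^ 2 := by
    simp only [pdet]; push_cast; ring
  have h1 := abs_le_L_one ξ x
  have h2 := abs_le_L_two ξ x
  have hL := L_nonneg ξ x
  have h3 : |(2 * (ξ * (x 0 * ξ - x 1)) - (x 0 * ξ ^ 2 - x 2))| ≤ 2 * bnd ξ * L ξ x := by
    have m1 : |ξ * (x 0 * ξ - x 1)| ≤ |ξ| * L ξ x := by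
      rw [abs_mul]; exact mul_le_mul_of_nonneg_left h1 (abs_nonneg _)
    have z : 0 ≤ ξ ^ 2 * L ξ x := by positivity
    rw [hb]
    rw [abs_le] at *
    constructor <;> nlinarith
  have h4 : |(x 0 : ℝ) * (2 * (ξ * (x 0 * ξ - x 1)) - (x 0 * ξ ^ 2 - x 2))|
      ≤ |(x 0 : ℝ)| * (2 * bnd ξ * L ξ x) := by
    rw [abs_mul]; exact mul_le_mul_of_nonneg_left h3 (abs_nonneg _)
  have h5 : |(x 0 * ξ - x 1 : ℝ) ^ 2| ≤ L ξ x ^ 2 := by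
    rw [abs_pow]; exact pow_le_pow_left₀ (abs_nonneg _) h1 2
  rw [e]
  refine (abs_sub _ _).trans ?_
  linarith

/-- The value at `ξ` of the plane spanned by `x` and `y` is at most `2 L(x) L(y)`. -/
lemma abs_evalAt_cross_le (ξ : ℝ) (x y : Point) :
    |evalAt ξ (x ⨯₃ y)| ≤ 2 * (L ξ x * L ξ y) := by
  have e : evalAt ξ (x ⨯₃ y) = (x 0 * ξ - x 1) * (y 0 * ξ ^ 2 - y 2)
      - (x 0 * ξ ^ 2 - x 2) * (y 0 * ξ - y 1) := by
    simp only [evalAt, cross_apply, cons_val]; push_cast; ring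
  rw [e]
  refine (abs_sub _ _).trans ?_
  rw [abs_mul, abs_mul]
  have h1 := mul_le_mul (abs_le_L_one ξ x) (abs_le_L_two ξ y) (abs_nonneg _) (L_nonneg ξ x)
  have h2 := mul_le_mul (abs_le_L_two ξ x) (abs_le_L_one ξ y) (abs_nonneg _) (L_nonneg ξ x)
  linarith

lemma coord_zero_le_norm (x : Point) : (x 0 : ℝ) ≤ ‖x‖ :=
  (le_abs_self _).trans (abs_coord_le_norm x 0)

lemma norm_le_bnd_mul {ξ : ℝ} {x : Point} (hx : 1 ≤ x 0) (hL : L ξ x ≤ 1) :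
    ‖x‖ ≤ bnd ξ * x 0 := by
  have hb : bnd ξ = 1 + |ξ| + ξ ^ 2 := rfl
  have hx' : (1 : ℝ) ≤ x 0 := by exact_mod_cast hx
  have h1 := (abs_le_L_one ξ x).trans hL
  have h2 := (abs_le_L_two ξ x).trans hL
  have z1 : 0 ≤ |ξ| * (x 0 : ℝ) := by positivity
  have z2 : 0 ≤ ξ ^ 2 * (x 0 : ℝ) := by positivity
  have z3 : |(x 0 : ℝ) * ξ| = |ξ| * x 0 := by rw [abs_mul, abs_of_pos (by linarith)]; ring
  apply norm_le_of_coords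
  intro i
  rw [hb]
  fin_cases i
  · change |(x 0 : ℝ)| ≤ _
    rw [abs_of_pos (by linarith)]; nlinarith
  · change |(x 1 : ℝ)| ≤ _
    have := abs_sub_abs_le_abs_sub (x 1 : ℝ) (x 0 * ξ)
    rw [abs_sub_comm] at this
    nlinarith
  · change |(x 2 : ℝ)| ≤ _
    rw [abs_le] at *
    constructor <;> nlinarith

/-! ### Minimal points -/

lemma isMinimalPoint_iff {ξ : ℝ} {a : Point} : IsMinimalPoint ξ a ↔
    1 ≤ a 0 ∧ L ξ a ≤ 1 ∧ ∀ b : Point, 1 ≤ b 0 → b 0 ≤ a 0 → L ξ b ≤ 1 → L ξ a ≤ L ξ b := by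
  constructor
  · rintro ⟨X, hX, ⟨h1, h2, h3⟩, h⟩
    refine ⟨by exact_mod_cast h1, h3, fun b hb hba hL => h b (by exact_mod_cast hb) ?_ hL⟩
    exact le_trans (by exact_mod_cast hba) h2
  · rintro ⟨h1, h2, h⟩
    refine ⟨a 0, by exact_mod_cast h1, ⟨by exact_mod_cast h1, le_rfl, h2⟩, fun b hb hba hL => ?_⟩
    exact h b (by exact_mod_cast hb) (by exact_mod_cast hba) hL

lemma IsMinimalPoint.one_le {ξ : ℝ} {a : Point} (h : IsMinimalPoint ξ a) : 1 ≤ a 0 :=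
  (isMinimalPoint_iff.mp h).1

lemma IsMinimalPoint.one_le_cast {ξ : ℝ} {a : Point} (h : IsMinimalPoint ξ a) :
    (1 : ℝ) ≤ a 0 := by exact_mod_cast h.one_le

lemma IsMinimalPoint.ne_zero {ξ : ℝ} {a : Point} (h : IsMinimalPoint ξ a) : a ≠ 0 := by
  rintro rfl
  have := h.one_le
  simp at this

lemma IsMinimalPoint.L_le_one {ξ : ℝ} {a : Point} (h : IsMinimalPoint ξ a) : L ξ a ≤ 1 :=
  (isMinimalPoint_iff.mp h).2.1

lemma IsMinimalPoint.le {ξ : ℝ} {a b : Point} (h : IsMinimalPoint ξ a) (hb : 1 ≤ b 0)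
    (hba : b 0 ≤ a 0) : L ξ a ≤ L ξ b := by
  by_cases hL : L ξ b ≤ 1
  · exact (isMinimalPoint_iff.mp h).2.2 b hb hba hL
  · linarith [h.L_le_one]

/-- The point with first coordinate `1` closest to `(1, ξ, ξ²)`. -/
noncomputable def nearestPoint (ξ : ℝ) : Point := ![1, round ξ, round (ξ ^ 2)]

lemma L_nearestPoint (ξ : ℝ) : L ξ (nearestPoint ξ) ≤ 1 / 2 := by
  apply max_le <;> simp only [nearestPoint, cons_val, Int.cast_one, one_mul] <;>
    exact abs_sub_round _

lemma IsMinimalPoint.L_le_half {ξ : ℝ} {a : Point} (h : IsMinimalPoint ξ a) :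
    L ξ a ≤ 1 / 2 :=
  (h.le (b := nearestPoint ξ) (by simp [nearestPoint])
    (by simpa [nearestPoint] using h.one_le)).trans (L_nearestPoint ξ)

lemma finite_points_le (ξ : ℝ) (n : ℤ) : {b : Point | 1 ≤ b 0 ∧ b 0 ≤ n ∧ L ξ b ≤ 1}.Finite := by
  apply (Set.finite_Icc (fun _ => -⌈bnd ξ * n⌉ : Point) (fun _ => ⌈bnd ξ * n⌉ : Point)).subset
  rintro b ⟨h1, h2, h3⟩
  have hn := norm_le_bnd_mul h1 h3
  have key : ∀ j, |b j| ≤ ⌈bnd ξ * n⌉ := by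
    intro j
    have e1 := abs_coord_le_norm b j
    have e2 : bnd ξ * b 0 ≤ bnd ξ * n :=
      mul_le_mul_of_nonneg_left (by exact_mod_cast h2) (by linarith [one_le_bnd ξ])
    have : ((|b j| : ℤ) : ℝ) ≤ (⌈bnd ξ * n⌉ : ℤ) := by
      rw [Int.cast_abs]
      exact (e1.trans (hn.trans e2)).trans (Int.le_ceil _)
    exact_mod_cast this
  exact ⟨fun j => (abs_le.mp (key j)).1, fun j => (abs_le.mp (key j)).2⟩

/-- The minimal point corresponding to `X = n`. -/
lemma exists_minimalPoint (ξ : ℝ) {n : ℤ} (hn : 1 ≤ n) :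
    ∃ a, IsMinimalPoint ξ a ∧ a 0 ≤ n ∧ ∀ b : Point, 1 ≤ b 0 → b 0 ≤ n → L ξ a ≤ L ξ b := by
  obtain ⟨a, ⟨h1, h2, h3⟩, hmin⟩ := Set.exists_min_image _ (L ξ) (finite_points_le ξ n)
    ⟨nearestPoint ξ, by simp [nearestPoint], by simpa [nearestPoint] using hn,
      (L_nearestPoint ξ).trans (by norm_num)⟩
  refine ⟨a, isMinimalPoint_iff.mpr ⟨h1, h3, fun b hb hba hL => hmin b ⟨hb, hba.trans h2, hL⟩⟩,
    h2, fun b hb hbn => ?_⟩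
  by_cases hL : L ξ b ≤ 1
  · exact hmin b ⟨hb, hbn, hL⟩
  · linarith

/-- A nonzero integer multiple of `ξ` or `ξ²` is never a half-integer, so the nearest integer is
unique. -/
lemma eq_of_first_eq {ξ : ℝ} (hξ : IrrationalNonQuadratic ξ) {a b : Point} (h0 : a 0 = b 0)
    (ha1 : 1 ≤ a 0) (ha : L ξ a ≤ 1 / 2) (hb : L ξ b ≤ 1 / 2) : a = b := by
  have key : ∀ (t : ℝ) (m n : ℤ), |t - m| ≤ 1 / 2 → |t - n| ≤ 1 / 2 → (∀ k : ℤ, 2 * t ≠ k) →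
      m = n := by
    intro t m n h1 h2 h3
    by_contra hne
    rw [abs_le] at h1 h2
    have h4 : |((m - n : ℤ) : ℝ)| ≤ 1 := by
      push_cast; rw [abs_le]; constructor <;> linarith
    have h5 : |m - n| ≤ 1 := by rw [← Int.cast_abs] at h4; exact_mod_cast h4
    have h6 : m - n ≠ 0 := sub_ne_zero.mpr hne
    have h7 : m = n + 1 ∨ n = m + 1 := by
      rw [abs_le] at h5; omega
    rcases h7 with rfl | rfl
    · push_cast at h1
      exact h3 (2 * n + 1) (by push_cast; linarith)
    · push_cast at h2
      exact h3 (2 * m + 1) (by push_cast; linarith)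
  refine point_ext h0 (key (a 0 * ξ) _ _ ((abs_le_L_one ξ a).trans ha) ?_ ?_)
    (key (a 0 * ξ ^ 2) _ _ ((abs_le_L_two ξ a).trans ha) ?_ ?_)
  · rw [h0]; exact (abs_le_L_one ξ b).trans hb
  · intro k hk
    have hne : (![-k, 2 * a 0, 0] : Point) ≠ 0 := fun h => by
      have := congrFun h 1
      simp at this; omega
    apply evalAt_ne_zero hξ hne
    simp only [evalAt, cons_val]; push_cast; linarith
  · rw [h0]; exact (abs_le_L_two ξ b).trans hb
  · intro k hk
    have hne : (![-k, 0, 2 * a 0] : Point) ≠ 0 := fun h => by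
      have := congrFun h 2
      simp at this; omega
    apply evalAt_ne_zero hξ hne
    simp only [evalAt, cons_val]; push_cast; linarith

lemma first_eq_of_L_eq {ξ : ℝ} (hξ : IrrationalNonQuadratic ξ) {a b : Point} (ha1 : 1 ≤ a 0)
    (hb1 : 1 ≤ b 0) (h : L ξ a = L ξ b) : a 0 = b 0 := by
  have key : ∀ p : Point, evalAt ξ p = 0 → p = 0 := fun p hp => by
    by_contra hne; exact evalAt_ne_zero hξ hne hp
  have hcase : ∀ x : Point, L ξ x = |(x 0 : ℝ) * ξ - x 1| ∨ L ξ x = |(x 0 : ℝ) * ξ ^ 2 - x 2| :=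
    fun x => max_choice _ _
  rcases hcase a with ea | ea <;> rcases hcase b with eb | eb <;> rw [ea, eb] at h <;>
    rcases abs_eq_abs.mp h with h | h
  · have := congrFun (key ![b 1 - a 1, a 0 - b 0, 0]
      (by simp only [evalAt, cons_val]; push_cast; linarith)) 1
    simp at this; omega
  · have := congrFun (key ![-b 1 - a 1, a 0 + b 0, 0]
      (by simp only [evalAt, cons_val]; push_cast; linarith)) 1
    simp at this; omega
  · have := congrFun (key ![b 2 - a 1, a 0, -b 0]
      (by simp only [evalAt, cons_val]; push_cast; linarith)) 1
    simp at this; omega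
  · have := congrFun (key ![-b 2 - a 1, a 0, b 0]
      (by simp only [evalAt, cons_val]; push_cast; linarith)) 1
    simp at this; omega
  · have := congrFun (key ![b 1 - a 2, -b 0, a 0]
      (by simp only [evalAt, cons_val]; push_cast; linarith)) 2
    simp at this; omega
  · have := congrFun (key ![-b 1 - a 2, b 0, a 0]
      (by simp only [evalAt, cons_val]; push_cast; linarith)) 2
    simp at this; omega
  · have := congrFun (key ![b 2 - a 2, 0, a 0 - b 0]
      (by simp only [evalAt, cons_val]; push_cast; linarith)) 2
    simp at this; omega
  · have := congrFun (key ![-b 2 - a 2, 0, a 0 + b 0]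
      (by simp only [evalAt, cons_val]; push_cast; linarith)) 2
    simp at this; omega

lemma IsMinimalPoint.eq_of_first_eq {ξ : ℝ} (hξ : IrrationalNonQuadratic ξ) {a b : Point}
    (ha : IsMinimalPoint ξ a) (hb : IsMinimalPoint ξ b) (h : a 0 = b 0) : a = b :=
  SimApprox.eq_of_first_eq hξ h ha.one_le ha.L_le_half hb.L_le_half

/-- A point at least as good and as small as a minimal point coincides with it. -/
lemma IsMinimalPoint.eq_of_le {ξ : ℝ} (hξ : IrrationalNonQuadratic ξ) {a b : Point}
    (ha : IsMinimalPoint ξ a) (hb1 : 1 ≤ b 0) (hba : b 0 ≤ a 0) (h : L ξ b ≤ L ξ a) : b = a := by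
  have e : L ξ a = L ξ b := le_antisymm (ha.le hb1 hba) h
  exact (SimApprox.eq_of_first_eq hξ (first_eq_of_L_eq hξ ha.one_le hb1 e) ha.one_le
    ha.L_le_half (e ▸ ha.L_le_half)).symm

lemma IsMinimalPoint.isPrimitivePoint {ξ : ℝ} (hξ : IrrationalNonQuadratic ξ) {a : Point}
    (ha : IsMinimalPoint ξ a) : IsPrimitivePoint a := by
  obtain ⟨m, x, hx, hx0, hm, rfl⟩ := exists_primitive (w := a) (by have := ha.one_le; omega)
  have h1 := ha.one_le
  simp only [Pi.smul_apply, smul_eq_mul] at h1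
  have hm1 : 1 ≤ m := by
    by_contra hcon
    have : m * x 0 ≤ 0 := mul_nonpos_of_nonpos_of_nonneg (by omega) hx0.le
    omega
  have hL : L ξ x ≤ L ξ (m • x) := by
    rw [L_smul]
    refine le_mul_of_one_le_left (L_nonneg _ _) ?_
    rw [← Int.cast_abs]; exact_mod_cast Int.one_le_abs hm
  have := ha.eq_of_le hξ (b := x) hx0 (by simp only [Pi.smul_apply, smul_eq_mul]; nlinarith) hL
  rwa [← this]

lemma IsMinimalPoint.eq_of_cross {ξ : ℝ} (hξ : IrrationalNonQuadratic ξ) {a b : Point}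
    (ha : IsMinimalPoint ξ a) (hb : IsMinimalPoint ξ b) (h : a ⨯₃ b = 0) : a = b :=
  (ha.isPrimitivePoint hξ).eq_of_cross (hb.isPrimitivePoint hξ) ha.one_le hb.one_le h

lemma IsMinimalPoint.cross_ne_zero {ξ : ℝ} (hξ : IrrationalNonQuadratic ξ) {a b : Point}
    (ha : IsMinimalPoint ξ a) (hb : IsMinimalPoint ξ b) (h : a 0 < b 0) : a ⨯₃ b ≠ 0 :=
  fun h' => h.ne (congrFun (ha.eq_of_cross hξ hb h') 0)

/-- The sup norm and the first coordinate induce the same order on minimal points. -/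
lemma IsMinimalPoint.norm_lt {ξ : ℝ} {a b : Point} (ha : IsMinimalPoint ξ a)
    (hb : IsMinimalPoint ξ b) (h : a 0 < b 0) : ‖a‖ < ‖b‖ := by
  have a0 := ha.one_le
  have hab : (a 0 : ℝ) + 1 ≤ b 0 := by exact_mod_cast h
  have a0' := ha.one_le_cast
  have a1 := abs_le.mp ((abs_le_L_one ξ a).trans ha.L_le_half)
  have a2 := abs_le.mp ((abs_le_L_two ξ a).trans ha.L_le_half)
  have b2 := abs_le.mp ((abs_le_L_two ξ b).trans hb.L_le_half)
  by_cases hx : |ξ| ≤ 1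
  · have hx' := abs_le.mp hx
    have hsq : ξ ^ 2 ≤ 1 := by nlinarith
    have key : ‖a‖ ≤ a 0 := by
      apply norm_le_of_coords
      intro i
      have i1 : |a 1| ≤ a 0 := by
        have h1 : (a 1 : ℝ) < a 0 + 1 := by nlinarith
        have h2 : -(a 0 + 1 : ℝ) < a 1 := by nlinarith
        have h1' : a 1 < a 0 + 1 := by exact_mod_cast h1
        have h2' : -(a 0 + 1) < a 1 := by exact_mod_cast h2
        rw [abs_le]; omega
      have i2 : |a 2| ≤ a 0 := by
        have h1 : (a 2 : ℝ) < a 0 + 1 := by nlinarith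
        have h2 : -(a 0 + 1 : ℝ) < a 2 := by nlinarith [sq_nonneg ξ]
        have h1' : a 2 < a 0 + 1 := by exact_mod_cast h1
        have h2' : -(a 0 + 1) < a 2 := by exact_mod_cast h2
        rw [abs_le]; omega
      fin_cases i
      · change |(a 0 : ℝ)| ≤ _
        rw [abs_of_pos (by linarith)]
      · change |(a 1 : ℝ)| ≤ _
        rw [← Int.cast_abs]; exact_mod_cast i1
      · change |(a 2 : ℝ)| ≤ _
        rw [← Int.cast_abs]; exact_mod_cast i2
    have := coord_zero_le_norm b
    linarith
  · push Not at hx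
    have hsq : |ξ| ≤ ξ ^ 2 := by rw [← sq_abs]; nlinarith
    have hsq1 : 1 < ξ ^ 2 := by linarith
    have hb2 : (a 0 : ℝ) * ξ ^ 2 + 1 / 2 < b 2 := by nlinarith
    have h1 : |(a 0 : ℝ) * ξ| ≤ a 0 * ξ ^ 2 := by
      rw [abs_mul, abs_of_pos (by linarith)]
      exact mul_le_mul_of_nonneg_left hsq (by linarith)
    have h1' := abs_le.mp h1
    have hcoord : ∀ i, |(a i : ℝ)| ≤ a 0 * ξ ^ 2 + 1 / 2 := by
      intro i
      fin_cases i
      · change |(a 0 : ℝ)| ≤ _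
        rw [abs_of_pos (by linarith)]; nlinarith
      · change |(a 1 : ℝ)| ≤ _
        rw [abs_le]; constructor <;> linarith
      · change |(a 2 : ℝ)| ≤ _
        rw [abs_le]; constructor <;> nlinarith
    calc ‖a‖ ≤ _ := norm_le_of_coords hcoord
      _ < b 2 := hb2
      _ ≤ |(b 2 : ℝ)| := le_abs_self _
      _ ≤ ‖b‖ := abs_coord_le_norm b 2

/-! ### Consecutive points -/

/-- `a` and `b` are consecutive elements of `G`, with respect to the first coordinate. -/
def Consec (G : Set Point) (a b : Point) : Prop :=
  a ∈ G ∧ b ∈ G ∧ a 0 < b 0 ∧ ∀ c ∈ G, c 0 ≤ a 0 ∨ b 0 ≤ c 0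

lemma exists_succ {G : Set Point} {a : Point} (ha : a ∈ G) (h : ∃ b ∈ G, a 0 < b 0) :
    ∃ b, Consec G a b := by
  obtain ⟨b, hb, hab⟩ := h
  obtain ⟨n, ⟨c, hc, hac, hcn⟩, hmin⟩ := Int.exists_least_of_bdd
    (P := fun n => ∃ c ∈ G, a 0 < c 0 ∧ c 0 = n) ⟨a 0, fun z ⟨c, _, h, h'⟩ => by omega⟩
    ⟨_, b, hb, hab, rfl⟩
  refine ⟨c, ha, hc, hac, fun d hd => ?_⟩
  by_cases h : d 0 ≤ a 0
  · exact Or.inl h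
  · exact Or.inr (hcn ▸ hmin _ ⟨d, hd, by omega, rfl⟩)

lemma exists_greatest {G : Set Point} {n : ℤ} (h : ∃ b ∈ G, b 0 < n) :
    ∃ a ∈ G, a 0 < n ∧ ∀ c ∈ G, c 0 < n → c 0 ≤ a 0 := by
  obtain ⟨b, hb, hab⟩ := h
  obtain ⟨m, ⟨c, hc, hac, hcm⟩, hmax⟩ := Int.exists_greatest_of_bdd
    (P := fun m => ∃ c ∈ G, c 0 < n ∧ c 0 = m) ⟨n, fun z ⟨c, _, h, h'⟩ => by omega⟩
    ⟨_, b, hb, hab, rfl⟩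
  exact ⟨c, hc, hac, fun d hd hdn => hcm ▸ hmax _ ⟨d, hd, hdn, rfl⟩⟩

lemma exists_pred {G : Set Point} {b : Point} (hb : b ∈ G) (h : ∃ a ∈ G, a 0 < b 0) :
    ∃ a, Consec G a b := by
  obtain ⟨a, ha, hab, hmax⟩ := exists_greatest h
  refine ⟨a, ha, hb, hab, fun c hc => ?_⟩
  by_cases h : b 0 ≤ c 0
  · exact Or.inr h
  · exact Or.inl (hmax c hc (by omega))

/-! ### Logarithmic size and quality -/

/-- The logarithm of the first coordinate. -/
noncomputable def lsize (x : Point) : ℝ := Real.log (x 0)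

/-- The quality `-log L(x)` of an approximation point. -/
noncomputable def qual (ξ : ℝ) (x : Point) : ℝ := -Real.log (L ξ x)

lemma IsMinimalPoint.lsize_nonneg {ξ : ℝ} {a : Point} (ha : IsMinimalPoint ξ a) : 0 ≤ lsize a :=
  Real.log_nonneg ha.one_le_cast

lemma IsMinimalPoint.qual_nonneg {ξ : ℝ} {a : Point} (ha : IsMinimalPoint ξ a) :
    0 ≤ qual ξ a := by
  have := Real.log_nonpos (L_nonneg ξ a) ha.L_le_one
  unfold qual; linarith

lemma IsMinimalPoint.exp_lsize {ξ : ℝ} {a : Point} (ha : IsMinimalPoint ξ a) :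
    Real.exp (lsize a) = a 0 := Real.exp_log (by linarith [ha.one_le_cast])

lemma exp_neg_qual {ξ : ℝ} (hξ : IrrationalNonQuadratic ξ) {a : Point} (ha : a ≠ 0) :
    Real.exp (-qual ξ a) = L ξ a := by
  rw [qual, neg_neg, Real.exp_log (L_pos hξ ha)]

lemma IsMinimalPoint.lsize_lt {ξ : ℝ} {a b : Point} (ha : IsMinimalPoint ξ a)
    (h : a 0 < b 0) : lsize a < lsize b :=
  Real.log_lt_log (by linarith [ha.one_le_cast]) (by exact_mod_cast h)

lemma IsMinimalPoint.lsize_le {ξ : ℝ} {a b : Point} (ha : IsMinimalPoint ξ a)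
    (h : a 0 ≤ b 0) : lsize a ≤ lsize b :=
  Real.log_le_log (by linarith [ha.one_le_cast]) (by exact_mod_cast h)

lemma IsMinimalPoint.lt_of_lsize {ξ : ℝ} {a b : Point}
    (hb : IsMinimalPoint ξ b) (h : lsize a < lsize b) : a 0 < b 0 := by
  by_contra hcon
  have := hb.lsize_le (b := a) (by omega)
  linarith

lemma IsMinimalPoint.qual_le {ξ : ℝ} (hξ : IrrationalNonQuadratic ξ) {a b : Point}
    (ha : IsMinimalPoint ξ a) (hb : IsMinimalPoint ξ b) (h : a 0 ≤ b 0) :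
    qual ξ a ≤ qual ξ b := by
  have := Real.log_le_log (L_pos hξ hb.ne_zero) (hb.le ha.one_le h)
  unfold qual; linarith

/-- The minimal points `a` with `L(a) ≤ a₀ ^ (-(1 - η))`. -/
def Good (ξ η : ℝ) : Set Point := {a | IsMinimalPoint ξ a ∧ (1 - η) * lsize a ≤ qual ξ a}

lemma Good.mono {ξ η η' : ℝ} (h : η ≤ η') : Good ξ η ⊆ Good ξ η' := fun a ha =>
  ⟨ha.1, le_trans (by nlinarith [ha.1.lsize_nonneg]) ha.2⟩

/-! ### Uniform exponents and minimal points -/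

/-- An exponent in `betaSet ξ ε` produces points of `Good ξ ε` of high quality below any large
bound. -/
lemma exists_of_mem_betaSet {ξ ε b : ℝ} (hξ : IrrationalNonQuadratic ξ) (hb : b ∈ betaSet ξ ε) :
    ∃ N : ℤ, 2 ≤ N ∧ ∀ n, N ≤ n → ∃ c ∈ Good ξ ε, c 0 < n ∧
      Real.log n ≤ b * qual ξ c + Real.log 2 := by
  obtain ⟨hb0, hev⟩ := hb
  obtain ⟨B0, hB0⟩ := eventually_atTop.mp hev
  refine ⟨max 2 (⌈B0⌉ + 1), le_max_left _ _, fun n hn => ?_⟩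
  have hn2 : (2 : ℤ) ≤ n := (le_max_left _ _).trans hn
  have hn2' : (2 : ℝ) ≤ n := by exact_mod_cast hn2
  have hnB : B0 ≤ (n : ℝ) - 1 := by
    have h1 : ⌈B0⌉ ≤ n - 1 := by have := (le_max_right 2 (⌈B0⌉ + 1)).trans hn; omega
    have := Int.ceil_le.mp h1
    push_cast at this; exact this
  obtain ⟨x, hx1, hxB, hxL⟩ := hB0 _ hnB
  have hx1' : 1 ≤ |x 0| := by rw [← Int.cast_abs] at hx1; exact_mod_cast hx1
  obtain ⟨c, hc, hc0, hmin⟩ := exists_minimalPoint ξ hx1'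
  have hLc : L ξ c ≤ L ξ x := by
    rcases abs_choice (x 0) with h | h
    · exact hmin x (by omega) (by omega)
    · have := hmin ((-1 : ℤ) • x) (by simp; omega) (by simp; omega)
      rw [L_smul] at this
      simpa using this
  have hc0' : (c 0 : ℝ) ≤ |(x 0 : ℝ)| := by rw [← Int.cast_abs]; exact_mod_cast hc0
  have hLpos := L_pos hξ hc.ne_zero
  have hB1 : (1 : ℝ) ≤ (n : ℝ) - 1 := by linarith
  have hq : ∀ (t s : ℝ), 0 < t → L ξ c ≤ t ^ s → -(s * Real.log t) ≤ qual ξ c := by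
    intro t s ht h
    have := Real.log_le_log hLpos h
    rw [Real.log_rpow ht] at this
    unfold qual; linarith
  have q1 := hq _ _ (by linarith) (hLc.trans (hxL.trans (min_le_left _ _)))
  have q2 := hq _ _ (by linarith) (hLc.trans (hxL.trans (min_le_right _ _)))
  refine ⟨c, ⟨hc, ?_⟩, ?_, ?_⟩
  · by_cases hε : ε ≤ 1
    · have : lsize c ≤ Real.log |(x 0 : ℝ)| := Real.log_le_log (by linarith [hc.one_le_cast]) hc0'
      have := mul_le_mul_of_nonneg_left this (sub_nonneg.mpr hε)
      linarith
    · have := mul_nonneg (sub_nonneg.mpr (not_le.mp hε).le) hc.lsize_nonneg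
      linarith [hc.qual_nonneg]
  · have : (c 0 : ℝ) < n := by linarith
    exact_mod_cast this
  · have e1 : Real.log n ≤ Real.log (2 * ((n : ℝ) - 1)) :=
      Real.log_le_log (by linarith) (by linarith)
    rw [Real.log_mul (by norm_num) (by linarith)] at e1
    have e2 : -(-1 / b * Real.log ((n : ℝ) - 1)) * b = Real.log ((n : ℝ) - 1) := by
      field_simp
    have := mul_le_mul_of_nonneg_right q1 hb0.le
    rw [e2] at this
    linarith

/-- The set of all minimal points. -/
def MP (ξ : ℝ) : Set Point := {a | IsMinimalPoint ξ a}

lemma exists_qual_ge {ξ ε b : ℝ} (hξ : IrrationalNonQuadratic ξ) (hb : b ∈ betaSet ξ ε) (Q : ℝ) :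
    ∃ c ∈ Good ξ ε, Q ≤ qual ξ c := by
  obtain ⟨N, hN, h⟩ := exists_of_mem_betaSet hξ hb
  obtain ⟨c, hc, -, hlog⟩ := h (max N ⌈Real.exp (b * Q + Real.log 2)⌉) (le_max_left _ _)
  refine ⟨c, hc, ?_⟩
  have h1 : Real.exp (b * Q + Real.log 2) ≤
      ((max N ⌈Real.exp (b * Q + Real.log 2)⌉ : ℤ) : ℝ) :=
    (Int.le_ceil _).trans (by exact_mod_cast le_max_right _ _)
  have h2 := Real.log_le_log (Real.exp_pos _) h1
  rw [Real.log_exp] at h2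
  exact le_of_mul_le_mul_left (by linarith) hb.1

/-- Minimal points of bounded size have bounded quality. -/
lemma exists_qual_bound {ξ : ℝ} (hξ : IrrationalNonQuadratic ξ) (M : ℝ) :
    ∃ Q, 0 ≤ Q ∧ ∀ a, IsMinimalPoint ξ a → lsize a ≤ M → qual ξ a ≤ Q := by
  obtain ⟨m, hm, -, hmin⟩ := exists_minimalPoint ξ (le_max_left 1 ⌈Real.exp M⌉)
  refine ⟨qual ξ m, hm.qual_nonneg, fun a ha haM => ?_⟩
  have h1 : (a 0 : ℝ) ≤ Real.exp M := by
    rw [← ha.exp_lsize]; exact Real.exp_le_exp.mpr haM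
  have h2 : a 0 ≤ ⌈Real.exp M⌉ := by
    have := h1.trans (Int.le_ceil _)
    exact_mod_cast this
  have := Real.log_le_log (L_pos hξ hm.ne_zero)
    (hmin a ha.one_le (h2.trans (le_max_right _ _)))
  unfold qual; linarith

lemma exists_lsize_ge {ξ ε b : ℝ} (hξ : IrrationalNonQuadratic ξ) (hb : b ∈ betaSet ξ ε) (M : ℝ) :
    ∃ c ∈ Good ξ ε, M < lsize c := by
  obtain ⟨Q, -, hQ⟩ := exists_qual_bound hξ M
  obtain ⟨c, hc, hcQ⟩ := exists_qual_ge hξ hb (Q + 1)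
  refine ⟨c, hc, ?_⟩
  by_contra hcon
  have := hQ c hc.1 (not_lt.mp hcon)
  linarith

lemma exists_consec_minimal {ξ ε b : ℝ} (hξ : IrrationalNonQuadratic ξ) (hb : b ∈ betaSet ξ ε)
    {a : Point} (ha : IsMinimalPoint ξ a) : ∃ y, Consec (MP ξ) a y := by
  obtain ⟨c, hc, h⟩ := exists_lsize_ge hξ hb (lsize a)
  exact exists_succ (G := MP ξ) ha ⟨c, hc.1, hc.1.lt_of_lsize h⟩

lemma lsize_le_log {a : Point} {n : ℤ} (h1 : 1 ≤ a 0) (h : a 0 ≤ n) : lsize a ≤ Real.log n :=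
  Real.log_le_log (by exact_mod_cast h1) (by exact_mod_cast h)

/-- Consecutive minimal points: `L(a) ≪ b₀ ^ (-1/β)`. -/
lemma exists_uniform {ξ b : ℝ} (hξ : IrrationalNonQuadratic ξ) (hb : b ∈ betaSet ξ 1) :
    ∃ C, 0 ≤ C ∧ ∀ x y, Consec (MP ξ) x y → lsize y ≤ b * qual ξ x + C := by
  obtain ⟨N, hN, h⟩ := exists_of_mem_betaSet hξ hb
  have hlogN : 0 ≤ Real.log N := Real.log_nonneg (by
    have : (2 : ℝ) ≤ N := by exact_mod_cast hN
    linarith)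
  have hlog2 := Real.log_nonneg (show (1 : ℝ) ≤ 2 by norm_num)
  refine ⟨Real.log N + Real.log 2, by positivity, fun x y hxy => ?_⟩
  obtain ⟨hx, hy, hlt, hcons⟩ := hxy
  have hbq := mul_nonneg hb.1.le (IsMinimalPoint.qual_nonneg hx)
  by_cases hyN : N ≤ y 0
  · obtain ⟨c, hc, hcy, hlog⟩ := h _ hyN
    have hcx : c 0 ≤ x 0 := (hcons c hc.1).resolve_right (by omega)
    have := mul_le_mul_of_nonneg_left (hc.1.qual_le hξ hx hcx) hb.1.le
    change Real.log (y 0) ≤ _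
    linarith
  · have := lsize_le_log (n := N) (IsMinimalPoint.one_le hy) (by omega)
    linarith

/-- The same as `exists_uniform` for consecutive points of `Good ξ η`. -/
lemma exists_gap {ξ η b : ℝ} (hξ : IrrationalNonQuadratic ξ) (hb : b ∈ betaSet ξ η) :
    ∃ C, 0 ≤ C ∧ ∀ x y, Consec (Good ξ η) x y → lsize y ≤ b * qual ξ x + C := by
  obtain ⟨N, hN, h⟩ := exists_of_mem_betaSet hξ hb
  have hlogN : 0 ≤ Real.log N := Real.log_nonneg (by
    have : (2 : ℝ) ≤ N := by exact_mod_cast hN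
    linarith)
  have hlog2 := Real.log_nonneg (show (1 : ℝ) ≤ 2 by norm_num)
  refine ⟨Real.log N + Real.log 2, by positivity, fun x y hxy => ?_⟩
  obtain ⟨hx, hy, hlt, hcons⟩ := hxy
  have hbq := mul_nonneg hb.1.le hx.1.qual_nonneg
  by_cases hyN : N ≤ y 0
  · obtain ⟨c, hc, hcy, hlog⟩ := h _ hyN
    have hcx : c 0 ≤ x 0 := (hcons c hc).resolve_right (by omega)
    have := mul_le_mul_of_nonneg_left (hc.1.qual_le hξ hx.1 hcx) hb.1.le
    change Real.log (y 0) ≤ _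
    linarith
  · have := lsize_le_log (n := N) hy.1.one_le (by omega)
    linarith

/-- The plane spanned by two minimal points `x`, `y` has height `≪ Y L(x)`. -/
lemma norm_cross_le_of_lt {ξ : ℝ} {x y : Point} (hx : IsMinimalPoint ξ x)
    (hy : IsMinimalPoint ξ y) (h : x 0 < y 0) :
    ‖x ⨯₃ y‖ ≤ (2 * bnd ξ + 2) * ((y 0 : ℝ) * L ξ x) := by
  have h1 := norm_cross_le ξ x y
  have hx1 := hx.one_le_cast
  have hy1 := hy.one_le_cast
  have hL := hy.le hx.one_le h.le
  have hxy : (x 0 : ℝ) ≤ y 0 := by exact_mod_cast h.le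
  rw [abs_of_pos (by linarith), abs_of_pos (by linarith)] at h1
  have e1 : (x 0 : ℝ) * L ξ y ≤ y 0 * L ξ x :=
    mul_le_mul hxy hL (L_nonneg _ _) (by linarith)
  have e2 : L ξ x * L ξ y ≤ y 0 * L ξ x := by
    rw [mul_comm]
    exact mul_le_mul_of_nonneg_right (hy.L_le_one.trans hy1) (L_nonneg _ _)
  nlinarith [one_le_bnd ξ]

lemma exists_log_norm_cross_le {ξ : ℝ} (hξ : IrrationalNonQuadratic ξ) :
    ∃ C, 0 ≤ C ∧ ∀ x y, IsMinimalPoint ξ x → IsMinimalPoint ξ y → x 0 < y 0 →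
      Real.log ‖x ⨯₃ y‖ ≤ lsize y - qual ξ x + C := by
  have hb := one_le_bnd ξ
  refine ⟨Real.log (2 * bnd ξ + 2), Real.log_nonneg (by linarith), fun x y hx hy h => ?_⟩
  have h1 := norm_cross_le_of_lt hx hy h
  have h2 := one_le_norm (hx.cross_ne_zero hξ hy h)
  have h3 := Real.log_le_log (by linarith) h1
  have hLx := L_pos hξ hx.ne_zero
  have hy0 : (0 : ℝ) < y 0 := by linarith [hy.one_le_cast]
  rw [Real.log_mul (by linarith) (by positivity), Real.log_mul (by linarith) (by linarith)] at h3
  unfold lsize qual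
  linarith

/-- A primitive point on the cone `x₀ x₂ = x₁²` is `(m², m n, n²)`, so that its planes have large
height. -/
lemma le_norm_cross_sq {a p : Point} (ha : IsPrimitivePoint a) (ha0 : 1 ≤ a 0) (hd : pdet a = 0)
    (hpa : p ⨯₃ a ≠ 0) : (a 0 : ℝ) ≤ ‖p ⨯₃ a‖ ^ 2 := by
  have hsq : a 0 * a 2 = a 1 ^ 2 := by unfold pdet at hd; linarith
  have hcop : IsCoprime (a 0) (a 2) := by
    rw [Int.isCoprime_iff_gcd_eq_one]
    by_contra hg
    obtain ⟨q, hq, hqg⟩ := Nat.exists_prime_and_dvd hg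
    have h0 : (q : ℤ) ∣ a 0 := (Int.natCast_dvd_natCast.mpr hqg).trans (Int.gcd_dvd_left ..)
    have h2 : (q : ℤ) ∣ a 2 := (Int.natCast_dvd_natCast.mpr hqg).trans (Int.gcd_dvd_right ..)
    have hqp : Prime (q : ℤ) := Nat.prime_iff_prime_int.mp hq
    have h1 : (q : ℤ) ∣ a 1 := hqp.dvd_of_dvd_pow (hsq ▸ h0.mul_right _)
    exact hqp.not_isUnit (ha q (fun j => by fin_cases j <;> assumption))
  obtain ⟨m, hm⟩ := Int.sq_of_isCoprime hcop hsq
  obtain ⟨n, hn⟩ := Int.sq_of_isCoprime hcop.symm (by rw [mul_comm]; exact hsq)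
  have hm : a 0 = m ^ 2 := hm.resolve_right (by nlinarith [sq_nonneg m])
  have hn : a 2 = n ^ 2 := by
    rcases hn with h | h
    · exact h
    · have : 0 ≤ a 0 * a 2 := hsq ▸ sq_nonneg _
      have h2 : 0 ≤ a 2 := nonneg_of_mul_nonneg_right this (by omega)
      nlinarith [sq_nonneg n]
  obtain ⟨n, hn, h1⟩ : ∃ n, a 2 = n ^ 2 ∧ a 1 = m * n := by
    have : a 1 ^ 2 = (m * n) ^ 2 := by rw [← hsq, hm, hn]; ring
    rcases sq_eq_sq_iff_eq_or_eq_neg.mp this with h | h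
    · exact ⟨n, hn, h⟩
    · exact ⟨-n, by rw [hn]; ring, by rw [h]; ring⟩
  have c0 : (p ⨯₃ a) 0 = n * (n * p 1 - m * p 2) := by
    simp only [cross_apply, cons_val, hn, h1]; ring
  have c1 : (p ⨯₃ a) 1 = -(n * (n * p 0 - m * p 1) + m * (n * p 1 - m * p 2)) := by
    simp only [cross_apply, cons_val, hn, hm]; ring
  have c2 : (p ⨯₃ a) 2 = m * (n * p 0 - m * p 1) := by
    simp only [cross_apply, cons_val, hm, h1]; ring
  have key : ∀ i, ∀ k : ℤ, k ≠ 0 → |(p ⨯₃ a) i| = |m * k| → (a 0 : ℝ) ≤ ‖p ⨯₃ a‖ ^ 2 := by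
    intro i k hk h
    have e1 : a 0 ≤ |(p ⨯₃ a) i| ^ 2 := by
      rw [h, sq_abs, hm]
      have : 1 ≤ k ^ 2 := by have := sq_pos_of_ne_zero hk; omega
      nlinarith [sq_nonneg m]
    have e2 := pow_le_pow_left₀ (abs_nonneg _) (abs_coord_le_norm (p ⨯₃ a) i) 2
    refine le_trans ?_ e2
    rw [← Int.cast_abs]
    exact_mod_cast e1
  by_cases hx : n * p 0 - m * p 1 = 0
  · by_cases hy : n * p 1 - m * p 2 = 0
    · exact absurd (point_ext (by rw [c0, hy]; simp) (by rw [c1, hx, hy]; simp)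
        (by rw [c2, hx]; simp)) hpa
    · exact key 1 _ hy (by rw [c1, hx, mul_zero, zero_add, abs_neg])
  · exact key 2 _ hx (by rw [c2])

/-- If `β₁(ξ) < 2`, large minimal points have nonzero determinant. -/
lemma exists_pdet_ne_zero {ξ b : ℝ} (hξ : IrrationalNonQuadratic ξ) (hb : b ∈ betaSet ξ 1)
    (hb2 : b < 2) : ∃ M, 0 ≤ M ∧ ∀ a, IsMinimalPoint ξ a → M < lsize a → pdet a ≠ 0 := by
  obtain ⟨C, hC, hU⟩ := exists_uniform hξ hb
  obtain ⟨D, hD, hX⟩ := exists_log_norm_cross_le hξ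
  refine ⟨2 * (C + b * D) / (2 - b), div_nonneg (by nlinarith [hb.1]) (by linarith),
    fun a ha hM hdet => ?_⟩
  have hM0 : 0 < lsize a := lt_of_le_of_lt (div_nonneg (by nlinarith [hb.1]) (by linarith)) hM
  rw [div_lt_iff₀ (by linarith)] at hM
  have h1a : 1 < a 0 := by
    by_contra hcon
    have := lsize_le_log (n := 1) ha.one_le (by omega)
    simp at this; linarith
  obtain ⟨m, hm, hm1, -⟩ := exists_minimalPoint ξ le_rfl
  obtain ⟨p, hp⟩ := exists_pred (G := MP ξ) (b := a) ha ⟨m, hm, by omega⟩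
  have hpm : IsMinimalPoint ξ p := hp.1
  have hne := hpm.cross_ne_zero hξ ha hp.2.2.1
  have h1 := le_norm_cross_sq (ha.isPrimitivePoint hξ) ha.one_le hdet hne
  have h2 := Real.log_le_log (by linarith [ha.one_le_cast]) h1
  rw [Real.log_pow] at h2
  have h3 := hX p a hpm ha hp.2.2.1
  have h4 := hU p a hp
  change lsize a ≤ _ at h2
  push_cast at h2
  have h5 : qual ξ p ≤ lsize a / 2 + D := by linarith
  have := mul_le_mul_of_nonneg_left h5 hb.1.le
  nlinarith

/-- A point with nonzero determinant satisfies `L(x) ≫ X⁻¹`. -/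
lemma qual_le_of_pdet {ξ : ℝ} {x : Point} (hd : pdet x ≠ 0) (hx : x 0 ≠ 0) (hL : L ξ x ≤ 1) :
    qual ξ x ≤ Real.log |(x 0 : ℝ)| + Real.log (2 * bnd ξ + 1) := by
  have hb := one_le_bnd ξ
  have h1 := abs_pdet_le ξ x
  have h2 : (1 : ℝ) ≤ |(pdet x : ℝ)| := by
    rw [← Int.cast_abs]; exact_mod_cast Int.one_le_abs hd
  have h3 : (1 : ℝ) ≤ |(x 0 : ℝ)| := by
    rw [← Int.cast_abs]; exact_mod_cast Int.one_le_abs hx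
  have hL0 := L_nonneg ξ x
  have h4 : 1 ≤ (2 * bnd ξ + 1) * (|(x 0 : ℝ)| * L ξ x) := by nlinarith
  have hLpos : 0 < L ξ x := by
    refine lt_of_le_of_ne hL0 fun h => ?_
    rw [← h] at h4; norm_num at h4
  have h5 := Real.log_nonneg h4
  rw [Real.log_mul (by linarith) (by positivity), Real.log_mul (by linarith) (by linarith)] at h5
  unfold qual; linarith

lemma exists_qual_le {ξ b : ℝ} (hξ : IrrationalNonQuadratic ξ) (hb : b ∈ betaSet ξ 1)
    (hb2 : b < 2) : ∃ C, 0 ≤ C ∧ ∀ a, IsMinimalPoint ξ a → qual ξ a ≤ lsize a + C := by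
  obtain ⟨M, hM, hdet⟩ := exists_pdet_ne_zero hξ hb hb2
  obtain ⟨Q, hQ, hQb⟩ := exists_qual_bound hξ M
  have hl : 0 ≤ Real.log (2 * bnd ξ + 1) := Real.log_nonneg (by linarith [one_le_bnd ξ])
  refine ⟨Q + Real.log (2 * bnd ξ + 1), by positivity, fun a ha => ?_⟩
  by_cases h : lsize a ≤ M
  · have := hQb a ha h
    linarith [ha.lsize_nonneg]
  · have := qual_le_of_pdet (hdet a ha (not_le.mp h)) (by have := ha.one_le; omega) ha.L_le_one
    rw [abs_of_pos (by linarith [ha.one_le_cast])] at this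
    unfold lsize; linarith

lemma one_le_of_mem_betaSet {ξ b : ℝ} (hξ : IrrationalNonQuadratic ξ) (hb : b ∈ betaSet ξ 1)
    (hb2 : b < 2) : 1 ≤ b := by
  obtain ⟨C, hC, hU⟩ := exists_uniform hξ hb
  obtain ⟨D, hD, hQ⟩ := exists_qual_le hξ hb hb2
  by_contra hcon
  push Not at hcon
  obtain ⟨a, ha, hlt⟩ := exists_lsize_ge hξ hb ((b * D + C) / (1 - b))
  rw [div_lt_iff₀ (by linarith)] at hlt
  obtain ⟨y, hy⟩ := exists_consec_minimal hξ hb ha.1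
  have h1 := hU a y hy
  have h2 := mul_le_mul_of_nonneg_left (hQ a ha.1) hb.1.le
  have h3 := ha.1.lsize_lt hy.2.2.1
  nlinarith

/-- A plane with integral normal vector `p` that contains the minimal point `a` satisfies
`‖p‖ ≫ a₀ ^ (2 - β)`: compare the last minimal point in the plane with the next one. -/
lemma exists_escape {ξ b : ℝ} (hξ : IrrationalNonQuadratic ξ) (hb : b ∈ betaSet ξ 1)
    (hb2 : b < 2) : ∃ C, 0 ≤ C ∧ ∀ p : Point, p ≠ 0 → ∀ a, IsMinimalPoint ξ a → p ⬝ᵥ a = 0 →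
      (2 - b) * lsize a ≤ Real.log ‖p‖ + C := by
  obtain ⟨C, hC, hU⟩ := exists_uniform hξ hb
  obtain ⟨D, hD, hQ⟩ := exists_qual_le hξ hb hb2
  have hb1 := one_le_of_mem_betaSet hξ hb hb2
  have hl4 : 0 ≤ Real.log 4 := Real.log_nonneg (by norm_num)
  refine ⟨Real.log 4 + C + (b - 1) * D, by nlinarith, fun p hp a ha hpa => ?_⟩
  have hP := abs_pos.mpr (evalAt_ne_zero hξ hp)
  have hpn := one_le_norm hp
  obtain ⟨n, ⟨m, hm, hpm, hmn⟩, hmax⟩ := Int.exists_greatest_of_bdd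
    (P := fun n => ∃ m, IsMinimalPoint ξ m ∧ p ⬝ᵥ m = 0 ∧ m 0 = n)
    ⟨⌈2 * ‖p‖ / |evalAt ξ p|⌉, fun z ⟨m, hm, hpm, hmz⟩ => by
      have h1 := abs_evalAt_le ξ hpm
      rw [abs_of_pos (by linarith [hm.one_le_cast])] at h1
      have h2 : (m 0 : ℝ) ≤ 2 * ‖p‖ / |evalAt ξ p| := by
        rw [le_div_iff₀ hP]
        nlinarith [hm.L_le_one]
      have := h2.trans (Int.le_ceil _)
      rw [← hmz]
      exact_mod_cast this⟩
    ⟨_, a, ha, hpa, rfl⟩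
  have ham : a 0 ≤ m 0 := hmn ▸ hmax _ ⟨a, ha, hpa, rfl⟩
  obtain ⟨y, hy⟩ := exists_consec_minimal hξ hb hm
  have hym : IsMinimalPoint ξ y := hy.2.1
  have hpy : p ⬝ᵥ y ≠ 0 := fun h => by
    have := hmax _ ⟨y, hym, h, rfl⟩
    have := hy.2.2.1
    omega
  have e1 := abs_evalAt_le ξ hpm
  have e2 := one_le_of_dot_ne_zero ξ hpy
  have hm1 := hm.one_le_cast
  have hy1 := hym.one_le_cast
  have hmy : (m 0 : ℝ) ≤ y 0 := by exact_mod_cast hy.2.2.1.le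
  rw [abs_of_pos (by linarith)] at e1 e2
  have hLpos := L_pos hξ hm.ne_zero
  have hL := hym.le hm.one_le hy.2.2.1.le
  have e3 : (m 0 : ℝ) ≤ 4 * ‖p‖ * (y 0 * L ξ m) := by
    have f1 := mul_le_mul_of_nonneg_left e1 (show (0 : ℝ) ≤ y 0 by linarith)
    have f2 : (m 0 : ℝ) * L ξ y ≤ y 0 * L ξ m :=
      mul_le_mul hmy hL (L_nonneg _ _) (by linarith)
    have f3 := mul_le_mul_of_nonneg_left f2 (show 0 ≤ 2 * ‖p‖ by linarith)
    have f4 := mul_le_mul_of_nonneg_left e2 (show (0 : ℝ) ≤ m 0 by linarith)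
    nlinarith
  have e4 := Real.log_le_log (by linarith) e3
  rw [Real.log_mul (by positivity) (by positivity), Real.log_mul (by norm_num) (by linarith),
    Real.log_mul (by linarith) (by linarith)] at e4
  have e5 := hU m y hy
  have e6 := hQ m hm
  have e7 : lsize m ≤ Real.log 4 + Real.log ‖p‖ + (lsize y - qual ξ m) := by
    unfold lsize qual; linarith
  have e8 := mul_le_mul_of_nonneg_left e6 (show 0 ≤ b - 1 by linarith)
  have e9 := mul_le_mul_of_nonneg_left (ha.lsize_le ham) (show 0 ≤ 2 - b by linarith)
  nlinarith

/-- If the minimal points enter the plane with normal vector `p` at `y`, then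
`y₀ ≪ ‖p‖ ^ β`. -/
lemma exists_entry {ξ b : ℝ} (hξ : IrrationalNonQuadratic ξ) (hb : b ∈ betaSet ξ 1) :
    ∃ C, 0 ≤ C ∧ ∀ p : Point, p ≠ 0 → ∀ x y, Consec (MP ξ) x y → p ⬝ᵥ y = 0 → p ⬝ᵥ x ≠ 0 →
      lsize y ≤ b * Real.log ‖p‖ + C := by
  obtain ⟨C, hC, hU⟩ := exists_uniform hξ hb
  have hl4 : 0 ≤ Real.log 4 := Real.log_nonneg (by norm_num)
  refine ⟨b * Real.log 4 + C, by nlinarith [hb.1], fun p hp x y hxy hpy hpx => ?_⟩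
  have hx : IsMinimalPoint ξ x := hxy.1
  have hy : IsMinimalPoint ξ y := hxy.2.1
  have hpn := one_le_norm hp
  have e1 := abs_evalAt_le ξ hpy
  have e2 := one_le_of_dot_ne_zero ξ hpx
  have hlt : (x 0 : ℝ) ≤ y 0 := by exact_mod_cast hxy.2.2.1.le
  rw [abs_of_pos (by linarith [hx.one_le_cast])] at e2
  rw [abs_of_pos (by linarith [hy.one_le_cast])] at e1
  have hL := hy.le hx.one_le hxy.2.2.1.le
  have e3 : 1 ≤ 4 * ‖p‖ * L ξ x := by
    have f1 := mul_le_mul_of_nonneg_right hlt (abs_nonneg (evalAt ξ p))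
    have f2 := mul_le_mul_of_nonneg_left hL (show 0 ≤ 2 * ‖p‖ by linarith)
    linarith
  have e4 := Real.log_nonneg e3
  rw [Real.log_mul (by positivity) (L_pos hξ hx.ne_zero).ne',
    Real.log_mul (by norm_num) (by linarith)] at e4
  have e5 := hU x y hxy
  have e6 : qual ξ x ≤ Real.log 4 + Real.log ‖p‖ := by unfold qual; linarith
  have := mul_le_mul_of_nonneg_left e6 hb.1.le
  linarith

/-- If `u < x < y` are minimal points and `log Y ≤ b (-log L(u)) + C` with `b < 2`, then `u`, `x`
and `y` are coplanar, provided that `u` is large. -/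
lemma exists_coplanar {ξ : ℝ} (hξ : IrrationalNonQuadratic ξ) {b C : ℝ} (hb2 : b < 2) :
    ∃ Q, ∀ u x y, IsMinimalPoint ξ u → IsMinimalPoint ξ x → IsMinimalPoint ξ y →
      u 0 < x 0 → x 0 < y 0 → lsize y ≤ b * qual ξ u + C → Q < qual ξ u →
      (u ⨯₃ x) ⬝ᵥ y = 0 := by
  have hbn := one_le_bnd ξ
  refine ⟨(C + Real.log (4 * bnd ξ + 6)) / (2 - b), fun u x y hu hx hy hux hxy hgap hQ => ?_⟩
  by_contra hne
  have h1 := one_le_of_dot_ne_zero ξ hne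
  have h2 := abs_evalAt_cross_le ξ u x
  have h3 := norm_cross_le_of_lt hu hx hux
  have hy1 := hy.one_le_cast
  rw [abs_of_pos (by linarith)] at h1
  have hLy := hy.le hx.one_le hxy.le
  have hLx := hx.le hu.one_le hux.le
  have hxy' : (x 0 : ℝ) ≤ y 0 := by exact_mod_cast hxy.le
  have hx1 := hx.one_le_cast
  have hux0 := L_nonneg ξ u
  have hx0 := L_nonneg ξ x
  have hy0 := L_nonneg ξ y
  have f1 : L ξ u * L ξ x ≤ L ξ u ^ 2 := by nlinarith
  have f2 : (x 0 : ℝ) * L ξ u * L ξ y ≤ y 0 * L ξ u ^ 2 := by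
    have g1 : (x 0 : ℝ) * L ξ u ≤ y 0 * L ξ u := mul_le_mul_of_nonneg_right hxy' hux0
    have g2 : (x 0 : ℝ) * L ξ u * L ξ y ≤ y 0 * L ξ u * L ξ u :=
      mul_le_mul g1 (hLy.trans hLx) hy0 (by positivity)
    linarith
  have f3 : 1 ≤ (4 * bnd ξ + 6) * (y 0 * L ξ u ^ 2) := by
    have g1 := mul_le_mul_of_nonneg_left (h2.trans (mul_le_mul_of_nonneg_left f1 (by norm_num)))
      (show (0 : ℝ) ≤ y 0 by linarith)
    have g2 := mul_le_mul_of_nonneg_right h3 hy0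
    have g3 := mul_le_mul_of_nonneg_left f2 (show 0 ≤ 2 * bnd ξ + 2 by linarith)
    nlinarith
  have f4 := Real.log_nonneg f3
  have hLu := L_pos hξ hu.ne_zero
  rw [Real.log_mul (by linarith) (by positivity), Real.log_mul (by linarith) (by positivity),
    Real.log_pow] at f4
  rw [div_lt_iff₀ (by linarith)] at hQ
  have f5 : 0 ≤ Real.log (4 * bnd ξ + 6) + lsize y - 2 * qual ξ u := by
    unfold lsize qual; push_cast at f4; linarith
  linarith

/-- A variant of `exists_entry` in which `v` need not be the minimal point preceding `u`: if `v` is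
good enough, that preceding minimal point lies outside the plane as soon as `v` does. -/
lemma exists_entry_of_gap {ξ b₁ : ℝ} (hξ : IrrationalNonQuadratic ξ) (hb₁ : b₁ ∈ betaSet ξ 1)
    {b C : ℝ} (hb2 : b < 2) :
    ∃ D Q, 0 ≤ D ∧ ∀ v u q, IsMinimalPoint ξ v → IsMinimalPoint ξ u → v 0 < u 0 →
      lsize u ≤ b * qual ξ v + C → Q < qual ξ v → q ≠ 0 → q ⬝ᵥ u = 0 → q ⬝ᵥ v ≠ 0 →
      lsize u ≤ b₁ * Real.log ‖q‖ + D := by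
  obtain ⟨D, hD, hE⟩ := exists_entry hξ hb₁
  obtain ⟨Q, hQ⟩ := exists_coplanar hξ (C := C) hb2
  refine ⟨D, Q, hD, fun v u q hv hu hvu hgap hQv hq hqu hqv => ?_⟩
  obtain ⟨x, hx⟩ := exists_pred (G := MP ξ) (b := u) hu ⟨v, hv, hvu⟩
  refine hE q hq x u hx hqu fun hqx => ?_
  have hxm : IsMinimalPoint ξ x := hx.1
  have hvx : v 0 ≤ x 0 := (hx.2.2.2 v hv).resolve_right (by omega)
  rcases hvx.lt_or_eq with h | h
  · have hcop := hQ v x u hv hxm hu h hx.2.2.1 hgap hQv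
    rw [cross_dot_rotate] at hcop
    have hne := hxm.cross_ne_zero hξ hu hx.2.2.1
    exact hqv (dot_eq_zero_of_normal hne (cross_dot_left _ _) (cross_dot_right _ _) hne hqx hqu
      hcop)
  · rw [hv.eq_of_first_eq hξ hxm h] at hqv
    exact hqv hqx

/-! ### The algebra of a plane -/

lemma exists_small_root {A B c : ℝ} (hA : A ≠ 0) (h : 4 * |B * c| ≤ A ^ 2) :
    ∃ z, B * z ^ 2 + A * z + c = 0 ∧ |z| ≤ 2 * |c| / |A| := by
  have hD : 0 ≤ A ^ 2 - 4 * (B * c) := by have := le_abs_self (B * c); linarith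
  have key : ∀ s : ℝ, s ^ 2 = A ^ 2 - 4 * (B * c) → |A| ≤ |A + s| →
      ∃ z, B * z ^ 2 + A * z + c = 0 ∧ |z| ≤ 2 * |c| / |A| := by
    intro s hs hAs
    have hA0 := abs_pos.mpr hA
    have hne : A + s ≠ 0 := abs_pos.mp (hA0.trans_le hAs)
    refine ⟨-2 * c / (A + s), ?_, ?_⟩
    · field_simp
      linear_combination c * hs
    · rw [abs_div, abs_mul]
      norm_num
      exact div_le_div_of_nonneg_left (by positivity) hA0 hAs
  rcases lt_or_gt_of_ne hA with h0 | h0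
  · refine key (-√(A ^ 2 - 4 * (B * c))) (by rw [neg_sq, Real.sq_sqrt hD]) ?_
    have := Real.sqrt_nonneg (A ^ 2 - 4 * (B * c))
    rw [abs_of_neg h0, abs_of_neg (by linarith)]
    linarith
  · refine key (√(A ^ 2 - 4 * (B * c))) (by rw [Real.sq_sqrt hD]) ?_
    have := Real.sqrt_nonneg (A ^ 2 - 4 * (B * c))
    rw [abs_of_pos h0, abs_of_pos (by linarith)]
    linarith

/-- Coordinates on the real span of a plane of `ℤ³` with normal vector `p`. The polynomial
`p₀ + p₁ X + p₂ X²` is a multiple of `(X - θ) (q X - r)`, and the plane contains the two isotropic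
points `(1, θ, θ²)` and `(q², q r, r²)`; `kap` and `lam` are linear forms that vanish at the first
and at the second of them, scaled so that `x₀ x₂ - x₁² = kap x * lam x` on the plane. -/
structure PlaneCoords (p : Point) where
  /-- A root of the polynomial `p₀ + p₁ X + p₂ X²`. -/
  θ : ℝ
  /-- The leading coefficient of the complementary factor `q X - r`. -/
  q : ℝ
  /-- The constant coefficient of the complementary factor `q X - r`, up to sign. -/
  r : ℝ
  /-- The factor between the polynomial and `(X - θ) (q X - r)`. -/
  m : ℝ
  hm : m ≠ 0
  hq : (p 2 : ℝ) = m * q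
  hr : (p 1 : ℝ) = -m * (r + q * θ)
  hp : (p 0 : ℝ) = m * (r * θ)
  hqr : 0 < q ^ 2 + r ^ 2

namespace PlaneCoords

variable {p : Point} (c : PlaneCoords p)

/-- The coordinate that measures the quality of a point of the plane. -/
noncomputable def kap (x : Point) : ℝ :=
  (c.q * (x 1 - c.θ * x 0) + c.r * (x 2 - c.θ * x 1)) / (c.q ^ 2 + c.r ^ 2)

/-- The coordinate that measures the size of a point of the plane. -/
noncomputable def lam (x : Point) : ℝ := c.r * x 0 - c.q * x 1

lemma dot_cast (x : Point) : ((p ⬝ᵥ x : ℤ) : ℝ) =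
    c.m * (c.q * (x 2 - c.θ * x 1) - c.r * (x 1 - c.θ * x 0)) := by
  simp only [vec3_dotProduct]
  push_cast
  rw [c.hq, c.hr, c.hp]; ring

lemma kap_mul {x : Point} (hx : p ⬝ᵥ x = 0) :
    (x 1 : ℝ) - c.θ * x 0 = c.kap x * c.q ∧ (x 2 : ℝ) - c.θ * x 1 = c.kap x * c.r := by
  have h := c.dot_cast x
  rw [hx, Int.cast_zero, eq_comm, mul_eq_zero] at h
  have h := h.resolve_left c.hm
  have hne := c.hqr.ne'
  unfold kap
  constructor <;> field_simp
  · linear_combination -c.r * h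
  · linear_combination c.q * h

lemma coords {x : Point} (hx : p ⬝ᵥ x = 0) : (x 1 : ℝ) = c.θ * x 0 + c.kap x * c.q ∧
    (x 2 : ℝ) = c.θ * (c.θ * x 0 + c.kap x * c.q) + c.kap x * c.r := by
  obtain ⟨h1, h2⟩ := c.kap_mul hx
  have e1 : (x 1 : ℝ) = c.θ * x 0 + c.kap x * c.q := by linarith
  exact ⟨e1, by rw [← e1]; linarith⟩

lemma lam_eq {x : Point} (hx : p ⬝ᵥ x = 0) :
    c.lam x = (c.r - c.q * c.θ) * x 0 - c.q ^ 2 * c.kap x := by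
  rw [lam, (c.coords hx).1]; ring

lemma pdet_eq {x : Point} (hx : p ⬝ᵥ x = 0) : (pdet x : ℝ) = c.kap x * c.lam x := by
  rw [c.lam_eq hx]
  unfold pdet
  push_cast
  rw [(c.coords hx).1, (c.coords hx).2]; ring

lemma bracket_aux {x y z : Point} (hx : p ⬝ᵥ x = 0) (hy : p ⬝ᵥ y = 0) (hz : p ⬝ᵥ z = 0) :
    (bracket x y z 1 : ℝ) - c.θ * bracket x y z 0 = c.kap x * c.kap y * c.lam z * c.q ∧
    (bracket x y z 2 : ℝ) - c.θ * bracket x y z 1 = c.kap x * c.kap y * c.lam z * c.r ∧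
    c.lam (bracket x y z) = c.lam x * c.lam y * c.kap z := by
  rw [c.lam_eq hx, c.lam_eq hy, c.lam_eq hz,
    show c.lam (bracket x y z) = c.r * bracket x y z 0 - c.q * bracket x y z 1 from rfl]
  simp only [bracket, bracketMatrix, symMatrix, J, Matrix.neg_apply, Matrix.mul_apply,
    Fin.sum_univ_two, Matrix.of_apply, cons_val]
  push_cast
  rw [(c.coords hx).1, (c.coords hx).2, (c.coords hy).1, (c.coords hy).2, (c.coords hz).1,
    (c.coords hz).2]
  refine ⟨?_, ?_, ?_⟩ <;> ring

lemma dot_bracket (c : PlaneCoords p) {x y z : Point} (hx : p ⬝ᵥ x = 0) (hy : p ⬝ᵥ y = 0)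
    (hz : p ⬝ᵥ z = 0) : p ⬝ᵥ bracket x y z = 0 := by
  have h := c.dot_cast (bracket x y z)
  obtain ⟨h1, h2, -⟩ := c.bracket_aux hx hy hz
  rw [h1, h2] at h
  have : ((p ⬝ᵥ bracket x y z : ℤ) : ℝ) = 0 := by rw [h]; ring
  exact_mod_cast this

lemma kap_bracket {x y z : Point} (hx : p ⬝ᵥ x = 0) (hy : p ⬝ᵥ y = 0) (hz : p ⬝ᵥ z = 0) :
    c.kap (bracket x y z) = c.kap x * c.kap y * c.lam z := by
  obtain ⟨h1, h2, -⟩ := c.bracket_aux hx hy hz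
  have hne := c.hqr.ne'
  rw [kap, h1, h2]
  field_simp

lemma lam_bracket {x y z : Point} (hx : p ⬝ᵥ x = 0) (hy : p ⬝ᵥ y = 0) (hz : p ⬝ᵥ z = 0) :
    c.lam (bracket x y z) = c.lam x * c.lam y * c.kap z := (c.bracket_aux hx hy hz).2.2

end PlaneCoords

/-- On the plane with normal vector `p`, the product of `x₀` and `p₀ + p₁ ξ + p₂ ξ²` is a
combination of the two approximation errors of `x`. -/
lemma dot_eq_zero_cast (ξ : ℝ) {p x : Point} (hx : p ⬝ᵥ x = 0) :
    (p 1 : ℝ) * (x 0 * ξ - x 1) + p 2 * (x 0 * ξ ^ 2 - x 2) = x 0 * evalAt ξ p := by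
  have : ((p ⬝ᵥ x : ℤ) : ℝ) = 0 := by rw [hx]; simp
  simp only [vec3_dotProduct] at this
  push_cast at this
  unfold evalAt
  linear_combination -this

lemma abs_evalAt_le_max {ξ : ℝ} {p y : Point} {m τ : ℝ} (hm0 : 0 < m) (hm1 : |(p 1 : ℝ)| ≤ m)
    (hm2 : |(p 2 : ℝ)| ≤ m) (hpy : p ⬝ᵥ y = 0) (hy1 : 1 ≤ y 0) (hτy : L ξ y ≤ τ * y 0) :
    |evalAt ξ p| ≤ 2 * m * τ := by
  have hy1' : (1 : ℝ) ≤ y 0 := by exact_mod_cast hy1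
  have e := dot_eq_zero_cast ξ hpy
  have h1 : |(p 1 : ℝ) * (y 0 * ξ - y 1)| ≤ m * L ξ y := by
    rw [abs_mul]; exact mul_le_mul hm1 (abs_le_L_one ξ y) (abs_nonneg _) hm0.le
  have h2 : |(p 2 : ℝ) * (y 0 * ξ ^ 2 - y 2)| ≤ m * L ξ y := by
    rw [abs_mul]; exact mul_le_mul hm2 (abs_le_L_two ξ y) (abs_nonneg _) hm0.le
  have h3 := (abs_add_le _ _).trans (add_le_add h1 h2)
  rw [e, abs_mul, abs_of_pos (by linarith)] at h3
  have h4 : (y 0 : ℝ) * |evalAt ξ p| ≤ y 0 * (2 * m * τ) := by nlinarith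
  exact le_of_mul_le_mul_left h4 (by linarith)

/-- The derivative at `ξ` of the polynomial `p₀ + p₁ X + p₂ X²` is of the size of `p`, if the
plane contains a good point `u` with nonzero determinant. -/
lemma le_abs_derivative {ξ : ℝ} {p u : Point} {m τ Γ Q P : ℝ} (hm0 : 0 < m)
    (hm : m = max |(p 1 : ℝ)| |(p 2 : ℝ)|) (hP : |P| ≤ 2 * m * τ) (hPdef : P = evalAt ξ p)
    (hpu : p ⬝ᵥ u = 0) (hu1 : 1 ≤ u 0) (hLu : L ξ u ≤ 1 / 2) (hdet : pdet u ≠ 0)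
    (hΓu : u 0 * L ξ u ≤ Γ) (hs1 : 256 * bnd ξ * ((u 0 : ℝ) ^ 2 * τ) ≤ 1)
    (hQ : Q = p 1 + 2 * ξ * p 2) : m / 2 ≤ |Q| * Γ := by
  have hB1 := one_le_bnd ξ
  have hBξ : |ξ| ≤ bnd ξ - 1 := by unfold bnd; nlinarith [sq_nonneg ξ]
  set β := bnd ξ
  have hu1' : (1 : ℝ) ≤ u 0 := by exact_mod_cast hu1
  obtain ⟨d1, hd1⟩ : ∃ d : ℝ, d = u 0 * ξ - u 1 := ⟨_, rfl⟩
  obtain ⟨d2, hd2⟩ : ∃ d : ℝ, d = u 0 * ξ ^ 2 - u 2 := ⟨_, rfl⟩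
  have a1 : |d1| ≤ L ξ u := hd1 ▸ abs_le_L_one ξ u
  have a2 : |d2| ≤ L ξ u := hd2 ▸ abs_le_L_two ξ u
  have e := dot_eq_zero_cast ξ hpu
  rw [← hd1, ← hd2, ← hPdef] at e
  obtain ⟨ρ, hρ⟩ : ∃ ρ, ρ = 2 * ξ * d1 - d2 := ⟨_, rfl⟩
  have hρu : 3 / 4 ≤ u 0 * |ρ| := by
    have h1 : (1 : ℝ) ≤ |(pdet u : ℝ)| := by
      rw [← Int.cast_abs]; exact_mod_cast Int.one_le_abs hdet
    have h2 : (pdet u : ℝ) = u 0 * ρ - d1 ^ 2 := by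
      simp only [pdet]; push_cast; rw [hρ, hd1, hd2]; ring
    have h3 : |d1 ^ 2| ≤ 1 / 4 := by
      rw [abs_pow]
      calc |d1| ^ 2 ≤ (1 / 2) ^ 2 := pow_le_pow_left₀ (abs_nonneg _) (a1.trans hLu) 2
        _ = 1 / 4 := by norm_num
    rw [h2] at h1
    have h4 := h1.trans (abs_sub _ _)
    rw [abs_mul, abs_of_pos (by linarith : (0 : ℝ) < u 0)] at h4
    linarith
  have e1 : (p 2 : ℝ) * ρ = Q * d1 - u 0 * P := by rw [hρ, hQ]; linear_combination -e
  have e2 : (p 1 : ℝ) * ρ = 2 * ξ * (u 0 * P) - Q * d2 := by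
    rw [hρ, hQ]; linear_combination 2 * ξ * e
  have hu0P : |(u 0 : ℝ) * P| = u 0 * |P| := by
    rw [abs_mul, abs_of_pos (by linarith : (0 : ℝ) < u 0)]
  have hnn : 0 ≤ (u 0 : ℝ) * |P| := by positivity
  have hmρ : m * |ρ| ≤ |Q| * L ξ u + 2 * β * (u 0 * |P|) := by
    have f1 : |(p 2 : ℝ)| * |ρ| ≤ |Q| * L ξ u + 2 * β * (u 0 * |P|) := by
      rw [← abs_mul, e1]
      refine (abs_sub _ _).trans ?_
      rw [hu0P, abs_mul]
      have := mul_le_mul_of_nonneg_left a1 (abs_nonneg Q)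
      nlinarith
    have f2 : |(p 1 : ℝ)| * |ρ| ≤ |Q| * L ξ u + 2 * β * (u 0 * |P|) := by
      rw [← abs_mul, e2]
      refine (abs_sub _ _).trans ?_
      rw [abs_mul (2 * ξ), hu0P, abs_mul Q, abs_mul 2]
      have := mul_le_mul_of_nonneg_left a2 (abs_nonneg Q)
      norm_num
      nlinarith
    rcases max_choice |(p 1 : ℝ)| |(p 2 : ℝ)| with h | h
    · rw [hm, h]; exact f2
    · rw [hm, h]; exact f1
  have g1 := mul_le_mul_of_nonneg_left hmρ (show (0 : ℝ) ≤ u 0 by linarith)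
  have g2 := mul_le_mul_of_nonneg_left hρu hm0.le
  have g3 := mul_le_mul_of_nonneg_left hΓu (abs_nonneg Q)
  have g4 : 2 * β * ((u 0 : ℝ) ^ 2 * |P|) ≤ m / 4 := by
    have : 2 * β * ((u 0 : ℝ) ^ 2 * |P|) ≤ 2 * β * ((u 0 : ℝ) ^ 2 * (2 * m * τ)) := by gcongr
    nlinarith
  nlinarith

lemma exists_planeCoords_aux {ξ : ℝ} {p u y : Point} {Γ τ : ℝ} (hp : p ≠ 0)
    (hpu : p ⬝ᵥ u = 0) (hpy : p ⬝ᵥ y = 0) (hu1 : 1 ≤ u 0) (hLu : L ξ u ≤ 1 / 2)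
    (hdet : pdet u ≠ 0) (hy1 : 1 ≤ y 0) (hΓ : 1 ≤ Γ) (hΓu : u 0 * L ξ u ≤ Γ) (hτ : 0 ≤ τ)
    (hτy : L ξ y ≤ τ * y 0) (hs0 : 256 * bnd ξ * (Γ ^ 2 * ((u 0 : ℝ) ^ 2 * τ)) ≤ 1) :
    ∃ c : PlaneCoords p, |c.θ| ≤ bnd ξ ∧ |c.q| ≤ 1 ∧ |c.r| ≤ 2 * bnd ξ ∧
      1 ≤ (c.q ^ 2 + c.r ^ 2) * (1 + bnd ξ ^ 2) ∧ |c.θ - ξ| ≤ 8 * (Γ * τ) ∧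
      1 / (4 * Γ) ≤ |c.r - c.q * c.θ| := by
  have hB1 := one_le_bnd ξ
  have hBξ : |ξ| ≤ bnd ξ - 1 := by unfold bnd; nlinarith [sq_nonneg ξ]
  set β := bnd ξ
  have hBsq : β ≤ β ^ 2 := by nlinarith
  have hB2 : 1 ≤ β ^ 2 := by linarith
  have hu1' : (1 : ℝ) ≤ u 0 := by exact_mod_cast hu1
  have hy1' : (1 : ℝ) ≤ y 0 := by exact_mod_cast hy1
  -- consequences of the smallness assumption
  have hΓsq : 1 ≤ Γ ^ 2 := one_le_pow₀ hΓ
  have husq : 1 ≤ (u 0 : ℝ) ^ 2 := one_le_pow₀ hu1'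
  have hs1 : 256 * β * ((u 0 : ℝ) ^ 2 * τ) ≤ 1 := by
    refine le_trans ?_ hs0
    have : 0 ≤ (u 0 : ℝ) ^ 2 * τ := by positivity
    exact mul_le_mul_of_nonneg_left (by nlinarith) (by linarith)
  have hs2 : 256 * (Γ ^ 2 * τ) ≤ 1 := by
    refine le_trans ?_ hs0
    have h1 : Γ ^ 2 * τ ≤ Γ ^ 2 * ((u 0 : ℝ) ^ 2 * τ) :=
      mul_le_mul_of_nonneg_left (by nlinarith) (by positivity)
    have h2 : 0 ≤ Γ ^ 2 * τ := by positivity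
    nlinarith
  have hs3 : 256 * (Γ * τ) ≤ 1 := by
    refine le_trans ?_ hs2
    have : 0 ≤ Γ * τ := by positivity
    nlinarith
  -- the normalized polynomial
  obtain ⟨m, hm⟩ : ∃ m, m = max |(p 1 : ℝ)| |(p 2 : ℝ)| := ⟨_, rfl⟩
  have hm1 : |(p 1 : ℝ)| ≤ m := hm ▸ le_max_left _ _
  have hm2 : |(p 2 : ℝ)| ≤ m := hm ▸ le_max_right _ _
  have hm0 : 0 < m := by
    refine lt_of_le_of_ne ((abs_nonneg _).trans hm1) fun h => hp ?_
    rw [← h, abs_nonpos_iff, Int.cast_eq_zero] at hm1 hm2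
    simp only [vec3_dotProduct, hm1, hm2] at hpu
    refine point_ext ?_ hm1 hm2
    rcases mul_eq_zero.mp (show p 0 * u 0 = 0 by linarith) with h | h
    · exact h
    · omega
  have hP := abs_evalAt_le_max hm0 hm1 hm2 hpy hy1 hτy
  set P := evalAt ξ p with hPdef
  obtain ⟨Q, hQ⟩ : ∃ Q : ℝ, Q = p 1 + 2 * ξ * p 2 := ⟨_, rfl⟩
  have hQΓ := le_abs_derivative hm0 hm hP hPdef hpu hu1 hLu hdet hΓu hs1 hQ
  have hA0 : |Q / m| = |Q| / m := by rw [abs_div, abs_of_pos hm0]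
  have hA : 1 / (2 * Γ) ≤ |Q / m| := by
    rw [hA0, div_le_div_iff₀ (by linarith) hm0]; linarith
  have hAinv : 0 < 1 / (2 * Γ) := by positivity
  have hB : |(p 2 : ℝ) / m| ≤ 1 := by
    rw [abs_div, abs_of_pos hm0, div_le_one hm0]; exact hm2
  have hc : |P / m| ≤ 2 * τ := by
    rw [abs_div, abs_of_pos hm0, div_le_iff₀ hm0]; linarith
  obtain ⟨z, hz, hzb⟩ := exists_small_root (A := Q / m) (B := p 2 / m) (c := P / m)
    (abs_pos.mp (hAinv.trans_le hA)) (by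
      rw [abs_mul]
      have h1 : |(p 2 : ℝ) / m| * |P / m| ≤ 1 * (2 * τ) :=
        mul_le_mul hB hc (abs_nonneg _) (by norm_num)
      have h2 : (1 / (2 * Γ)) ^ 2 ≤ (Q / m) ^ 2 := by
        rw [← sq_abs (Q / m)]; exact pow_le_pow_left₀ hAinv.le hA 2
      have h3 : 8 * τ ≤ (1 / (2 * Γ)) ^ 2 := by
        rw [div_pow, le_div_iff₀ (by positivity)]
        have : 0 ≤ Γ ^ 2 * τ := by positivity
        linarith
      linarith)
  have hz8 : |z| ≤ 8 * (Γ * τ) := by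
    refine hzb.trans ?_
    rw [div_le_iff₀ (hAinv.trans_le hA)]
    have h1 : 8 * (Γ * τ) * (1 / (2 * Γ)) = 4 * τ := by field_simp; ring
    have h2 := mul_le_mul_of_nonneg_left hA (show 0 ≤ 8 * (Γ * τ) by positivity)
    linarith
  have hz1 : |z| ≤ 1 := by linarith
  have hθ : |ξ + z| ≤ β := (abs_add_le _ _).trans (by linarith)
  obtain ⟨θ, hθdef⟩ : ∃ θ, θ = ξ + z := ⟨_, rfl⟩
  rw [← hθdef] at hθ
  obtain ⟨q, hq⟩ : ∃ q : ℝ, q = p 2 / m := ⟨_, rfl⟩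
  obtain ⟨r, hr⟩ : ∃ r : ℝ, r = -(p 1 + p 2 * θ) / m := ⟨_, rfl⟩
  have hmq : (p 2 : ℝ) = m * q := by rw [hq]; field_simp
  have hmr : (p 1 : ℝ) = -m * (r + q * θ) := by rw [hr, hq]; field_simp; ring
  have hmp : (p 0 : ℝ) = m * (r * θ) := by
    have hz' : (p 2 : ℝ) * z ^ 2 + Q * z + P = 0 := by
      have := congrArg (fun t => m * t) hz
      simp only [mul_zero] at this
      rw [← this]; field_simp
    rw [hr, hθdef]
    rw [hPdef, hQ] at hz'
    unfold evalAt at hz'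
    field_simp
    linear_combination hz'
  have hq1 : |q| ≤ 1 := hq ▸ hB
  have hr1 : |r| ≤ 2 * β := by
    rw [hr, abs_div, abs_of_pos hm0, div_le_iff₀ hm0, abs_neg]
    refine (abs_add_le _ _).trans ?_
    rw [abs_mul]
    have := mul_le_mul hm2 hθ (abs_nonneg _) hm0.le
    have := mul_le_mul_of_nonneg_right hB1 hm0.le
    linarith
  have hW : 1 ≤ (q ^ 2 + r ^ 2) * (1 + β ^ 2) := by
    rcases max_choice |(p 1 : ℝ)| |(p 2 : ℝ)| with h | h
    · have h1 : |r + q * θ| = 1 := by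
        have : |(p 1 : ℝ)| = m * |r + q * θ| := by
          rw [hmr, abs_mul, abs_neg, abs_of_pos hm0]
        rw [← h, ← hm] at this
        have h2 : m * 1 = m * |r + q * θ| := by linarith
        exact (mul_left_cancel₀ hm0.ne' h2).symm
      have h3 : (r + q * θ) ^ 2 = 1 := by rw [← sq_abs, h1]; norm_num
      have h4 : θ ^ 2 ≤ β ^ 2 := by
        rw [← sq_abs]; exact pow_le_pow_left₀ (abs_nonneg _) hθ 2
      have h5 : 0 ≤ (q ^ 2 + r ^ 2) * (β ^ 2 - θ ^ 2) :=
        mul_nonneg (by positivity) (by linarith)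
      linarith [sq_nonneg (q - r * θ)]
    · have h1 : |q| = 1 := by
        rw [hq, abs_div, abs_of_pos hm0, ← h, ← hm, div_self hm0.ne']
      have h2 : q ^ 2 = 1 := by rw [← sq_abs, h1]; norm_num
      rw [h2]
      linarith [sq_nonneg r, mul_nonneg (sq_nonneg r) (sq_nonneg β)]
  have hqr : 0 < q ^ 2 + r ^ 2 := by
    by_contra hcon
    have h1 : (q ^ 2 + r ^ 2) * (1 + β ^ 2) ≤ 0 :=
      mul_nonpos_of_nonpos_of_nonneg (not_lt.mp hcon) (by positivity)
    linarith
  have hΔ : 1 / (4 * Γ) ≤ |r - q * θ| := by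
    have e : r - q * θ = -(Q / m + 2 * q * z) := by
      rw [hr, hq, hQ, hθdef]; field_simp; ring
    rw [e, abs_neg]
    have h1 : |Q / m| - |2 * q * z| ≤ |Q / m + 2 * q * z| := by
      have := abs_sub_abs_le_abs_sub (Q / m) (-(2 * q * z))
      rwa [abs_neg, sub_neg_eq_add] at this
    have h2 : |2 * q * z| ≤ 16 * (Γ * τ) := by
      rw [abs_mul, abs_mul]
      have : |q| * |z| ≤ 1 * (8 * (Γ * τ)) := mul_le_mul hq1 hz8 (abs_nonneg _) (by norm_num)
      norm_num
      linarith
    have h3 : 16 * (Γ * τ) ≤ 1 / (4 * Γ) := by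
      have : 0 ≤ Γ ^ 2 * τ := by positivity
      rw [le_div_iff₀ (by positivity)]
      linarith
    have h4 : 1 / (2 * Γ) = 1 / (4 * Γ) + 1 / (4 * Γ) := by field_simp; norm_num
    linarith
  exact ⟨⟨θ, q, r, m, hm0.ne', hmq, hmr, hmp, hqr⟩, hθ, hq1, hr1, hW,
    by change |θ - ξ| ≤ _; rw [hθdef]; simpa using hz8, hΔ⟩

/-- Size estimates for the coordinates of a plane that contains two good points `u` and `y`, the
second of which is much larger: up to constants and powers of `Γ`, `lam x` has the size of `x₀`,
and `kap x` has the size of `L(x)`. -/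
theorem exists_planeCoords (ξ : ℝ) : ∃ K, 1 ≤ K ∧ ∀ (p u y : Point) (Γ τ : ℝ), p ≠ 0 →
    p ⬝ᵥ u = 0 → p ⬝ᵥ y = 0 → 1 ≤ u 0 → L ξ u ≤ 1 / 2 → pdet u ≠ 0 → 1 ≤ y 0 → 1 ≤ Γ →
    u 0 * L ξ u ≤ Γ → 0 ≤ τ → L ξ y ≤ τ * y 0 → K * (Γ ^ 2 * ((u 0 : ℝ) ^ 2 * τ)) ≤ 1 →
    ∃ c : PlaneCoords p,
      (∀ x : Point, |c.lam x| ≤ K * (|(x 0 : ℝ)| + L ξ x)) ∧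
      (∀ x : Point, |c.kap x| ≤ K * (L ξ x + Γ * τ * |(x 0 : ℝ)|)) ∧
      (∀ x : Point, p ⬝ᵥ x = 0 → L ξ x ≤ K * (|c.kap x| + Γ * τ * |(x 0 : ℝ)|)) ∧
      (∀ x : Point, p ⬝ᵥ x = 0 → |(x 0 : ℝ)| ≤ K * Γ * (|c.lam x| + |c.kap x|)) ∧
      (∀ x z : Point, p ⬝ᵥ x = 0 → p ⬝ᵥ z = 0 →
        ‖x ⨯₃ z‖ ≤ K * Γ * (|c.lam x * c.kap z| + |c.lam z * c.kap x|)) := by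
  have hB1 := one_le_bnd ξ
  have hBξ : |ξ| ≤ bnd ξ - 1 := by unfold bnd; nlinarith [sq_nonneg ξ]
  set β := bnd ξ
  have hBsq : β ≤ β ^ 2 := by nlinarith
  have hB2 : 1 ≤ β ^ 2 := by linarith
  obtain ⟨K, hK⟩ : ∃ K, K = 256 * (1 + β ^ 2) * β ^ 2 := ⟨_, rfl⟩
  have hK1 : 256 * β ^ 2 ≤ K := by rw [hK]; nlinarith
  have hK2 : 24 * (1 + β ^ 2) * β ^ 2 ≤ K := by rw [hK]; nlinarith
  refine ⟨K, by linarith, ?_⟩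
  intro p u y Γ τ hp hpu hpy hu1 hLu hdet hy1 hΓ hΓu hτ hτy hsmall
  have hs0 : 256 * β * (Γ ^ 2 * ((u 0 : ℝ) ^ 2 * τ)) ≤ 1 :=
    le_trans (mul_le_mul_of_nonneg_right (by linarith) (by positivity)) hsmall
  obtain ⟨c, hθ, hq1, hr1, hW, hz8, hΔ⟩ :=
    exists_planeCoords_aux hp hpu hpy hu1 hLu hdet hy1 hΓ hΓu hτ hτy hs0
  have hqr := c.hqr
  obtain ⟨z, hz⟩ : ∃ z, z = c.θ - ξ := ⟨_, rfl⟩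
  obtain ⟨θ, hθ'⟩ : ∃ θ, θ = c.θ := ⟨_, rfl⟩
  obtain ⟨q, hq'⟩ : ∃ q, q = c.q := ⟨_, rfl⟩
  obtain ⟨r, hr'⟩ : ∃ r, r = c.r := ⟨_, rfl⟩
  have hθdef : θ = ξ + z := by rw [hz, hθ']; ring
  rw [← hz] at hz8
  rw [← hθ'] at hθ hΔ
  rw [← hq'] at hq1 hW hΔ hqr
  rw [← hr'] at hr1 hW hΔ hqr
  have hΔ' : ∀ t : ℝ, |t| ≤ 4 * Γ * |(r - q * θ) * t| := by
    intro t
    rw [abs_mul, ← mul_assoc]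
    have : 1 ≤ 4 * Γ * |r - q * θ| := by
      rw [div_le_iff₀ (by positivity)] at hΔ; linarith
    exact le_mul_of_one_le_left (abs_nonneg _) this
  have hK3 : 3 * β ≤ K := by linarith
  have bd : ∀ s t S T : ℝ, |s| ≤ S → |t| ≤ T → |s * t| ≤ S * T := by
    intro s t S T h1 h2
    rw [abs_mul]; exact mul_le_mul h1 h2 (abs_nonneg _) ((abs_nonneg _).trans h1)
  have hzx : ∀ x : Point, |z * x 0| ≤ 8 * (Γ * τ * |(x 0 : ℝ)|) := fun x =>
    (bd _ _ _ _ hz8 le_rfl).trans (by linarith)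
  refine ⟨c, fun x => ?_, fun x => ?_, fun x hx => ?_, fun x hx => ?_, fun x y hx hy => ?_⟩
  · have hL := L_nonneg ξ x
    have h1 : |(x 1 : ℝ)| ≤ β * |(x 0 : ℝ)| + L ξ x := by
      have e : (x 1 : ℝ) = x 0 * ξ - (x 0 * ξ - x 1) := by ring
      rw [e]
      refine (abs_sub _ _).trans (add_le_add ?_ (abs_le_L_one ξ x))
      rw [mul_comm]
      exact bd _ _ _ _ (by linarith) le_rfl
    have h2 : |c.lam x| ≤ 2 * β * |(x 0 : ℝ)| + 1 * (β * |(x 0 : ℝ)| + L ξ x) := by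
      rw [PlaneCoords.lam, ← hr', ← hq']
      exact (abs_sub _ _).trans (add_le_add (bd _ _ _ _ hr1 le_rfl) (bd _ _ _ _ hq1 h1))
    have h3 := mul_le_mul_of_nonneg_right hK3 (add_nonneg (abs_nonneg (x 0 : ℝ)) hL)
    have h4 := mul_le_mul_of_nonneg_right hB1 hL
    linarith
  · have hL := L_nonneg ξ x
    obtain ⟨t, ht⟩ : ∃ t, t = L ξ x + Γ * τ * |(x 0 : ℝ)| := ⟨_, rfl⟩
    have hx0 : 0 ≤ Γ * τ * |(x 0 : ℝ)| := by positivity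
    have ha : |(x 1 : ℝ) - θ * x 0| ≤ 8 * t := by
      have e : (x 1 : ℝ) - θ * x 0 = -(x 0 * ξ - x 1) - z * x 0 := by rw [hθdef]; ring
      rw [e]
      refine (abs_sub _ _).trans ?_
      rw [abs_neg]
      linarith [abs_le_L_one ξ x, hzx x]
    have hb : |(x 2 : ℝ) - θ * x 1| ≤ 8 * β * t := by
      have e : (x 2 : ℝ) - θ * x 1 =
          θ * (x 0 * ξ - x 1) - (x 0 * ξ ^ 2 - x 2) - ξ * (z * x 0) := by rw [hθdef]; ring
      rw [e]
      refine (abs_sub _ _).trans (le_trans (add_le_add (abs_sub _ _) le_rfl) ?_)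
      have f1 := bd _ _ _ _ hθ (abs_le_L_one ξ x)
      have f2 := abs_le_L_two ξ x
      have f3 := bd _ _ _ _ (show |ξ| ≤ β by linarith) (hzx x)
      have f4 := mul_le_mul_of_nonneg_right hB1 hL
      rw [ht]
      linarith
    have hk : |c.kap x| = |q * (x 1 - θ * x 0) + r * (x 2 - θ * x 1)| / (q ^ 2 + r ^ 2) := by
      rw [PlaneCoords.kap, ← hθ', ← hq', ← hr', abs_div, abs_of_pos hqr]
    rw [hk, div_le_iff₀ hqr, ← ht]
    have ht0 : 0 ≤ t := by rw [ht]; linarith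
    have h1 : |q * (x 1 - θ * x 0) + r * (x 2 - θ * x 1)| ≤ 1 * (8 * t) + 2 * β * (8 * β * t) :=
      (abs_add_le _ _).trans (add_le_add (bd _ _ _ _ hq1 ha) (bd _ _ _ _ hr1 hb))
    have h2 : 24 * β ^ 2 * t ≤ K * t * (q ^ 2 + r ^ 2) := by
      calc 24 * β ^ 2 * t = 24 * β ^ 2 * t * 1 := by ring
        _ ≤ 24 * β ^ 2 * t * ((q ^ 2 + r ^ 2) * (1 + β ^ 2)) :=
          mul_le_mul_of_nonneg_left hW (by positivity)
        _ = 24 * (1 + β ^ 2) * β ^ 2 * (t * (q ^ 2 + r ^ 2)) := by ring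
        _ ≤ K * (t * (q ^ 2 + r ^ 2)) := mul_le_mul_of_nonneg_right hK2 (by positivity)
        _ = _ := by ring
    have h3 := mul_le_mul_of_nonneg_right hB2 ht0
    linarith
  · obtain ⟨e1, e2⟩ := c.coords hx
    rw [← hθ', ← hq'] at e1
    rw [← hθ', ← hq', ← hr'] at e2
    rw [← e1] at e2
    have h0 : 0 ≤ Γ * τ * |(x 0 : ℝ)| := by positivity
    have f0 := bd _ _ _ _ (le_refl |c.kap x|) hq1
    have d1 : |(x 0 : ℝ) * ξ - x 1| ≤ |c.kap x| + 8 * (Γ * τ * |(x 0 : ℝ)|) := by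
      have e : (x 0 : ℝ) * ξ - x 1 = -(c.kap x * q) - z * x 0 := by rw [e1, hθdef]; ring
      rw [e]
      refine (abs_sub _ _).trans ?_
      rw [abs_neg]
      linarith [hzx x]
    have d2 : |(x 0 : ℝ) * ξ ^ 2 - x 2| ≤ 3 * β * |c.kap x| + 16 * β * (Γ * τ * |(x 0 : ℝ)|) := by
      have e : (x 0 : ℝ) * ξ ^ 2 - x 2 =
          θ * (x 0 * ξ - x 1) - ξ * (z * x 0) - c.kap x * r := by rw [e2, hθdef]; ring
      rw [e]
      refine (abs_sub _ _).trans (le_trans (add_le_add (abs_sub _ _) le_rfl) ?_)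
      have f1 := bd _ _ _ _ hθ d1
      have f2 := bd _ _ _ _ (le_refl |c.kap x|) hr1
      have f3 := bd _ _ _ _ (show |ξ| ≤ β by linarith) (hzx x)
      linarith
    have hk := abs_nonneg (c.kap x)
    have g1 := mul_le_mul_of_nonneg_right (show 16 * β ≤ K by linarith) hk
    have g2 := mul_le_mul_of_nonneg_right (show 16 * β ≤ K by linarith) h0
    have g3 := mul_le_mul_of_nonneg_right hB1 hk
    have g4 := mul_le_mul_of_nonneg_right hB1 h0
    apply max_le
    · linarith
    · linarith
  · have e := c.lam_eq hx
    rw [← hθ', ← hq', ← hr'] at e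
    have h1 : |(r - q * θ) * x 0| ≤ |c.lam x| + |c.kap x| := by
      have e' : (r - q * θ) * x 0 = c.lam x + q ^ 2 * c.kap x := by rw [e]; ring
      rw [e']
      refine (abs_add_le _ _).trans (add_le_add le_rfl ?_)
      have : |q ^ 2| ≤ 1 := by rw [abs_pow]; exact pow_le_one₀ (abs_nonneg _) hq1
      exact (bd _ _ _ _ this le_rfl).trans (by linarith)
    have h2 := hΔ' (x 0)
    have h3 := mul_le_mul_of_nonneg_left h1 (show 0 ≤ 4 * Γ by positivity)
    have h4 : 4 * Γ * (|c.lam x| + |c.kap x|) ≤ K * Γ * (|c.lam x| + |c.kap x|) := by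
      gcongr; linarith
    linarith
  · obtain ⟨x1, x2⟩ := c.coords hx
    obtain ⟨y1, y2⟩ := c.coords hy
    rw [← hθ', ← hq'] at x1
    rw [← hθ', ← hq', ← hr'] at x2
    rw [← hθ', ← hq'] at y1
    rw [← hθ', ← hq', ← hr'] at y2
    obtain ⟨w, hw⟩ : ∃ w : ℝ, w = x 0 * c.kap y - y 0 * c.kap x := ⟨_, rfl⟩
    have hwΔ : (r - q * θ) * w = c.lam x * c.kap y - c.lam y * c.kap x := by
      have ex := c.lam_eq hx
      have ey := c.lam_eq hy
      rw [← hθ', ← hq', ← hr'] at ex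
      rw [← hθ', ← hq', ← hr'] at ey
      rw [ex, ey, hw]; ring
    have hwb : |w| ≤ 4 * Γ * (|c.lam x * c.kap y| + |c.lam y * c.kap x|) := by
      refine (hΔ' w).trans ?_
      rw [hwΔ]
      exact mul_le_mul_of_nonneg_left (abs_sub _ _) (by positivity)
    have hmain : ∀ s : ℝ, |s| ≤ 3 * β ^ 2 →
        |s * w| ≤ K * Γ * (|c.lam x * c.kap y| + |c.lam y * c.kap x|) := by
      intro s hs
      refine (bd _ _ _ _ hs hwb).trans ?_
      have : 3 * β ^ 2 * (4 * Γ * (|c.lam x * c.kap y| + |c.lam y * c.kap x|)) =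
        12 * β ^ 2 * (Γ * (|c.lam x * c.kap y| + |c.lam y * c.kap x|)) := by ring
      rw [this, mul_assoc K]
      gcongr
      linarith
    apply norm_le_of_coords
    intro i
    fin_cases i
    · have e : (((x ⨯₃ y) 0 : ℤ) : ℝ) = θ * r * w := by
        simp only [cross_apply, cons_val]; push_cast
        rw [x1, x2, y1, y2, hw]; ring
      change |(((x ⨯₃ y) 0 : ℤ) : ℝ)| ≤ _
      rw [e]
      exact hmain _ ((bd _ _ _ _ hθ hr1).trans (by linarith))
    · have e : (((x ⨯₃ y) 1 : ℤ) : ℝ) = -(θ * q + r) * w := by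
        simp only [cross_apply, cons_val]; push_cast
        rw [x2, y2, hw]; ring
      change |(((x ⨯₃ y) 1 : ℤ) : ℝ)| ≤ _
      rw [e]
      refine hmain _ ?_
      rw [abs_neg]
      refine (abs_add_le _ _).trans ((add_le_add (bd _ _ _ _ hθ hq1) hr1).trans (by linarith))
    · have e : (((x ⨯₃ y) 2 : ℤ) : ℝ) = q * w := by
        simp only [cross_apply, cons_val]; push_cast
        rw [x1, y1, hw]; ring
      change |(((x ⨯₃ y) 2 : ℤ) : ℝ)| ≤ _
      rw [e]
      exact hmain _ (hq1.trans (by linarith))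

lemma eq_zero_of_L_lt_one {ξ : ℝ} {x : Point} (h0 : x 0 = 0) (hL : L ξ x < 1) : x = 0 := by
  have h1 := (abs_le_L_one ξ x).trans_lt hL
  have h2 := (abs_le_L_two ξ x).trans_lt hL
  rw [h0] at h1 h2
  simp only [Int.cast_zero, zero_mul, zero_sub, abs_neg] at h1 h2
  rw [← Int.cast_abs] at h1 h2
  have h1' : |x 1| < 1 := by exact_mod_cast h1
  have h2' : |x 2| < 1 := by exact_mod_cast h2
  exact point_ext h0 (Int.abs_lt_one_iff.mp h1') (Int.abs_lt_one_iff.mp h2')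

/-- Logarithmic form of `exists_planeCoords`: on the plane with normal vector `p`, spanned by two
points `u`, `y` of defect `≤ E`, there are functions `α` (the logarithmic size) and `β` (the
quality) that are additive with respect to the bracket, and that agree with `log |x₀|` and `qual`
up to `O(E)`. -/
theorem exists_logCoords {ξ : ℝ} (hξ : IrrationalNonQuadratic ξ) : ∃ C, 0 ≤ C ∧
    ∀ (p u y : Point) (E : ℝ), p ≠ 0 → p ⬝ᵥ u = 0 → p ⬝ᵥ y = 0 → IsMinimalPoint ξ u →
    IsMinimalPoint ξ y → pdet u ≠ 0 → 0 ≤ E → lsize u - qual ξ u ≤ E →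
    lsize y - qual ξ y ≤ E → 3 * E + 2 * lsize u + C ≤ 2 * lsize y →
    ∃ α β : Point → ℝ,
      (∀ x, p ⬝ᵥ x = 0 → pdet x ≠ 0 → α x - β x = Real.log |(pdet x : ℝ)|) ∧
      (∀ x y z, p ⬝ᵥ x = 0 → p ⬝ᵥ y = 0 → p ⬝ᵥ z = 0 → pdet x ≠ 0 → pdet y ≠ 0 → pdet z ≠ 0 →
        p ⬝ᵥ bracket x y z = 0 ∧ pdet (bracket x y z) ≠ 0 ∧
        α (bracket x y z) = α x + α y - β z ∧ β (bracket x y z) = β x + β y - α z) ∧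
      (∀ x, p ⬝ᵥ x = 0 → pdet x ≠ 0 → x 0 ≠ 0 → L ξ x ≤ 1 → Real.log |(x 0 : ℝ)| ≤ lsize y →
        α x ≤ Real.log |(x 0 : ℝ)| + C ∧ qual ξ x - 2 * E - C ≤ β x) ∧
      (∀ x, p ⬝ᵥ x = 0 → pdet x ≠ 0 → C ≤ β x → x 0 ≠ 0 ∧
        Real.log |(x 0 : ℝ)| ≤ α x + E + C ∧
        min (β x) (2 * lsize y - 3 * E - α x) ≤ qual ξ x + C) ∧
      (∀ x z, p ⬝ᵥ x = 0 → p ⬝ᵥ z = 0 → pdet x ≠ 0 → pdet z ≠ 0 → x ⨯₃ z ≠ 0 →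
        Real.log ‖x ⨯₃ z‖ ≤ max (α x - β z) (α z - β x) + E + C) := by
  obtain ⟨K, hK, hmain⟩ := exists_planeCoords ξ
  obtain ⟨c1, hc1⟩ : ∃ c, c = Real.log (2 * bnd ξ + 1) := ⟨_, rfl⟩
  have hc1' : 0 ≤ c1 := hc1 ▸ Real.log_nonneg (by linarith [one_le_bnd ξ])
  have hlK := Real.log_nonneg hK
  have hl2 : 0 < Real.log 2 := Real.log_pos (by norm_num)
  have hl1 : 0 ≤ Real.log (1 + Real.exp c1) := Real.log_nonneg (by linarith [Real.exp_pos c1])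
  obtain ⟨C, hC⟩ : ∃ C, C = 2 * Real.log K + 2 * Real.log 2 + Real.log (1 + Real.exp c1) :=
    ⟨_, rfl⟩
  refine ⟨C, by rw [hC]; positivity, ?_⟩
  intro p u y E hp hpu hpy hu hy hdu hE hdefu hdefy hsep
  obtain ⟨T, hT⟩ : ∃ T, T = lsize y := ⟨_, rfl⟩
  rw [← hT] at hdefy hsep ⊢
  have hΓτ : Real.exp E * Real.exp (E - 2 * T) = Real.exp (2 * E - 2 * T) := by
    rw [← Real.exp_add]; ring_nf
  obtain ⟨c, hlam, hkap, hLx, hx0, hcr⟩ := hmain p u y (Real.exp E) (Real.exp (E - 2 * T)) hp hpu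
    hpy hu.one_le hu.L_le_half hdu hy.one_le (Real.one_le_exp hE) (by
      rw [← hu.exp_lsize, ← exp_neg_qual hξ hu.ne_zero, ← Real.exp_add]
      exact Real.exp_le_exp.mpr (by linarith)) (Real.exp_pos _).le (by
      rw [← hy.exp_lsize, ← exp_neg_qual hξ hy.ne_zero, ← Real.exp_add]
      exact Real.exp_le_exp.mpr (by linarith)) (by
      rw [← hu.exp_lsize, ← Real.exp_log (show 0 < K by linarith), ← Real.exp_nat_mul,
        ← Real.exp_nat_mul, ← Real.exp_add, ← Real.exp_add, ← Real.exp_add, Real.exp_le_one_iff]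
      push_cast
      linarith)
  rw [hΓτ] at hkap hLx
  have hne : ∀ x, p ⬝ᵥ x = 0 → pdet x ≠ 0 → c.kap x ≠ 0 ∧ c.lam x ≠ 0 := by
    intro x hx hd
    have : (pdet x : ℝ) ≠ 0 := by exact_mod_cast hd
    rw [c.pdet_eq hx] at this
    exact mul_ne_zero_iff.mp this
  have hdet1 : ∀ x, pdet x ≠ 0 → (1 : ℝ) ≤ |(pdet x : ℝ)| := by
    intro x hd
    rw [← Int.cast_abs]; exact_mod_cast Int.one_le_abs hd
  refine ⟨fun x => Real.log |c.lam x|, fun x => -Real.log |c.kap x|, ?_, ?_, ?_, ?_, ?_⟩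
  · intro x hx hd
    obtain ⟨h1, h2⟩ := hne x hx hd
    dsimp only
    rw [c.pdet_eq hx, abs_mul, Real.log_mul (abs_ne_zero.mpr h1) (abs_ne_zero.mpr h2)]
    ring
  · intro x y z hx hy hz hdx hdy hdz
    obtain ⟨x1, x2⟩ := hne x hx hdx
    obtain ⟨y1, y2⟩ := hne y hy hdy
    obtain ⟨z1, z2⟩ := hne z hz hdz
    have hb := c.dot_bracket hx hy hz
    refine ⟨hb, ?_, ?_, ?_⟩
    · have : (pdet (bracket x y z) : ℝ) ≠ 0 := by
        rw [c.pdet_eq hb, c.kap_bracket hx hy hz, c.lam_bracket hx hy hz]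
        positivity
      exact_mod_cast this
    · dsimp only
      rw [c.lam_bracket hx hy hz, abs_mul, abs_mul, Real.log_mul (by positivity) (by positivity),
        Real.log_mul (by positivity) (by positivity)]
      ring
    · dsimp only
      rw [c.kap_bracket hx hy hz, abs_mul, abs_mul, Real.log_mul (by positivity) (by positivity),
        Real.log_mul (by positivity) (by positivity)]
      ring
  · intro x hx hd hx0 hL hxT
    obtain ⟨h1, h2⟩ := hne x hx hd
    have hx1 : (1 : ℝ) ≤ |(x 0 : ℝ)| := by
      rw [← Int.cast_abs]; exact_mod_cast Int.one_le_abs hx0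
    have hxne : x ≠ 0 := by rintro rfl; exact hx0 rfl
    constructor
    · have h3 : |c.lam x| ≤ K * 2 * |(x 0 : ℝ)| := (hlam x).trans (by nlinarith)
      have h4 := Real.log_le_log (abs_pos.mpr h2) h3
      rw [Real.log_mul (by positivity) (by positivity),
        Real.log_mul (by positivity) (by norm_num)] at h4
      dsimp only
      linarith
    · have hq := qual_le_of_pdet hd hx0 hL
      rw [← hc1] at hq
      have h3 : Real.exp (2 * E - 2 * T) * |(x 0 : ℝ)| ≤
          Real.exp c1 * (Real.exp (2 * E) * L ξ x) := by
        rw [← Real.exp_log (show 0 < |(x 0 : ℝ)| by linarith), ← exp_neg_qual hξ hxne,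
          ← Real.exp_add, ← Real.exp_add, ← Real.exp_add]
        exact Real.exp_le_exp.mpr (by linarith)
      have h4 : L ξ x ≤ Real.exp (2 * E) * L ξ x :=
        le_mul_of_one_le_left (L_nonneg _ _) (Real.one_le_exp (by linarith))
      have h5 : |c.kap x| ≤ K * ((1 + Real.exp c1) * (Real.exp (2 * E) * L ξ x)) :=
        (hkap x).trans (mul_le_mul_of_nonneg_left (by linarith) (by linarith))
      have h6 := Real.log_le_log (abs_pos.mpr h1) h5
      have hLp := L_pos hξ hxne
      rw [Real.log_mul (by positivity) (by positivity),
        Real.log_mul (by positivity) (by positivity),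
        Real.log_mul (by positivity) (by positivity), Real.log_exp] at h6
      dsimp only
      unfold qual
      linarith
  · intro x hx hd hβ
    obtain ⟨h1, h2⟩ := hne x hx hd
    dsimp only at hβ ⊢
    have hk1 : |c.kap x| * K < 1 := by
      rw [← Real.exp_log (abs_pos.mpr h1), ← Real.exp_log (show 0 < K by linarith),
        ← Real.exp_add, Real.exp_lt_one_iff]
      linarith
    have hk1' : |c.kap x| < 1 := by nlinarith [abs_nonneg (c.kap x)]
    have hkl : |c.kap x| ≤ |c.lam x| := by
      have := hdet1 x hd
      rw [c.pdet_eq hx, abs_mul] at this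
      nlinarith [abs_nonneg (c.kap x), abs_nonneg (c.lam x)]
    have hx0' : x 0 ≠ 0 := by
      intro h0
      have := hLx x hx
      rw [h0] at this
      simp only [Int.cast_zero, abs_zero, mul_zero, add_zero] at this
      have hz := eq_zero_of_L_lt_one h0 (this.trans_lt (by linarith))
      exact hd (by rw [hz]; simp [pdet])
    have hx1 : (0 : ℝ) < |(x 0 : ℝ)| := abs_pos.mpr (by exact_mod_cast hx0')
    have hxne : x ≠ 0 := by rintro rfl; exact hx0' rfl
    have hb1 : |(x 0 : ℝ)| ≤ K * 2 * (Real.exp E * |c.lam x|) := by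
      refine (hx0 x hx).trans ?_
      have := mul_le_mul_of_nonneg_left (show |c.lam x| + |c.kap x| ≤ 2 * |c.lam x| by linarith)
        (show 0 ≤ K * Real.exp E by positivity)
      linarith
    have hl1' : Real.log |(x 0 : ℝ)| ≤ Real.log |c.lam x| + E + (Real.log K + Real.log 2) := by
      have := Real.log_le_log hx1 hb1
      rw [Real.log_mul (by positivity) (by positivity), Real.log_mul (by positivity) (by norm_num),
        Real.log_mul (by positivity) (by positivity), Real.log_exp] at this
      linarith
    refine ⟨hx0', by linarith, ?_⟩
    obtain ⟨M, hM⟩ : ∃ M, M = min (-Real.log |c.kap x|) (2 * T - 3 * E - Real.log |c.lam x|) :=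
      ⟨_, rfl⟩
    rw [← hM]
    have e1 : |c.kap x| ≤ K * 2 * Real.exp (-M) := by
      have : |c.kap x| ≤ Real.exp (-M) := by
        rw [← Real.exp_log (abs_pos.mpr h1)]
        have := min_le_left (-Real.log |c.kap x|) (2 * T - 3 * E - Real.log |c.lam x|)
        exact Real.exp_le_exp.mpr (by linarith)
      nlinarith [Real.exp_pos (-M)]
    have e2 : Real.exp (2 * E - 2 * T) * |(x 0 : ℝ)| ≤ K * 2 * Real.exp (-M) := by
      have f1 := mul_le_mul_of_nonneg_left hb1 (Real.exp_pos (2 * E - 2 * T)).le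
      have f2 : Real.exp (2 * E - 2 * T) * (Real.exp E * |c.lam x|) ≤ Real.exp (-M) := by
        rw [← Real.exp_log (abs_pos.mpr h2), ← Real.exp_add, ← Real.exp_add]
        have := min_le_right (-Real.log |c.kap x|) (2 * T - 3 * E - Real.log |c.lam x|)
        exact Real.exp_le_exp.mpr (by linarith)
      have f3 := mul_le_mul_of_nonneg_left f2 (show 0 ≤ K * 2 by linarith)
      linarith
    have e3 : L ξ x ≤ K * 2 * (K * 2 * Real.exp (-M)) := by
      refine (hLx x hx).trans ?_
      have := mul_le_mul_of_nonneg_left (add_le_add e1 e2) (show 0 ≤ K by linarith)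
      linarith
    have e4 := Real.log_le_log (L_pos hξ hxne) e3
    rw [Real.log_mul (by positivity) (by positivity), Real.log_mul (by positivity) (by norm_num),
      Real.log_mul (by positivity) (by positivity), Real.log_mul (by positivity) (by norm_num),
      Real.log_exp] at e4
    unfold qual
    linarith
  · intro x z hx hz hdx hdz hxz
    obtain ⟨x1, x2⟩ := hne x hx hdx
    obtain ⟨z1, z2⟩ := hne z hz hdz
    dsimp only
    obtain ⟨M, hM⟩ : ∃ M, M = max (Real.log |c.lam x| - -Real.log |c.kap z|)
      (Real.log |c.lam z| - -Real.log |c.kap x|) := ⟨_, rfl⟩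
    rw [← hM]
    have e1 : |c.lam x * c.kap z| ≤ Real.exp M := by
      rw [abs_mul, ← Real.exp_log (abs_pos.mpr x2), ← Real.exp_log (abs_pos.mpr z1),
        ← Real.exp_add]
      refine Real.exp_le_exp.mpr (le_trans (le_of_eq ?_) (hM ▸ le_max_left _ _))
      ring
    have e2 : |c.lam z * c.kap x| ≤ Real.exp M := by
      rw [abs_mul, ← Real.exp_log (abs_pos.mpr z2), ← Real.exp_log (abs_pos.mpr x1),
        ← Real.exp_add]
      refine Real.exp_le_exp.mpr (le_trans (le_of_eq ?_) (hM ▸ le_max_right _ _))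
      ring
    have e3 : ‖x ⨯₃ z‖ ≤ K * 2 * (Real.exp E * Real.exp M) := by
      refine (hcr x z hx hz).trans ?_
      have := mul_le_mul_of_nonneg_left (add_le_add e1 e2) (show 0 ≤ K * Real.exp E by positivity)
      linarith
    have e4 := Real.log_le_log (lt_of_lt_of_le one_pos (one_le_norm hxz)) e3
    rw [Real.log_mul (by positivity) (by positivity), Real.log_mul (by positivity) (by norm_num),
      Real.log_mul (by positivity) (by positivity), Real.log_exp, Real.log_exp] at e4
    linarith

lemma betaSet_mono {ξ ε ε' : ℝ} (h : ε ≤ ε') : betaSet ξ ε ⊆ betaSet ξ ε' := by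
  rintro b ⟨hb, hev⟩
  refine ⟨hb, hev.mono fun B ⟨x, h1, h2, h3⟩ => ⟨x, h1, h2, h3.trans (min_le_min le_rfl ?_)⟩⟩
  exact Real.rpow_le_rpow_of_exponent_le h1 (by linarith)

lemma pdet_smul (m : ℤ) (x : Point) : pdet (m • x) = m ^ 2 * pdet x := by
  simp only [pdet, Pi.smul_apply, smul_eq_mul]; ring

lemma cross_dot_exchange (x y z : Point) : (x ⨯₃ y) ⬝ᵥ z = -((x ⨯₃ z) ⬝ᵥ y) := by
  simp only [cross_apply, vec3_dotProduct, cons_val]; ring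

/-! ### Points of small defect -/

/-- The point `s` at which the points of `G` enter a plane, and its successor `n`. -/
lemma exists_entry_points {ξ : ℝ} (hξ : IrrationalNonQuadratic ξ) {G : Set Point} (hG : G ⊆ MP ξ)
    {p u y : Point} (huy : Consec G u y) (hpu : p ⬝ᵥ u = 0) (hpy : p ⬝ᵥ y = 0)
    (h : ∃ g ∈ G, p ⬝ᵥ g ≠ 0 ∧ g 0 < u 0) :
    ∃ r s n, Consec G r s ∧ Consec G s n ∧ p ⬝ᵥ r ≠ 0 ∧ p ⬝ᵥ s = 0 ∧ p ⬝ᵥ n = 0 ∧ s 0 ≤ u 0 ∧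
      n 0 ≤ y 0 := by
  have heq : ∀ a ∈ G, ∀ b ∈ G, a 0 = b 0 → a = b := fun a ha b hb hab =>
    IsMinimalPoint.eq_of_first_eq hξ (hG ha) (hG hb) hab
  obtain ⟨g, hg, hpg, hgu⟩ := h
  obtain ⟨r, ⟨hr, hpr⟩, hru, hmax⟩ := exists_greatest (G := {g ∈ G | p ⬝ᵥ g ≠ 0}) (n := u 0)
    ⟨g, ⟨hg, hpg⟩, hgu⟩
  obtain ⟨s, hs⟩ := exists_succ (G := G) hr ⟨u, huy.1, hru⟩
  have hin : ∀ c ∈ G, r 0 < c 0 → c 0 ≤ u 0 → p ⬝ᵥ c = 0 := by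
    intro c hc hrc hcu
    rcases hcu.lt_or_eq with h | h
    · by_contra hne
      have := hmax c ⟨hc, hne⟩ h
      omega
    · rw [heq c hc u huy.1 h]; exact hpu
  have hsu : s 0 ≤ u 0 := (hs.2.2.2 u huy.1).resolve_left (by omega)
  obtain ⟨n, hn⟩ := exists_succ (G := G) hs.2.1 ⟨y, huy.2.1, by have := huy.2.2.1; omega⟩
  have hny : n 0 ≤ y 0 := (hn.2.2.2 y huy.2.1).resolve_left (by have := huy.2.2.1; omega)
  refine ⟨r, s, n, hs, hn, hpr, hin s hs.2.1 hs.2.2.1 hsu, ?_, hsu, hny⟩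
  rcases huy.2.2.2 n hn.2.1 with h | h
  · exact hin n hn.2.1 (hs.2.2.1.trans hn.2.2.1) h
  · rw [heq n hn.2.1 y huy.2.1 (le_antisymm hny h)]; exact hpy

/-- Iterating `w ↦ [w, n, s]` from `s` yields points of the plane whose two logarithmic coordinates
form, up to a controlled error, the arithmetic progression `S + k (N - S)`. -/
lemma exists_translates {p s n : Point} {α β : Point → ℝ} {S N e : ℝ}
    (hbr : ∀ x y z, p ⬝ᵥ x = 0 → p ⬝ᵥ y = 0 → p ⬝ᵥ z = 0 → pdet x ≠ 0 → pdet y ≠ 0 →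
      pdet z ≠ 0 → p ⬝ᵥ bracket x y z = 0 ∧ pdet (bracket x y z) ≠ 0 ∧
        α (bracket x y z) = α x + α y - β z ∧ β (bracket x y z) = β x + β y - α z)
    (hps : p ⬝ᵥ s = 0) (hpn : p ⬝ᵥ n = 0) (hds : pdet s ≠ 0) (hdn : pdet n ≠ 0)
    (hαs : |α s - S| ≤ e) (hβs : |β s - S| ≤ e) (hαn : |α n - N| ≤ e) (hβn : |β n - N| ≤ e)
    (k : ℕ) : ∃ w, p ⬝ᵥ w = 0 ∧ pdet w ≠ 0 ∧
      |α w - (S + k * (N - S))| ≤ (2 * k + 1) * e ∧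
      |β w - (S + k * (N - S))| ≤ (2 * k + 1) * e := by
  induction k with
  | zero => exact ⟨s, hps, hds, by simpa using hαs, by simpa using hβs⟩
  | succ k ih =>
    obtain ⟨w, hpw, hdw, h1, h2⟩ := ih
    obtain ⟨hb1, hb2, hb3, hb4⟩ := hbr w n s hpw hpn hps hdw hdn hds
    refine ⟨_, hb1, hb2, ?_, ?_⟩
    · rw [hb3]
      push_cast
      rw [abs_le] at *
      constructor <;> linarith
    · rw [hb4]
      push_cast
      rw [abs_le] at *
      constructor <;> linarith

lemma sum_error_bound {t ℓ S d E k K₀ : ℝ} {α β : ℝ} (hE : 0 ≤ E) (hk : k ≤ K₀)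
    (hσ : S + k * d ≤ (t + ℓ) / 2 + E) (hα : |α - (S + k * d)| ≤ (2 * k + 1) * (4 * E))
    (hβ : |β - (S + k * d)| ≤ (2 * k + 1) * (4 * E)) {a b : ℝ} (ha : a ≤ t + E)
    (hb : ℓ - 3 * E ≤ b) :
    max (α - b) (a - β) + E + E ≤ t - (S + k * d) + (8 * K₀ + 20) * E := by
  have := mul_le_mul_of_nonneg_right hk hE
  rw [abs_le] at hα hβ
  have : max (α - b) (a - β) ≤ t - (S + k * d) + (8 * K₀ + 18) * E := by
    apply max_le <;> nlinarith
  linarith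

lemma sum_error_bound' {t ℓ S d E k K₀ : ℝ} {α β : ℝ} (hE : 0 ≤ E) (hk : k ≤ K₀ + 1)
    (hσ : (t + ℓ) / 2 ≤ S + k * d) (hα : |α - (S + k * d)| ≤ (2 * k + 1) * (4 * E))
    (hβ : |β - (S + k * d)| ≤ (2 * k + 1) * (4 * E)) {a b : ℝ} (ha : a ≤ t + E)
    (hb : ℓ - 3 * E ≤ b) :
    max (α - b) (a - β) + E + E ≤ S + k * d - ℓ + (8 * K₀ + 20) * E := by
  have := mul_le_mul_of_nonneg_right hk hE
  rw [abs_le] at hα hβ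
  have : max (α - b) (a - β) ≤ S + k * d - ℓ + (8 * K₀ + 18) * E := by
    apply max_le <;> nlinarith
  linarith

/-- The numerical contradiction behind `exists_good_subset`. Here `q₁` and `q₂` are the logarithmic
norms of the normal vectors `w₁ ⨯₃ a` and `w₂ ⨯₃ a` given by two successive translates of `s`, the
first of which has logarithmic size `x`; `T`, `S`, `N`, `t` are the logarithmic sizes of `y`, `s`,
`n`, `a`, and `ℓ` is the quality of `a`. Up to the error `E`, the mean `H` of `q₁` and `q₂`
satisfies `2 H ≤ (N - S) + (t - ℓ) ≤ (b₀ - 1) S + ε T ≤ (b₀ - 1) b₁ H + ε T`, while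
`H ≥ (2 - b₁) T`. -/
lemma heights_contradiction {b₁ b₀ ε T S N q₁ q₂ x ℓ t E K₀ δ : ℝ} (hb₁ : 0 < b₁)
    (hb₀ : 1 ≤ b₀) (hb₀2 : b₀ < 2) (hE : 0 ≤ E)
    (h1 : (2 - b₁) * T ≤ q₁ + E) (h2 : (2 - b₁) * T ≤ q₂ + E) (h3 : S ≤ b₁ * q₁ + E)
    (h4 : S ≤ b₁ * q₂ + E) (h5 : q₁ ≤ t - x + (8 * K₀ + 20) * E)
    (h6 : q₂ ≤ x + (N - S) - ℓ + (8 * K₀ + 20) * E) (h7 : N ≤ b₀ * S + 3 * E)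
    (h8 : t - ℓ ≤ ε * T) (hμ : 0 ≤ 2 + b₁ - b₀ * b₁)
    (hδ : 2 * δ ≤ (2 - b₁) * (2 + b₁ - b₀ * b₁) - ε) (hA : (16 * K₀ + 100) * E ≤ δ * T)
    (hδ0 : 0 < δ) (hT : 0 < T) : False := by
  obtain ⟨H, hH⟩ : ∃ H, H = (q₁ + q₂) / 2 := ⟨_, rfl⟩
  have e1 : S ≤ b₁ * H + E := by rw [hH]; linarith
  have e2 : (2 - b₁) * T ≤ H + E := by rw [hH]; linarith
  have e3 : 2 * H ≤ N - S + (t - ℓ) + (16 * K₀ + 40) * E := by rw [hH]; linarith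
  have e4 := mul_le_mul_of_nonneg_left e1 (show 0 ≤ b₀ - 1 by linarith)
  have e5 := mul_le_mul_of_nonneg_left e2 hμ
  have e6 : (2 + b₁ - b₀ * b₁) * H ≤ ε * T + (16 * K₀ + 44) * E := by nlinarith
  have e7 : (2 + b₁ - b₀ * b₁) * E ≤ 4 * E := mul_le_mul_of_nonneg_right (by nlinarith) hE
  have e9 := mul_le_mul_of_nonneg_right hδ hT.le
  have e10 : 0 < δ * T := mul_pos hδ0 hT
  nlinarith

/-- Locating `a` among the translates `s, n, …` in the plane: either `a` is collinear to one of
them, hence of small determinant and small defect, or the cross products of `a` with two consecutive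
translates are nonzero and of controlled norm. -/
lemma exists_translates_around {ξ : ℝ} (hξ : IrrationalNonQuadratic ξ) {p s n a : Point}
    {α β : Point → ℝ} {C E T K₀ : ℝ} (hE : 0 ≤ E) (hCE : C ≤ E)
    (hα : ∀ x, p ⬝ᵥ x = 0 → pdet x ≠ 0 → α x - β x = Real.log |(pdet x : ℝ)|)
    (hbr : ∀ x y z, p ⬝ᵥ x = 0 → p ⬝ᵥ y = 0 → p ⬝ᵥ z = 0 → pdet x ≠ 0 → pdet y ≠ 0 →
      pdet z ≠ 0 → p ⬝ᵥ bracket x y z = 0 ∧ pdet (bracket x y z) ≠ 0 ∧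
        α (bracket x y z) = α x + α y - β z ∧ β (bracket x y z) = β x + β y - α z)
    (hup : ∀ x, p ⬝ᵥ x = 0 → pdet x ≠ 0 → x 0 ≠ 0 → L ξ x ≤ 1 → Real.log |(x 0 : ℝ)| ≤ T →
      α x ≤ Real.log |(x 0 : ℝ)| + C ∧ qual ξ x - 2 * E - C ≤ β x)
    (hlow : ∀ x, p ⬝ᵥ x = 0 → pdet x ≠ 0 → C ≤ β x → x 0 ≠ 0 ∧
        Real.log |(x 0 : ℝ)| ≤ α x + E + C ∧ min (β x) (2 * T - 3 * E - α x) ≤ qual ξ x + C)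
    (hcr : ∀ x z, p ⬝ᵥ x = 0 → p ⬝ᵥ z = 0 → pdet x ≠ 0 → pdet z ≠ 0 → x ⨯₃ z ≠ 0 →
        Real.log ‖x ⨯₃ z‖ ≤ max (α x - β z) (α z - β x) + E + C)
    (hs : IsMinimalPoint ξ s) (hn : IsMinimalPoint ξ n) (ha : IsMinimalPoint ξ a)
    (hps : p ⬝ᵥ s = 0) (hpn : p ⬝ᵥ n = 0) (hpa : p ⬝ᵥ a = 0)
    (hds : pdet s ≠ 0) (hdn : pdet n ≠ 0) (hda : pdet a ≠ 0)
    (hsT : lsize s ≤ T) (hnT : lsize n ≤ T) (haT : lsize a ≤ T)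
    (hqs : lsize s ≤ qual ξ s + E) (hqn : lsize n ≤ qual ξ n + E) (hqa : 4 * E ≤ qual ξ a)
    (hqa' : qual ξ a ≤ lsize a + E)
    (hsa : lsize s ≤ (lsize a + qual ξ a) / 2 + E) (hd : 0 < lsize n - lsize s)
    (hK : lsize a + E ≤ K₀ * (lsize n - lsize s)) (hK₀ : 0 ≤ K₀) :
    lsize a - qual ξ a ≤ (16 * K₀ + 27) * E ∨ ∃ x w₁ w₂, p ⬝ᵥ w₁ = 0 ∧ p ⬝ᵥ w₂ = 0 ∧
      w₁ ⨯₃ a ≠ 0 ∧ w₂ ⨯₃ a ≠ 0 ∧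
      Real.log ‖w₁ ⨯₃ a‖ ≤ lsize a - x + (8 * K₀ + 20) * E ∧
      Real.log ‖w₂ ⨯₃ a‖ ≤ x + (lsize n - lsize s) - qual ξ a + (8 * K₀ + 20) * E := by
  have hlog : ∀ {x : Point}, IsMinimalPoint ξ x → Real.log |(x 0 : ℝ)| = lsize x := fun {x} hx => by
    rw [abs_of_pos (by linarith [hx.one_le_cast])]; rfl
  have h0 : ∀ {x : Point}, IsMinimalPoint ξ x → x 0 ≠ 0 := fun {x} hx => by
    have := hx.one_le; omega
  have hdet : ∀ {x : Point}, pdet x ≠ 0 → 0 ≤ Real.log |(pdet x : ℝ)| := fun {x} hx =>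
    Real.log_nonneg (by rw [← Int.cast_abs]; exact_mod_cast Int.one_le_abs hx)
  have est : ∀ {x : Point}, IsMinimalPoint ξ x → p ⬝ᵥ x = 0 → pdet x ≠ 0 → lsize x ≤ T →
      α x ≤ lsize x + E ∧ qual ξ x - 3 * E ≤ β x ∧ 0 ≤ α x - β x := fun {x} hx hpx hdx hxT => by
    obtain ⟨h1, h2⟩ := hup x hpx hdx (h0 hx) hx.L_le_one (by rwa [hlog hx])
    rw [hlog hx] at h1
    exact ⟨by linarith, by linarith, by rw [hα x hpx hdx]; exact hdet hdx⟩
  obtain ⟨s1, s2, s3⟩ := est hs hps hds hsT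
  obtain ⟨n1, n2, n3⟩ := est hn hpn hdn hnT
  obtain ⟨a1, a2, a3⟩ := est ha hpa hda haT
  have hw := exists_translates (S := lsize s) (N := lsize n) (e := 4 * E) hbr hps hpn hds hdn
    (abs_le.mpr ⟨by linarith, by linarith⟩) (abs_le.mpr ⟨by linarith, by linarith⟩)
    (abs_le.mpr ⟨by linarith, by linarith⟩) (abs_le.mpr ⟨by linarith, by linarith⟩)
  have hcol : ∀ (k : ℕ), (k : ℝ) ≤ K₀ + 1 → ∀ w, pdet w ≠ 0 → p ⬝ᵥ w = 0 →
      |α w - (lsize s + k * (lsize n - lsize s))| ≤ (2 * k + 1) * (4 * E) →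
      |β w - (lsize s + k * (lsize n - lsize s))| ≤ (2 * k + 1) * (4 * E) → w ⨯₃ a = 0 →
      lsize a - qual ξ a ≤ (16 * K₀ + 27) * E := by
    intro k hk w hdw hpw h1 h2 hwa
    obtain ⟨m, rfl⟩ := (ha.isPrimitivePoint hξ).exists_eq_smul (w := w)
      (cross_comm_eq_zero hwa)
    have hm : m ≠ 0 := by rintro rfl; simp [pdet] at hdw
    have h3 := hα _ hpw hdw
    rw [pdet_smul] at h3
    have hm1 : (1 : ℝ) ≤ |(m : ℝ)| := by rw [← Int.cast_abs]; exact_mod_cast Int.one_le_abs hm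
    have h4 : Real.log |(pdet a : ℝ)| ≤ Real.log |((m ^ 2 * pdet a : ℤ) : ℝ)| := by
      refine Real.log_le_log (abs_pos.mpr (by exact_mod_cast hda)) ?_
      push_cast
      rw [abs_mul, abs_pow]
      exact le_mul_of_one_le_left (abs_nonneg _) (one_le_pow₀ hm1)
    have hkE := mul_le_mul_of_nonneg_right hk hE
    have h5 : α a - β a ≤ (16 * K₀ + 24) * E := by
      rw [hα a hpa hda]
      rw [abs_le] at h1 h2
      linarith
    obtain ⟨-, h6, h7⟩ := hlow a hpa hda (by linarith)
    rw [hlog ha] at h6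
    have h8 : lsize a - (16 * K₀ + 26) * E ≤ min (β a) (2 * T - 3 * E - α a) := by
      have : 0 ≤ K₀ * E := mul_nonneg hK₀ hE
      apply le_min <;> linarith
    linarith
  obtain ⟨z, hz⟩ : ∃ z, z = ((lsize a + qual ξ a) / 2 - lsize s) / (lsize n - lsize s) := ⟨_, rfl⟩
  have hz' : z * (lsize n - lsize s) = (lsize a + qual ξ a) / 2 - lsize s := by
    rw [hz, div_mul_cancel₀ _ hd.ne']
  obtain ⟨k, hk⟩ : ∃ k, k = ⌊z⌋₊ := ⟨_, rfl⟩
  have hk1 : z < k + 1 := hk ▸ Nat.lt_floor_add_one z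
  have hzK : z ≤ K₀ := by
    rw [hz, div_le_iff₀ hd]
    have := hs.lsize_nonneg
    linarith
  have hkK : (k : ℝ) ≤ K₀ := by
    by_cases hz0 : 0 ≤ z
    · exact (hk ▸ Nat.floor_le hz0 : (k : ℝ) ≤ z).trans hzK
    · rw [hk, Nat.floor_of_nonpos (by linarith)]
      simpa using hK₀
  have hσ : lsize s + k * (lsize n - lsize s) ≤ (lsize a + qual ξ a) / 2 + E := by
    by_cases hz0 : 0 ≤ z
    · have : (k : ℝ) ≤ z := hk ▸ Nat.floor_le hz0
      have := mul_le_mul_of_nonneg_right this hd.le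
      linarith
    · have : k = 0 := by rw [hk, Nat.floor_of_nonpos (by linarith)]
      rw [this]
      simpa using hsa
  have hσ' : (lsize a + qual ξ a) / 2 ≤ lsize s + ((k + 1 : ℕ) : ℝ) * (lsize n - lsize s) := by
    have := mul_le_mul_of_nonneg_right hk1.le hd.le
    push_cast
    linarith
  obtain ⟨w₁, p1, d1, x1, y1⟩ := hw k
  obtain ⟨w₂, p2, d2, x2, y2⟩ := hw (k + 1)
  by_cases c1 : w₁ ⨯₃ a = 0
  · exact Or.inl (hcol k (by linarith) w₁ d1 p1 x1 y1 c1)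
  by_cases c2 : w₂ ⨯₃ a = 0
  · exact Or.inl (hcol (k + 1) (by push_cast; linarith) w₂ d2 p2 x2 y2 c2)
  refine Or.inr ⟨lsize s + k * (lsize n - lsize s), w₁, w₂, p1, p2, c1, c2, ?_, ?_⟩
  · refine le_trans ((hcr w₁ a p1 hpa d1 hda c1).trans ?_) (sum_error_bound hE hkK hσ x1 y1 a1 a2)
    linarith
  · refine (le_trans ((hcr w₂ a p2 hpa d2 hda c2).trans ?_)
      (sum_error_bound' (K₀ := K₀) hE (by push_cast; linarith) hσ' x2 y2 a1 a2)).trans ?_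
    · linarith
    · push_cast; linarith

set_option maxHeartbeats 1000000 in
/-- Every large minimal point `a` of relative defect at most `ε` has in fact arbitrarily small
relative defect. Let `u`, `y` be the neighbours of `a` among the points of relative defect at most
`η₀`. The gap between them is so small that `a` lies in their plane. Let `s`, `n` be the first two
such points in that plane. By `exists_translates_around`, either the determinant of `a` is small and
the claim follows, or the plane has two integral normal vectors that are short. But every integral
normal vector is long, because the plane contains the large minimal point `y` (`exists_escape`) and
is entered only at `s` (`exists_entry_of_gap`). -/
theorem exists_good_subset {ξ : ℝ} (hξ : IrrationalNonQuadratic ξ) {b₁ b₀ ε η : ℝ}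
    (hb₁ : b₁ ∈ betaSet ξ 1) (hb₁2 : b₁ < 2) (hb₀2 : b₀ < 2)
    (hb₀ : ∀ η, 0 < η → η < 1 → b₀ ∈ betaSet ξ η) (hε : 0 < ε)
    (hε1 : ε < (2 - b₁) * (2 + b₁ - b₀ * b₁)) (hη : 0 < η) :
    ∃ N, ∀ a ∈ Good ξ ε, N ≤ lsize a → a ∈ Good ξ η := by
  have h1b₁ := one_le_of_mem_betaSet hξ hb₁ hb₁2
  have h1b₀ : 1 ≤ b₀ := one_le_of_mem_betaSet hξ
    (betaSet_mono (by norm_num) (hb₀ (1 / 2) (by norm_num) (by norm_num))) hb₀2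
  obtain ⟨κ, hκ⟩ : ∃ κ, κ = 2 - b₁ := ⟨_, rfl⟩
  have hκ0 : 0 < κ := by linarith
  have hκ1 : κ ≤ 1 := by linarith
  have hμ : 0 ≤ 2 + b₁ - b₀ * b₁ := by nlinarith
  obtain ⟨K₀, hK₀⟩ : ∃ K₀, K₀ = 4 / κ := ⟨_, rfl⟩
  have hK₀0 : 0 ≤ K₀ := hK₀ ▸ by positivity
  obtain ⟨A, hA⟩ : ∃ A, A = 16 * K₀ + 100 := ⟨_, rfl⟩
  have hA0 : 0 < A := by linarith
  obtain ⟨δ, hδ⟩ : ∃ δ, δ = min κ (min (η / 4) (((2 - b₁) * (2 + b₁ - b₀ * b₁) - ε) / 2)) :=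
    ⟨_, rfl⟩
  have hδ0 : 0 < δ := by
    rw [hδ]; exact lt_min hκ0 (lt_min (by linarith) (by linarith))
  have hδκ : δ ≤ κ := hδ ▸ min_le_left _ _
  have hδη : δ ≤ η / 4 := hδ ▸ (min_le_right _ _).trans (min_le_left _ _)
  have hδε : 2 * δ ≤ (2 - b₁) * (2 + b₁ - b₀ * b₁) - ε := by
    have : δ ≤ _ := hδ ▸ (min_le_right _ _).trans (min_le_right _ _)
    linarith
  -- With this `η₀` all the errors, at most `A * E` where `E = η₀ * T + C`, stay below `δ * T`.
  obtain ⟨η₀, hη₀⟩ : ∃ η₀, η₀ = δ / (2 * A) := ⟨_, rfl⟩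
  have hη₀0 : 0 < η₀ := hη₀ ▸ by positivity
  have hη₀A : A * η₀ = δ / 2 := by rw [hη₀]; field_simp
  have hη₀δ : 100 * η₀ ≤ δ := by nlinarith
  have hη₀1 : η₀ < 1 := by linarith
  have hbη := hb₀ η₀ hη₀0 hη₀1
  obtain ⟨Cg, hCg, hgap⟩ := exists_gap hξ hbη
  obtain ⟨C1, hC1, hcross⟩ := exists_log_norm_cross_le hξ
  obtain ⟨C2, hC2, hqual⟩ := exists_qual_le hξ hb₁ hb₁2
  obtain ⟨C3, hC3, hesc⟩ := exists_escape hξ hb₁ hb₁2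
  obtain ⟨D, Q1, hD, hent⟩ := exists_entry_of_gap (C := Cg) hξ hb₁ hb₀2
  obtain ⟨Q2, hcop⟩ := exists_coplanar (C := Cg) hξ hb₀2
  obtain ⟨CL, hCL, hLC⟩ := exists_logCoords hξ
  obtain ⟨M, hM, hdet⟩ := exists_pdet_ne_zero hξ hb₁ hb₁2
  obtain ⟨g₀, hg₀, -⟩ := exists_lsize_ge hξ hbη 0
  obtain ⟨g₁, hg₁, hg₀₁⟩ := exists_lsize_ge hξ hbη (lsize g₀)
  have hgg : g₀ ⨯₃ g₁ ≠ 0 := hg₀.1.cross_ne_zero hξ hg₁.1 (hg₁.1.lt_of_lsize hg₀₁)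
  have hgn := Real.log_nonneg (one_le_norm hgg)
  have hg1 := hg₁.1.lsize_nonneg
  obtain ⟨C, hC⟩ : ∃ C, C = Cg + C1 + C2 + C3 + D + CL := ⟨_, rfl⟩
  obtain ⟨W, hW⟩ : ∃ W, W = M + |Q1| + |Q2| + lsize g₁ + Real.log ‖g₀ ⨯₃ g₁‖ + C + 1 := ⟨_, rfl⟩
  have hQ1 := le_abs_self Q1
  have hQ2 := le_abs_self Q2
  have hQ1' := abs_nonneg Q1
  have hQ2' := abs_nonneg Q2
  have hW0 : 0 < W := by linarith
  refine ⟨2 * A * C / δ + 100 * W / κ, fun a ha hNa => ?_⟩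
  by_cases hgood : a ∈ Good ξ η₀
  · exact Good.mono (by linarith) hgood
  have ham : IsMinimalPoint ξ a := ha.1
  have hNa1 : 2 * A * C ≤ δ * lsize a := by
    have : 2 * A * C / δ ≤ lsize a := le_trans (le_add_of_nonneg_right (by positivity)) hNa
    rwa [div_le_iff₀ hδ0, mul_comm (lsize a)] at this
  have hNa2 : 100 * W ≤ κ * lsize a := by
    have : 100 * W / κ ≤ lsize a :=
      le_trans (le_add_of_nonneg_left (div_nonneg (mul_nonneg (by positivity) (by linarith))
        hδ0.le)) hNa
    rwa [div_le_iff₀ hκ0, mul_comm (lsize a)] at this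
  clear hNa
  have ha0 := ham.lsize_nonneg
  have hκa : κ * lsize a ≤ lsize a := mul_le_of_le_one_left ha0 hκ1
  -- the points `u` and `y` of very small defect surrounding `a`
  obtain ⟨u, hu, hua, humax⟩ := exists_greatest (G := Good ξ η₀) (n := a 0)
    ⟨g₁, hg₁, ham.lt_of_lsize (by linarith)⟩
  obtain ⟨y, huy⟩ := exists_succ hu (by
    obtain ⟨c, hc, h⟩ := exists_lsize_ge hξ hbη (lsize u)
    exact ⟨c, hc, hc.1.lt_of_lsize h⟩)
  have hay : a 0 < y 0 := by
    rcases lt_trichotomy (a 0) (y 0) with h | h | h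
    · exact h
    · exact absurd (ham.eq_of_first_eq hξ huy.2.1.1 h ▸ huy.2.1) hgood
    · have := humax y huy.2.1 h
      have := huy.2.2.1
      omega
  have hum : IsMinimalPoint ξ u := hu.1
  have hym : IsMinimalPoint ξ y := huy.2.1.1
  obtain ⟨T, hT⟩ : ∃ T, T = lsize y := ⟨_, rfl⟩
  have hat := ham.lsize_le hay.le
  have hut := hum.lsize_le hua.le
  rw [← hT] at hat
  have hκT : κ * lsize a ≤ κ * T := mul_le_mul_of_nonneg_left hat hκ0.le
  have hδT : δ * lsize a ≤ δ * T := mul_le_mul_of_nonneg_left hat hδ0.le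
  have hT0 : 0 < T := by linarith
  have hδκT : δ * T ≤ κ * T := mul_le_mul_of_nonneg_right hδκ hT0.le
  have hκTT : κ * T ≤ T := mul_le_of_le_one_left hT0.le hκ1
  obtain ⟨E, hE⟩ : ∃ E, E = η₀ * T + C := ⟨_, rfl⟩
  have hCE : C ≤ E := by have := mul_pos hη₀0 hT0; linarith
  have hAE : A * E ≤ δ * T := by
    have : A * E = A * η₀ * T + A * C := by rw [hE]; ring
    rw [this, hη₀A]
    linarith
  have hE0 : 0 ≤ E := by linarith
  have hAE' : (16 * K₀ + 100) * E ≤ δ * T := hA ▸ hAE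
  have hK₀E : 0 ≤ K₀ * E := mul_nonneg hK₀0 hE0
  have h100 : 100 * E ≤ δ * T := by linarith
  have hqg : ∀ x ∈ Good ξ η₀, lsize x ≤ T → lsize x ≤ qual ξ x + (E - C) := fun x hx hxT => by
    have h1 := hx.2
    have h2 := mul_le_mul_of_nonneg_left hxT hη₀0.le
    linarith
  have hg2 : ∀ {x z : Point}, Consec (Good ξ η₀) x z → lsize z ≤ 2 * lsize x + 3 * C :=
    fun {x z} hxz => by
    have h1 := hgap x z hxz
    have h2 := hqual x hxz.1.1
    have h3 := mul_le_mul_of_nonneg_right hb₀2.le hxz.1.1.qual_nonneg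
    linarith
  have hu2 := hg2 huy
  rw [← hT] at hu2
  have hqu := hqg u hu (by linarith)
  have hyq := hqg y huy.2.1 hT.ge
  have hpa : (u ⨯₃ y) ⬝ᵥ a = 0 := by
    rw [cross_dot_exchange, hcop u a y hum ham hym hua hay (hgap u y huy) (by linarith), neg_zero]
  have hp0 : u ⨯₃ y ≠ 0 := hum.cross_ne_zero hξ hym huy.2.2.1
  have hpu := cross_dot_left u y
  have hpy := cross_dot_right u y
  have hgu : g₁ 0 < u 0 := hum.lt_of_lsize (by linarith)
  -- the points of very small defect enter the plane at `s`, preceded by `r` and followed by `n`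
  obtain ⟨r, s, n, hrs, hsn, hpr, hps, hpn, hsu, hny⟩ := exists_entry_points hξ
    (fun x hx => hx.1) huy hpu hpy (by
      by_contra hcon
      push Not at hcon
      have h0 : (u ⨯₃ y) ⬝ᵥ g₀ = 0 := by
        by_contra h
        have := hcon g₀ hg₀ h
        have := hg₁.1.lt_of_lsize hg₀₁
        omega
      have h1 : (u ⨯₃ y) ⬝ᵥ g₁ = 0 := by
        by_contra h
        have := hcon g₁ hg₁ h
        omega
      have h2 := hesc (g₀ ⨯₃ g₁) hgg y hym (dot_eq_zero_of_normal hp0 h0 h1 hgg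
        (cross_dot_left _ _) (cross_dot_right _ _) hpy)
      rw [← hκ, ← hT] at h2
      linarith)
  have hrm : IsMinimalPoint ξ r := hrs.1.1
  have hsm : IsMinimalPoint ξ s := hsn.1.1
  have hnm : IsMinimalPoint ξ n := hsn.2.1.1
  have hsn0 : s ⨯₃ n ≠ 0 := hsm.cross_ne_zero hξ hnm hsn.2.2.1
  have hsT : lsize s ≤ lsize u := hsm.lsize_le hsu
  have hnT : lsize n ≤ T := hT ▸ hnm.lsize_le hny
  have hqs := hqg s hsn.1 (by linarith)
  have hqn := hqg n hsn.2.1 hnT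
  -- the first step inside the plane is long, so that boundedly many translates of `s` reach `a`
  have hd : κ * T ≤ lsize n - lsize s + 3 * E := by
    have h2 := hesc (s ⨯₃ n) hsn0 y hym (dot_eq_zero_of_normal hp0 hps hpn hsn0
        (cross_dot_left _ _) (cross_dot_right _ _) hpy)
    have h3 := hcross s n hsm hnm hsn.2.2.1
    rw [← hκ, ← hT] at h2
    linarith
  have hsep : κ * T ≤ T - lsize u + 3 * E := by
    have h2 := hesc (u ⨯₃ y) hp0 y hym hpy
    have h3 := hcross u y hum hym huy.2.2.1
    rw [← hκ, ← hT] at h2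
    rw [← hT] at h3
    linarith
  have hs0 := hsm.lsize_nonneg
  have hsn2 := hg2 hsn
  have hrs2 := hg2 hrs
  have hqr : lsize r ≤ qual ξ r + (E - C) := hqg r hrs.1 (by
    have := hrm.lsize_lt hrs.2.2.1
    linarith)
  obtain ⟨α, β, l1, l2, l3, l4, l5⟩ := hLC (u ⨯₃ y) u y E hp0 hpu hpy hum hym
    (hdet u hum (by linarith)) hE0 (by linarith) (by linarith) (by linarith)
  have hqa := hum.qual_le hξ ham hua.le
  have hga := hgap u y huy
  have hgs := hgap s n hsn
  have h2q := mul_le_mul_of_nonneg_right hb₀2.le hum.qual_nonneg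
  have hqa' := hqual a ham
  rw [← hT] at l3 l4 hga
  rcases exists_translates_around (K₀ := K₀) hξ hE0 (by linarith) l1 l2 l3 l4 l5 hsm hnm ham
    hps hpn hpa (hdet s hsm (by linarith)) (hdet n hnm (by linarith)) (hdet a ham (by linarith))
    (by linarith) hnT hat (by linarith) (by linarith) (by linarith) (by linarith) (by linarith)
    (by linarith) (by
      have h : κ * T / 2 ≤ lsize n - lsize s := by linarith
      have h2 := mul_le_mul_of_nonneg_left h hK₀0
      have h3 : K₀ * (κ * T / 2) = 2 * T := by rw [hK₀]; field_simp; ring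
      linarith) hK₀0 with h | ⟨x, w₁, w₂, p1, p2, c1, c2, q1, q2⟩
  · refine ⟨ham, ?_⟩
    have h1 : (16 * K₀ + 27) * E ≤ δ * T := by linarith
    have h2 : T ≤ 4 * lsize a := by linarith
    have h3 := mul_le_mul_of_nonneg_left h2 hδ0.le
    have h4 := mul_le_mul_of_nonneg_right hδη ha0
    linarith
  · exfalso
    have hq : ∀ w, (u ⨯₃ y) ⬝ᵥ w = 0 → w ⨯₃ a ≠ 0 →
        (2 - b₁) * T ≤ Real.log ‖w ⨯₃ a‖ + E ∧ lsize s ≤ b₁ * Real.log ‖w ⨯₃ a‖ + E := by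
      intro w hpw hwa
      have hz : ∀ z, (u ⨯₃ y) ⬝ᵥ z = 0 → (w ⨯₃ a) ⬝ᵥ z = 0 := fun z hz =>
        dot_eq_zero_of_normal hp0 hpw hpa hwa (cross_dot_left _ _) (cross_dot_right _ _) hz
      have h1 := hesc _ hwa y hym (hz y hpy)
      have h2 := hent r s _ hrm hsm hrs.2.2.1 (hgap r s hrs) (by linarith) hwa (hz s hps)
        fun hqr => hpr (dot_eq_zero_of_normal hwa (hz s hps) (hz n hpn) hsn0 hps hpn hqr)
      rw [← hT] at h1
      constructor <;> linarith
    obtain ⟨e1, e2⟩ := hq w₁ p1 c1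
    obtain ⟨e3, e4⟩ := hq w₂ p2 c2
    have hqs' := hqual s hsm
    have h8 : lsize a - qual ξ a ≤ ε * T := by
      have h1 := ha.2
      have h2 := mul_le_mul_of_nonneg_left hat hε.le
      linarith
    have h7 : lsize n ≤ b₀ * lsize s + 3 * E := by
      have h1 := mul_le_mul_of_nonneg_left hqs' (show 0 ≤ b₀ by linarith)
      have h2 := mul_le_mul_of_nonneg_right hb₀2.le hC2
      linarith
    exact heights_contradiction (by linarith) h1b₀ hb₀2 hE0 e1 e3 e2 e4 q1 q2 h7 h8 hμ hδε hAE'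
      hδ0 hT0

/-! ### Sets of minimal points of small defect -/

/-- A primitive point of small defect is a minimal point. -/
lemma exists_isMinimalPoint_of_defect {ξ b : ℝ} (hξ : IrrationalNonQuadratic ξ)
    (hb : b ∈ betaSet ξ 1) (hb2 : b < 2) : ∃ N, ∀ x, IsPrimitivePoint x → 0 < x 0 → N ≤ lsize x →
      (1 - (2 - b) / 4) * lsize x ≤ qual ξ x → IsMinimalPoint ξ x := by
  obtain ⟨C2, hC2, hqual⟩ := exists_qual_le hξ hb hb2
  obtain ⟨C3, hC3, hesc⟩ := exists_escape hξ hb hb2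
  have hb1 := one_le_of_mem_betaSet hξ hb hb2
  have hbn := one_le_bnd ξ
  have hl := Real.log_nonneg (show (1 : ℝ) ≤ 2 * bnd ξ + 2 by linarith)
  obtain ⟨D, hD⟩ : ∃ D, D = C2 + C3 + Real.log (2 * bnd ξ + 2) + 1 := ⟨_, rfl⟩
  refine ⟨4 * D / (2 - b), fun x hx hx0 hN hdef => ?_⟩
  rw [div_le_iff₀ (by linarith)] at hN
  have hx1 : 1 ≤ x 0 := hx0
  have hx1' : (1 : ℝ) ≤ x 0 := by exact_mod_cast hx1
  have hs0 : 0 ≤ lsize x := Real.log_nonneg hx1'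
  obtain ⟨a, ha, hax, hmin⟩ := exists_minimalPoint ξ hx1
  have hLx := hmin x hx1 le_rfl
  have hLx0 := L_pos hξ hx.ne_zero
  have hq : qual ξ x ≤ qual ξ a := neg_le_neg (Real.log_le_log (L_pos hξ ha.ne_zero) hLx)
  by_cases hcol : x ⨯₃ a = 0
  · rw [hx.eq_of_cross (ha.isPrimitivePoint hξ) hx0 ha.one_le hcol]
    exact ha
  exfalso
  have h1 : ‖x ⨯₃ a‖ ≤ (2 * bnd ξ + 2) * (x 0 * L ξ x) := by
    have h := norm_cross_le ξ x a
    have ha1 := ha.one_le_cast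
    rw [abs_of_pos (by linarith), abs_of_pos (by linarith)] at h
    have haL := ha.L_le_one
    have hax' : (a 0 : ℝ) ≤ x 0 := by exact_mod_cast hax
    have e1 : (x 0 : ℝ) * L ξ a ≤ x 0 * L ξ x := mul_le_mul_of_nonneg_left hLx (by linarith)
    have e2 : (a 0 : ℝ) * L ξ x ≤ x 0 * L ξ x := mul_le_mul_of_nonneg_right hax' hLx0.le
    have e3 : L ξ x * L ξ a ≤ x 0 * L ξ x := by
      rw [mul_comm]
      exact mul_le_mul_of_nonneg_right (by linarith) hLx0.le
    have e4 := mul_le_mul_of_nonneg_left (add_le_add e1 e2) (show 0 ≤ bnd ξ by linarith)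
    linarith
  have h2 := Real.log_le_log (by linarith [one_le_norm hcol]) h1
  rw [Real.log_mul (by linarith) (mul_pos (by linarith) hLx0).ne',
    Real.log_mul (by linarith) hLx0.ne'] at h2
  have h3 := hesc _ hcol a ha (cross_dot_right x a)
  have h4 : Real.log (L ξ x) = -qual ξ x := by rw [qual, neg_neg]
  have h5 : Real.log (x 0) = lsize x := rfl
  rw [h4, h5] at h2
  have h6 := hqual a ha
  have h7 : (2 - b) * (qual ξ x - C2) ≤ (2 - b) * lsize a :=
    mul_le_mul_of_nonneg_left (by linarith) (by linarith)
  nlinarith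

/-- The data shared by the two parts of the theorem: a set `G` of minimal points which contains all
large minimal points of very small defect, whose large elements have very small defect, and whose
gaps are controlled by an exponent less than `2`. -/
structure GoodSet (ξ b₁ : ℝ) (G : Set Point) : Prop where
  irr : IrrationalNonQuadratic ξ
  mem : b₁ ∈ betaSet ξ 1
  lt_two : b₁ < 2
  sub : G ⊆ MP ξ
  tight : ∀ η, 0 < η → ∃ N, ∀ a ∈ G, N ≤ lsize a → a ∈ Good ξ η
  full : ∃ η, 0 < η ∧ ∃ N, ∀ a ∈ Good ξ η, N ≤ lsize a → a ∈ G
  gap : ∃ b C, b < 2 ∧ 0 ≤ C ∧ ∀ x y, Consec G x y → lsize y ≤ b * qual ξ x + C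
  unbounded : ∀ M, ∃ a ∈ G, M < lsize a

namespace GoodSet

variable {ξ b₁ : ℝ} {G : Set Point}

lemma exists_defect_le (hG : GoodSet ξ b₁ G) {η : ℝ} (hη : 0 < η) :
    ∃ C, 0 ≤ C ∧ ∀ a ∈ G, lsize a ≤ qual ξ a + η * lsize a + C := by
  obtain ⟨N, hN⟩ := hG.tight η hη
  refine ⟨|N|, abs_nonneg _, fun a ha => ?_⟩
  have h0 := (hG.sub ha).lsize_nonneg
  have h1 := (hG.sub ha).qual_nonneg
  have h2 := mul_nonneg hη.le h0
  by_cases h : N ≤ lsize a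
  · have := (hN a ha h).2
    linarith [abs_nonneg N]
  · linarith [le_abs_self N]

/-- If `u` is a smaller element of a good set than `y`, then `log y₀` exceeds `log u₀` by a positive
proportion of `log y₀`, because the plane that they span has large height. -/
lemma exists_size_gap (hG : GoodSet ξ b₁ G) {η : ℝ} (hη : 0 < η) :
    ∃ C, 0 ≤ C ∧ ∀ u ∈ G, ∀ y ∈ G, u 0 < y 0 →
      (2 - b₁) * lsize y ≤ lsize y - lsize u + η * lsize u + C := by
  obtain ⟨C0, hC0, hdef⟩ := hG.exists_defect_le hη
  obtain ⟨C1, hC1, hcross⟩ := exists_log_norm_cross_le hG.irr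
  obtain ⟨C3, hC3, hesc⟩ := exists_escape hG.irr hG.mem hG.lt_two
  refine ⟨C0 + C1 + C3, by positivity, fun u hu y hy huy => ?_⟩
  have hum := hG.sub hu
  have hym := hG.sub hy
  have h1 := hcross u y hum hym huy
  have h2 := hesc _ (hum.cross_ne_zero hG.irr hym huy) y hym (cross_dot_right u y)
  have h3 := hdef u hu
  linarith

lemma succ (hG : GoodSet ξ b₁ G) {u : Point} (hu : u ∈ G) : ∃ y, Consec G u y := by
  obtain ⟨c, hc, h⟩ := hG.unbounded (lsize u)
  exact exists_succ hu ⟨c, hc, (hG.sub hc).lt_of_lsize h⟩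

lemma exists_gap (hG : GoodSet ξ b₁ G) : ∃ b C, 0 ≤ b ∧ b < 2 ∧ 0 ≤ C ∧
    ∀ x y, Consec G x y → lsize y ≤ b * qual ξ x + C ∧ lsize y ≤ b * lsize x + C := by
  obtain ⟨b, C, hb, hC, h⟩ := hG.gap
  obtain ⟨C2, hC2, hqual⟩ := exists_qual_le hG.irr hG.mem hG.lt_two
  refine ⟨max b 0, C + max b 0 * C2, le_max_right _ _, by simp [hb],
    add_nonneg hC (mul_nonneg (le_max_right _ _) hC2), fun x y hxy => ?_⟩
  have h1 := h x y hxy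
  have hx := hG.sub hxy.1
  have h2 := mul_le_mul_of_nonneg_right (le_max_left b 0) hx.qual_nonneg
  have h3 := mul_le_mul_of_nonneg_left (hqual x hx) (le_max_right b 0)
  have h4 := mul_nonneg (le_max_right b 0) hC2
  constructor <;> linarith

end GoodSet

/-- The estimates for a bracket `w` in a plane with logarithmic coordinates `α`, `β`. -/
lemma bracket_estimates {p u x : Point} {α β : Point → ℝ} {ξ C E T U X : ℝ} (hCE : C ≤ E)
    (hα : ∀ x, p ⬝ᵥ x = 0 → pdet x ≠ 0 → α x - β x = Real.log |(pdet x : ℝ)|)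
    (hbr : ∀ x y z, p ⬝ᵥ x = 0 → p ⬝ᵥ y = 0 → p ⬝ᵥ z = 0 → pdet x ≠ 0 → pdet y ≠ 0 →
      pdet z ≠ 0 → p ⬝ᵥ bracket x y z = 0 ∧ pdet (bracket x y z) ≠ 0 ∧
        α (bracket x y z) = α x + α y - β z ∧ β (bracket x y z) = β x + β y - α z)
    (hup : ∀ x, p ⬝ᵥ x = 0 → pdet x ≠ 0 → x 0 ≠ 0 → L ξ x ≤ 1 → Real.log |(x 0 : ℝ)| ≤ T →
      α x ≤ Real.log |(x 0 : ℝ)| + C ∧ qual ξ x - 2 * E - C ≤ β x)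
    (hlow : ∀ x, p ⬝ᵥ x = 0 → pdet x ≠ 0 → C ≤ β x → x 0 ≠ 0 ∧
        Real.log |(x 0 : ℝ)| ≤ α x + E + C ∧ min (β x) (2 * T - 3 * E - α x) ≤ qual ξ x + C)
    (hu : IsMinimalPoint ξ u) (hx : IsMinimalPoint ξ x) (hpu : p ⬝ᵥ u = 0) (hpx : p ⬝ᵥ x = 0)
    (hdu : pdet u ≠ 0) (hdx : pdet x ≠ 0) (hU : U = lsize u) (hX : X = lsize x) (hUT : U ≤ T)
    (hXT : X ≤ T) (hqu : U ≤ qual ξ u + E) (hqx : X ≤ qual ξ x + E) (hE : 10 * E ≤ 2 * U - X)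
    (hT : 2 * U - X ≤ T) :
    pdet (bracket u u x) ≠ 0 ∧ bracket u u x 0 ≠ 0 ∧
      Real.log |(bracket u u x 0 : ℝ)| ≤ 2 * U - X + 8 * E ∧
      2 * U - X - 10 * E ≤ qual ξ (bracket u u x) := by
  have est : ∀ {x : Point}, IsMinimalPoint ξ x → p ⬝ᵥ x = 0 → pdet x ≠ 0 → lsize x ≤ T →
      α x ≤ lsize x + E ∧ qual ξ x - 3 * E ≤ β x ∧ 0 ≤ α x - β x := fun {x} hx hpx hdx hxT => by
    have hlog : Real.log |(x 0 : ℝ)| = lsize x := by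
      rw [abs_of_pos (by linarith [hx.one_le_cast])]; rfl
    obtain ⟨h1, h2⟩ := hup x hpx hdx (by have := hx.one_le; omega) hx.L_le_one (by rwa [hlog])
    rw [hlog] at h1
    refine ⟨by linarith, by linarith, ?_⟩
    rw [hα x hpx hdx]
    exact Real.log_nonneg (by rw [← Int.cast_abs]; exact_mod_cast Int.one_le_abs hdx)
  obtain ⟨u1, u2, u3⟩ := est hu hpu hdu (hU ▸ hUT)
  obtain ⟨x1, x2, x3⟩ := est hx hpx hdx (hX ▸ hXT)
  rw [← hU] at u1
  rw [← hX] at x1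
  obtain ⟨b1, b2, b3, b4⟩ := hbr u u x hpu hpu hpx hdu hdu hdx
  obtain ⟨h1, h2, h3⟩ := hlow _ b1 b2 (by rw [b4]; linarith)
  rw [b3] at h2 h3
  rw [b4] at h3
  refine ⟨b2, h1, by linarith, ?_⟩
  have : 2 * U - X - 9 * E ≤ min (β u + β u - α x) (2 * T - 3 * E - (α u + α u - β x)) := by
    apply le_min <;> linarith
  linarith

namespace GoodSet

variable {ξ b₁ : ℝ} {G : Set Point}

set_option maxHeartbeats 600000 in
/-- Brackets of elements of a good set are collinear to elements of it. -/
theorem exists_mem_bracket (hG : GoodSet ξ b₁ G) {c η : ℝ} (hc : 0 < c) (hη : 0 < η) :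
    ∃ N, ∀ u ∈ G, ∀ y ∈ G, ∀ x ∈ G, u 0 < y 0 → x 0 ≤ y 0 → (u ⨯₃ y) ⬝ᵥ x = 0 → pdet u ≠ 0 →
      pdet x ≠ 0 → N ≤ lsize y → c * lsize y ≤ 2 * lsize u - lsize x →
      2 * lsize u - lsize x ≤ lsize y →
      ∃ w ∈ G, w ⨯₃ bracket u u x = 0 ∧
        |lsize w - (2 * lsize u - lsize x)| ≤ η * lsize y := by
  have hξ := hG.irr
  have hb2 := hG.lt_two
  obtain ⟨ηf, hηf, Nf, hfull⟩ := hG.full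
  obtain ⟨Nm, hmin⟩ := exists_isMinimalPoint_of_defect hξ hG.mem hb2
  obtain ⟨κ, hκ⟩ : ∃ κ, κ = 2 - b₁ := ⟨_, rfl⟩
  have hκ0 : 0 < κ := by linarith
  obtain ⟨δ, hδ⟩ : ∃ δ, δ = min κ (min c (min η (min (c * ηf) (c * κ / 4)))) := ⟨_, rfl⟩
  have hδ0 : 0 < δ := by
    rw [hδ]
    refine lt_min ?_ (lt_min ?_ (lt_min ?_ (lt_min ?_ ?_))) <;> positivity
  have d1 : δ ≤ κ := hδ ▸ min_le_left _ _
  have d2 : δ ≤ c := hδ ▸ (min_le_right _ _).trans (min_le_left _ _)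
  have d3 : δ ≤ η := hδ ▸ (min_le_right _ _).trans ((min_le_right _ _).trans (min_le_left _ _))
  have d4 : δ ≤ c * ηf := hδ ▸ (min_le_right _ _).trans
    ((min_le_right _ _).trans ((min_le_right _ _).trans (min_le_left _ _)))
  have d5 : δ ≤ c * κ / 4 := hδ ▸ (min_le_right _ _).trans
    ((min_le_right _ _).trans ((min_le_right _ _).trans (min_le_right _ _)))
  obtain ⟨η₀, hη₀⟩ : ∃ η₀, η₀ = δ / 200 := ⟨_, rfl⟩
  have hη₀0 : 0 < η₀ := by rw [hη₀]; positivity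
  obtain ⟨C0, hC0, hdef⟩ := hG.exists_defect_le hη₀0
  obtain ⟨C1, hC1, hgap⟩ := hG.exists_size_gap hη₀0
  obtain ⟨CL, hCL, hLC⟩ := exists_logCoords hξ
  obtain ⟨c4, hc4⟩ : ∃ c, c = Real.log (2 * bnd ξ + 1) := ⟨_, rfl⟩
  have hc4' : 0 ≤ c4 := hc4 ▸ Real.log_nonneg (by linarith [one_le_bnd ξ])
  obtain ⟨C, hC⟩ : ∃ C, C = C0 + C1 + CL + c4 := ⟨_, rfl⟩
  have hN1 := le_abs_self Nf
  have hN2 := le_abs_self Nm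
  refine ⟨200 * C / δ + 2 * (|Nf| + |Nm| + 1) / c, ?_⟩
  intro u hu y hy x hx huy hxy hpx hdu hdx hN hcT hT
  obtain ⟨T, hTy⟩ : ∃ T, T = lsize y := ⟨_, rfl⟩
  rw [← hTy] at hN hcT hT ⊢
  have hNa1 : 200 * C ≤ δ * T := by
    have : 200 * C / δ ≤ T := le_trans (le_add_of_nonneg_right (by positivity)) hN
    rwa [div_le_iff₀ hδ0, mul_comm T] at this
  have hNa2 : 2 * (|Nf| + |Nm| + 1) ≤ c * T := by
    have : 2 * (|Nf| + |Nm| + 1) / c ≤ T := le_trans (le_add_of_nonneg_left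
      (div_nonneg (by linarith) hδ0.le)) hN
    rwa [div_le_iff₀ hc, mul_comm T] at this
  clear hN
  have hf0 := abs_nonneg Nf
  have hm0 := abs_nonneg Nm
  have hT0 : 0 < T := pos_of_mul_pos_right (show 0 < c * T by linarith) hc.le
  obtain ⟨E, hE⟩ : ∃ E, E = η₀ * T + C := ⟨_, rfl⟩
  have hηT := mul_pos hη₀0 hT0
  have hE100 : 100 * E ≤ δ * T := by
    have : 200 * (η₀ * T) = δ * T := by rw [hη₀]; ring
    linarith
  have hE0 : 0 ≤ E := by linarith
  have dT1 := mul_le_mul_of_nonneg_right d1 hT0.le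
  have dT2 := mul_le_mul_of_nonneg_right d2 hT0.le
  have dT3 := mul_le_mul_of_nonneg_right d3 hT0.le
  have dT4 := mul_le_mul_of_nonneg_right d4 hT0.le
  have dT5 := mul_le_mul_of_nonneg_right d5 hT0.le
  have hum := hG.sub hu
  have hym := hG.sub hy
  have hxm := hG.sub hx
  have hUT := hum.lsize_le huy.le
  have hXT := hxm.lsize_le hxy
  rw [← hTy] at hUT hXT
  have hq : ∀ z ∈ G, lsize z ≤ T → lsize z ≤ qual ξ z + (E - C + C0) := fun z hz hzT => by
    have h1 := hdef z hz
    have h2 := mul_le_mul_of_nonneg_left hzT hη₀0.le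
    linarith
  have hqu := hq u hu hUT
  have hqx := hq x hx hXT
  have hqy := hq y hy hTy.ge
  have hsep := hgap u hu y hy huy
  have hηU := mul_le_mul_of_nonneg_left hUT hη₀0.le
  rw [← hTy, ← hκ] at hsep
  have hp0 : u ⨯₃ y ≠ 0 := hum.cross_ne_zero hξ hym huy
  obtain ⟨α, β, l1, l2, l3, l4, -⟩ := hLC (u ⨯₃ y) u y E hp0 (cross_dot_left u y)
    (cross_dot_right u y) hum hym hdu hE0 (by linarith) (by linarith) (by linarith)
  rw [← hTy] at l3 l4
  obtain ⟨e1, e2, e3, e4⟩ := bracket_estimates (by linarith) l1 l2 l3 l4 hum hxm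
    (cross_dot_left u y) hpx hdu hdx rfl rfl hUT hXT (by linarith) (by linarith) (by linarith) hT
  obtain ⟨m, w, hw, hw0, hm, hwm⟩ := exists_primitive e2
  have hm1 : (1 : ℝ) ≤ |(m : ℝ)| := by rw [← Int.cast_abs]; exact_mod_cast Int.one_le_abs hm
  have hw1 : (1 : ℝ) ≤ w 0 := by exact_mod_cast hw0
  have hLw := L_pos hξ hw.ne_zero
  have s1 : lsize w ≤ Real.log |(bracket u u x 0 : ℝ)| := by
    refine Real.log_le_log (by linarith) ?_
    rw [hwm]
    simp only [Pi.smul_apply, smul_eq_mul, Int.cast_mul]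
    rw [abs_mul, abs_of_pos (show (0 : ℝ) < w 0 by linarith)]
    exact le_mul_of_one_le_left (by linarith) hm1
  have s2 : qual ξ (bracket u u x) ≤ qual ξ w := by
    refine neg_le_neg (Real.log_le_log hLw ?_)
    rw [hwm, L_smul]
    exact le_mul_of_one_le_left hLw.le hm1
  have s3 : pdet w ≠ 0 := by
    rw [hwm, pdet_smul] at e1
    exact right_ne_zero_of_mul e1
  have s4 : L ξ w ≤ 1 := by
    rw [← exp_neg_qual hξ hw.ne_zero]
    exact Real.exp_le_one_iff.mpr (by linarith)
  have s5 := qual_le_of_pdet s3 hw0.ne' s4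
  rw [abs_of_pos (show (0 : ℝ) < w 0 by linarith), ← hc4] at s5
  have s6 : Real.log (w 0) = lsize w := rfl
  rw [s6] at s5
  have hwT : c * T ≤ 2 * lsize w := by linarith
  have hwm' : IsMinimalPoint ξ w := by
    refine hmin w hw hw0 (by linarith) ?_
    have := mul_le_mul_of_nonneg_left hwT hκ0.le
    rw [← hκ]
    linarith
  have hwG : w ∈ G := by
    refine hfull w ⟨hwm', ?_⟩ (by linarith)
    have := mul_le_mul_of_nonneg_left hwT hηf.le
    linarith
  refine ⟨w, hwG, ?_, ?_⟩
  · rw [hwm, cross_eq_zero_iff]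
    intro i j
    simp only [Pi.smul_apply, smul_eq_mul]
    ring
  · rw [abs_le]
    constructor <;> linarith

end GoodSet

/-! ### Consecutive points and brackets -/

lemma dot_bracket_self (u y : Point) : (u ⨯₃ y) ⬝ᵥ bracket u u y = 0 := by
  simp only [bracket, bracketMatrix, symMatrix, J, Matrix.neg_apply, Matrix.mul_apply,
    Fin.sum_univ_two, cross_apply, vec3_dotProduct, Matrix.of_apply, cons_val]
  ring

/-- The map `[u, u, ·]` is an involution up to the factor `pdet u ^ 2`. -/
lemma bracket_bracket (u y : Point) : bracket u u (bracket u u y) = pdet u ^ 2 • y := by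
  apply point_ext <;>
  · simp only [bracket, bracketMatrix, symMatrix, J, Matrix.neg_apply, Matrix.mul_apply,
      Fin.sum_univ_two, Matrix.of_apply, cons_val, pdet, Pi.smul_apply, smul_eq_mul]
    ring

lemma bracket_smul (u y : Point) (m : ℤ) : bracket u u (m • y) = m • bracket u u y := by
  apply point_ext <;>
  · simp only [bracket, bracketMatrix, symMatrix, J, Matrix.neg_apply, Matrix.mul_apply,
      Fin.sum_univ_two, Matrix.of_apply, cons_val, Pi.smul_apply, smul_eq_mul]
    ring

lemma bracket_ne_zero {u y : Point} (hu : pdet u ≠ 0) (hy : y ≠ 0) : bracket u u y ≠ 0 := by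
  intro h
  have h1 := bracket_bracket u y
  have h2 : bracket u u (0 : Point) = 0 := by
    have := bracket_smul u 0 0
    simpa using this
  rw [h, h2] at h1
  obtain ⟨i, hi⟩ := exists_ne_zero hy
  have := congrFun h1 i
  simp only [Pi.zero_apply, Pi.smul_apply, smul_eq_mul] at this
  exact mul_ne_zero (pow_ne_zero 2 hu) hi this.symm

lemma bracket_cross_eq_zero (u : Point) {y z : Point} (hy : y ≠ 0) (h : y ⨯₃ z = 0) :
    bracket u u y ⨯₃ bracket u u z = 0 := by
  obtain ⟨k, hk⟩ := exists_ne_zero hy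
  have h1 : y k • z = z k • y := by
    rw [cross_eq_zero_iff] at h
    ext i
    simp only [Pi.smul_apply, smul_eq_mul]
    linarith [h k i]
  have h2 : y k • bracket u u z = z k • bracket u u y := by
    rw [← bracket_smul, h1, bracket_smul]
  rw [cross_eq_zero_iff]
  intro i j
  have e1 := congrFun h2 i
  have e2 := congrFun h2 j
  simp only [Pi.smul_apply, smul_eq_mul] at e1 e2
  refine mul_left_cancel₀ hk ?_
  linear_combination (bracket u u y) i * e2 - (bracket u u y) j * e1

namespace GoodSet

variable {ξ b₁ : ℝ} {G : Set Point}

/-- If `u`, `y` are consecutive in `G`, then `[u, u, y]` is collinear to a smaller element of `G`,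
whose size is known. -/
lemma reflect_down (hG : GoodSet ξ b₁ G) {η : ℝ} (hη : 0 < η) :
    ∃ N, ∀ u y, Consec G u y → N ≤ lsize y → ∃ w ∈ G, w 0 < u 0 ∧ w ⨯₃ bracket u u y = 0 ∧
      |lsize w - (2 * lsize u - lsize y)| ≤ η * lsize y := by
  have hb2 := hG.lt_two
  obtain ⟨κ, hκ⟩ : ∃ κ, κ = 2 - b₁ := ⟨_, rfl⟩
  have hκ0 : 0 < κ := by linarith
  obtain ⟨b, C, hb0, hb, hC, hgap⟩ := hG.exists_gap
  obtain ⟨M, hM, hdet⟩ := exists_pdet_ne_zero hG.irr hG.mem hb2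
  obtain ⟨C1, hC1, hsz⟩ := hG.exists_size_gap (show 0 < κ / 4 by linarith)
  have hη' : 0 < min η (κ / 4) := lt_min hη (by linarith)
  obtain ⟨N, hN⟩ := hG.exists_mem_bracket (show 0 < (2 - b) / 4 by linarith) hη'
  refine ⟨max N (max (C + 2 * M + 1 + C + 8 * C / (2 - b)) (4 * C1 / κ + 1)), fun u y huy hNy => ?_⟩
  obtain ⟨n1, n2, n3⟩ : N ≤ lsize y ∧ C + 2 * M + 1 + C + 8 * C / (2 - b) ≤ lsize y ∧
      4 * C1 / κ + 1 ≤ lsize y := by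
    simpa only [max_le_iff] using hNy
  have n4 : 4 * C1 + κ ≤ κ * lsize y := by
    have := mul_le_mul_of_nonneg_left n3 hκ0.le
    have e : κ * (4 * C1 / κ + 1) = 4 * C1 + κ := by field_simp
    linarith
  have hum := hG.sub huy.1
  have hym := hG.sub huy.2.1
  have hUY := hum.lsize_le huy.2.2.1.le
  have hU0 := hum.lsize_nonneg
  have hg := (hgap u y huy).2
  have hbU : b * lsize u ≤ 2 * lsize u := mul_le_mul_of_nonneg_right hb.le hU0
  have h8 : 0 ≤ 8 * C / (2 - b) := div_nonneg (by linarith) (by linarith)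
  have hU4 : 4 * C ≤ (2 - b) * lsize u := by
    have h : 4 * C / (2 - b) ≤ lsize u := by
      have e : 8 * C / (2 - b) = 2 * (4 * C / (2 - b)) := by ring
      linarith
    rwa [div_le_iff₀ (by linarith), mul_comm (lsize u)] at h
  have hs := hsz u huy.1 y huy.2.1 huy.2.2.1
  rw [← hκ] at hs
  have hκU := mul_le_mul_of_nonneg_left hUY hκ0.le
  obtain ⟨w, hw, hwc, hwl⟩ := hN u huy.1 y huy.2.1 y huy.2.1 huy.2.2.1 le_rfl
    (cross_dot_right u y) (hdet u hum (by linarith)) (hdet y hym (by linarith)) n1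
    (by nlinarith) (by linarith)
  have hY0 := hym.lsize_nonneg
  refine ⟨w, hw, hum.lt_of_lsize ?_, hwc, hwl.trans
    (mul_le_mul_of_nonneg_right (min_le_left _ _) hY0)⟩
  have h1 := hwl.trans (mul_le_mul_of_nonneg_right (min_le_right _ _) hY0)
  have h2 := (abs_le.mp h1).2
  linarith

/-- If `v`, `u`, `y` are consecutive in `G` and linearly dependent, then `[u, u, y]` is collinear
to `v`: otherwise `[u, u, v]` would yield an element of `G` between `u` and `y`. -/
lemma cross_bracket_eq_zero (hG : GoodSet ξ b₁ G) : ∃ N, ∀ v u y, Consec G v u → Consec G u y →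
    N ≤ lsize y → (v ⨯₃ u) ⬝ᵥ y = 0 → v ⨯₃ bracket u u y = 0 := by
  have hb2 := hG.lt_two
  obtain ⟨κ, hκ⟩ : ∃ κ, κ = 2 - b₁ := ⟨_, rfl⟩
  have hκ0 : 0 < κ := by linarith
  have hκ1 : κ ≤ 1 := by linarith [one_le_of_mem_betaSet hG.irr hG.mem hb2]
  obtain ⟨b, C, hb0, hb, hC, hgap⟩ := hG.exists_gap
  obtain ⟨M, hM, hdet⟩ := exists_pdet_ne_zero hG.irr hG.mem hb2
  obtain ⟨C1, hC1, hsz⟩ := hG.exists_size_gap (show 0 < κ / 4 by linarith)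
  obtain ⟨N1, hN1⟩ := hG.reflect_down (show 0 < κ / 128 by linarith)
  obtain ⟨N2, hN2⟩ := hG.exists_mem_bracket (c := 1 / 8) (by norm_num)
    (show 0 < κ / 128 by linarith)
  refine ⟨max N1 (max N2 (6 * C + 8 * M + 8 + 64 * C1 / κ)), fun v u y hvu huy hN hcop => ?_⟩
  obtain ⟨n1, n2, n3⟩ : N1 ≤ lsize y ∧ N2 ≤ lsize y ∧
      6 * C + 8 * M + 8 + 64 * C1 / κ ≤ lsize y := by
    simpa only [max_le_iff] using hN
  have h64 : 0 ≤ 64 * C1 / κ := by positivity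
  have n4 : 64 * C1 + κ ≤ κ * lsize y := by
    have h1 : 64 * C1 / κ + 1 ≤ lsize y := by linarith
    have := mul_le_mul_of_nonneg_left h1 hκ0.le
    have e : κ * (64 * C1 / κ + 1) = 64 * C1 + κ := by field_simp
    linarith
  have hvm := hG.sub hvu.1
  have hum := hG.sub huy.1
  have hym := hG.sub huy.2.1
  obtain ⟨w, hw, hwu, hwc, hwl⟩ := hN1 u y huy n1
  have hwm := hG.sub hw
  rcases (hvu.2.2.2 w hw).resolve_right (by omega) |>.lt_or_eq with hwv | hwv
  swap
  · rwa [← hwm.eq_of_first_eq hG.irr hvm hwv]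
  exfalso
  have hWV := hwm.lsize_le hwv.le
  have hVU := hvm.lsize_le hvu.2.2.1.le
  have hUY := hum.lsize_le huy.2.2.1.le
  have hV0 := hvm.lsize_nonneg
  have g1 := (hgap u y huy).2
  have g2 := (hgap v u hvu).2
  have g3 : b * lsize u ≤ 2 * lsize u := mul_le_mul_of_nonneg_right hb.le hum.lsize_nonneg
  have g4 : b * lsize v ≤ 2 * lsize v := mul_le_mul_of_nonneg_right hb.le hV0
  have hV8 : lsize y / 8 ≤ lsize v := by linarith
  have s1 := hsz w hw v hvu.1 hwv
  have s2 := hsz v hvu.1 u huy.1 hvu.2.2.1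
  rw [← hκ] at s1 s2
  have k1 := mul_le_mul_of_nonneg_left hWV hκ0.le
  have k2 := mul_le_mul_of_nonneg_left hV8 hκ0.le
  have k3 := mul_le_mul_of_nonneg_left hVU hκ0.le
  have w1 := abs_le.mp hwl
  obtain ⟨x, hx, -, hxl⟩ := hN2 u huy.1 y huy.2.1 v hvu.1 huy.2.2.1
    (hvu.2.2.1.trans huy.2.2.1).le (by rw [← cross_dot_rotate]; exact hcop)
    (hdet u hum (by linarith)) (hdet v hvm (by linarith)) n2 (by linarith) (by linarith)
  have x1 := abs_le.mp hxl
  have hxm := hG.sub hx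
  have := hxm.lt_of_lsize (a := u) (by linarith)
  have := hym.lt_of_lsize (a := x) (by linarith)
  rcases huy.2.2.2 x hx with h | h <;> omega

end GoodSet

/-! ### Increasing sequences of minimal points -/

lemma tendsto_lsize {v : ℕ → Point} {i₀ : ℕ} (h : ∀ i, i₀ ≤ i → v i 0 < v (i + 1) 0) :
    Tendsto (fun i => lsize (v i)) atTop atTop := by
  have h1 : ∀ i, i₀ ≤ i → v i₀ 0 + (i - i₀) ≤ v i 0 := by
    intro i hi
    induction i, hi using Nat.le_induction with
    | base => simp
    | succ i hi ih =>
      have := h i hi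
      push_cast
      linarith
  have h2 : Tendsto (fun i => v i 0) atTop atTop := by
    refine tendsto_atTop_mono' (f₁ := fun i : ℕ => (i : ℤ) + (v i₀ 0 - i₀)) atTop ?_
      (tendsto_atTop_add_const_right _ _ tendsto_natCast_atTop_atTop)
    filter_upwards [eventually_ge_atTop i₀] with i hi
    linarith [h1 i hi]
  exact Real.tendsto_log_atTop.comp (tendsto_intCast_atTop_atTop.comp h2)

lemma tendsto_qual {ξ b : ℝ} (hξ : IrrationalNonQuadratic ξ) (hb : b ∈ betaSet ξ 1)
    {v : ℕ → Point} {i₀ : ℕ} (hm : ∀ i, i₀ ≤ i → IsMinimalPoint ξ (v i))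
    (h : ∀ i, i₀ ≤ i → v i 0 < v (i + 1) 0) :
    Tendsto (fun i => qual ξ (v i)) atTop atTop := by
  rw [tendsto_atTop]
  intro Q
  obtain ⟨c, hc, hcQ⟩ := exists_qual_ge hξ hb Q
  filter_upwards [eventually_ge_atTop i₀,
    (tendsto_lsize h).eventually_gt_atTop (lsize c)] with i hi hl
  exact hcQ.trans (hc.1.qual_le hξ (hm i hi) ((hm i hi).lt_of_lsize hl).le)

/-- A sequence of minimal points does not stay in a plane. -/
lemma exists_not_coplanar {ξ b : ℝ} (hξ : IrrationalNonQuadratic ξ) (hb : b ∈ betaSet ξ 1)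
    (hb2 : b < 2) {v : ℕ → Point} {i₀ : ℕ} (hm : ∀ i, i₀ ≤ i → IsMinimalPoint ξ (v i))
    (h : ∀ i, i₀ ≤ i → v i 0 < v (i + 1) 0) :
    ∃ j, i₀ ≤ j ∧ (v j ⨯₃ v (j + 1)) ⬝ᵥ v (j + 2) ≠ 0 := by
  by_contra hcon
  push Not at hcon
  have hne : ∀ i, i₀ ≤ i → v i ⨯₃ v (i + 1) ≠ 0 := fun i hi =>
    (hm i hi).cross_ne_zero hξ (hm (i + 1) (by omega)) (h i hi)
  have key : ∀ i, i₀ ≤ i → (v i₀ ⨯₃ v (i₀ + 1)) ⬝ᵥ v i = 0 ∧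
      (v i₀ ⨯₃ v (i₀ + 1)) ⬝ᵥ v (i + 1) = 0 := by
    intro i hi
    induction i, hi using Nat.le_induction with
    | base => exact ⟨cross_dot_left _ _, cross_dot_right _ _⟩
    | succ i hi ih =>
      exact ⟨ih.2, dot_eq_zero_of_normal (hne i hi) (cross_dot_left _ _) (cross_dot_right _ _)
        (hne i hi) ih.1 ih.2 (hcon i hi)⟩
  obtain ⟨C, hC, hesc⟩ := exists_escape hξ hb hb2
  obtain ⟨i, hi1, hi2⟩ := ((eventually_ge_atTop i₀).and ((tendsto_lsize h).eventually_gt_atTop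
    ((Real.log ‖v i₀ ⨯₃ v (i₀ + 1)‖ + C) / (2 - b)))).exists
  have h1 := hesc _ (hne i₀ le_rfl) (v i) (hm i hi1) (key i hi1).1
  rw [div_lt_iff₀ (by linarith)] at hi2
  linarith

namespace GoodSet

variable {ξ b₁ : ℝ} {G : Set Point}

/-- If a sequence in `G` with controlled gaps skips an element of `G` between `v` and `v'`, then
the element `v₀` of the sequence before `v` lies in the plane of `v` and `v'`. -/
lemma coplanar_of_skip (hG : GoodSet ξ b₁ G) {b C : ℝ} (hb0 : 0 ≤ b) (hb : b < 2) :
    ∃ N, ∀ v₀ ∈ G, ∀ v ∈ G, ∀ v' ∈ G, ∀ c ∈ G, v₀ 0 < v 0 → v 0 < c 0 → c 0 < v' 0 →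
      lsize v ≤ b * qual ξ v₀ + C → lsize v' ≤ b * qual ξ v + C → N ≤ qual ξ v₀ →
      (v ⨯₃ c) ⬝ᵥ v' = 0 ∧ (v₀ ⨯₃ v) ⬝ᵥ v' = 0 := by
  have hξ := hG.irr
  have hb1 := one_le_of_mem_betaSet hξ hG.mem hG.lt_two
  have hb2 := hG.lt_two
  obtain ⟨ρ, hρ⟩ : ∃ ρ, ρ = 2 - b₁ * (b - 1) := ⟨_, rfl⟩
  have hρ0 : 0 < ρ := by nlinarith
  obtain ⟨b', C', hb'0, hb', hC', hgap⟩ := hG.exists_gap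
  obtain ⟨D, Q, hD, hent⟩ := exists_entry_of_gap (C := C') hξ hG.mem hb'
  obtain ⟨Q1, hcop⟩ := exists_coplanar (C := C) hξ hb
  obtain ⟨C1, hC1, hcross⟩ := exists_log_norm_cross_le hξ
  obtain ⟨C2, hC2, hqual⟩ := exists_qual_le hξ hG.mem hb2
  obtain ⟨η, hη⟩ : ∃ η, η = ρ / 16 := ⟨_, rfl⟩
  have hη0 : 0 < η := by rw [hη]; linarith
  obtain ⟨C0, hC0, hdef⟩ := hG.exists_defect_le hη0
  obtain ⟨C3, hC3⟩ : ∃ C3, C3 = 2 * C2 + |C| := ⟨_, rfl⟩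
  have hCabs := le_abs_self C
  have hCabs' := abs_nonneg C
  obtain ⟨C4, hC4⟩ : ∃ C4, C4 = b₁ * (C3 + η * C3 + 2 * C0 + 2 * C1) + 2 * D := ⟨_, rfl⟩
  refine ⟨|Q| + |Q1| + C2 + 1 + 2 * C4 / ρ, ?_⟩
  intro v₀ hv₀ v hv v' hv' c hc h0 h1 h2 g0 g1 hN
  have hQ := le_abs_self Q
  have hQ1 := le_abs_self Q1
  have hQ' := abs_nonneg Q
  have hQ1' := abs_nonneg Q1
  have hC30 : 0 ≤ C3 := by rw [hC3]; positivity
  have hC40 : 0 ≤ C4 := by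
    rw [hC4]
    exact add_nonneg (mul_nonneg (by linarith) (by positivity)) (by positivity)
  have hC4ρ : 0 ≤ 2 * C4 / ρ := by positivity
  have hm₀ := hG.sub hv₀
  have hm := hG.sub hv
  have hm' := hG.sub hv'
  have hmc := hG.sub hc
  have hq0 := hm₀.qual_le hξ hm h0.le
  have hcp := hcop v c v' hm hmc hm' h1 h2 g1 (by linarith)
  refine ⟨hcp, ?_⟩
  have n1 : v ⨯₃ c ≠ 0 := hm.cross_ne_zero hξ hmc h1
  have n2 : c ⨯₃ v' ≠ 0 := hmc.cross_ne_zero hξ hm' h2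
  obtain ⟨r, hr⟩ := exists_pred hv ⟨v₀, hv₀, h0⟩
  have hmr := hG.sub hr.1
  have hv₀r : v₀ 0 ≤ r 0 := (hr.2.2.2 v₀ hv₀).resolve_right (by omega)
  have hqr := hm₀.qual_le hξ hmr hv₀r
  have hpr : (v ⨯₃ c) ⬝ᵥ r = 0 := by
    by_contra hne
    have hne2 : (c ⨯₃ v') ⬝ᵥ r ≠ 0 := fun h => hne (dot_eq_zero_of_normal n2
      (by rw [← cross_dot_rotate]; exact hcp) (cross_dot_left _ _) n1 (cross_dot_left _ _)
      (cross_dot_right _ _) h)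
    have e1 := hent r v _ hmr hm hr.2.2.1 (hgap r v hr).1 (by linarith) n1 (cross_dot_left _ _) hne
    have e2 := hent r v _ hmr hm hr.2.2.1 (hgap r v hr).1 (by linarith) n2
      (by rw [← cross_dot_rotate]; exact hcp) hne2
    have x1 := hcross v c hm hmc h1
    have x2 := hcross c v' hmc hm' h2
    have y1 := hdef v hv
    have y2 := hdef c hc
    have z1 := hqual v hm
    have z2 := hmc.lsize_le h2.le
    have hV0 := hm.lsize_nonneg
    have hqv := hm.qual_nonneg
    have z3 : lsize v' - lsize v ≤ (b - 1) * lsize v + C3 := by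
      have t1 := mul_le_mul_of_nonneg_left z1 hb0
      have t2 := mul_le_mul_of_nonneg_right hb.le hC2
      linarith
    have z4 : (b - 1) * lsize v ≤ lsize v := by nlinarith
    have z5 := mul_le_mul_of_nonneg_left (show lsize c ≤ 2 * lsize v + C3 by linarith) hη0.le
    have z6 : Real.log ‖v ⨯₃ c‖ + Real.log ‖c ⨯₃ v'‖ ≤
        (b - 1) * lsize v + 3 * (η * lsize v) + (C3 + η * C3 + 2 * C0 + 2 * C1) := by linarith
    have z7 := mul_le_mul_of_nonneg_left z6 (show 0 ≤ b₁ by linarith)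
    have z8 : b₁ * (3 * (η * lsize v)) ≤ 6 * (η * lsize v) := by
      have := mul_nonneg hη0.le hV0
      nlinarith
    have z9 : ρ * lsize v ≤ 6 * (η * lsize v) + C4 := by
      rw [hρ, hC4]
      linarith
    have z10 : 2 * C4 < ρ * lsize v := by
      have : 2 * C4 / ρ < lsize v := by linarith
      rwa [div_lt_iff₀ hρ0, mul_comm (lsize v)] at this
    have z11 : 6 * (η * lsize v) = 6 / 16 * (ρ * lsize v) := by rw [hη]; ring
    linarith
  have hpv₀ : (v ⨯₃ c) ⬝ᵥ v₀ = 0 := by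
    rcases hv₀r.lt_or_eq with h | h
    · have hc0 := hcop v₀ r v hm₀ hmr hm h hr.2.2.1 g0 (by linarith)
      have nr : r ⨯₃ v ≠ 0 := hmr.cross_ne_zero hξ hm hr.2.2.1
      exact dot_eq_zero_of_normal nr (cross_dot_left _ _) (cross_dot_right _ _) nr hpr
        (cross_dot_left _ _) (by rw [← cross_dot_rotate]; exact hc0)
    · rw [hm₀.eq_of_first_eq hξ hmr h]
      exact hpr
  exact dot_eq_zero_of_normal n1 hpv₀ (cross_dot_left _ _) (hm₀.cross_ne_zero hξ hm h0)
    (cross_dot_left _ _) (cross_dot_right _ _) hcp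

/-- A sequence in `G` as in the converse part of the theorem eventually runs through all of `G`:
skipping an element of `G` would propagate backwards and confine the sequence to a plane. -/
theorem eventually_consec (hG : GoodSet ξ b₁ G) {v : ℕ → Point} {i₀ : ℕ}
    (hmem : ∀ i, i₀ ≤ i → v i ∈ G) (hmono : ∀ i, i₀ ≤ i → v i 0 < v (i + 1) 0) {b C : ℝ}
    (hb0 : 0 ≤ b) (hb : b < 2) (hgap : ∀ i, i₀ ≤ i → lsize (v (i + 1)) ≤ b * qual ξ (v i) + C)
    (hbr : ∀ i, i₀ ≤ i → (v i ⨯₃ v (i + 1)) ⬝ᵥ v (i + 2) = 0 →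
      bracket (v (i + 1)) (v (i + 1)) (v i) ⨯₃ v (i + 2) = 0) :
    ∃ i₁, i₀ ≤ i₁ ∧ ∀ i, i₁ ≤ i → Consec G (v i) (v (i + 1)) := by
  have hξ := hG.irr
  have hm : ∀ i, i₀ ≤ i → IsMinimalPoint ξ (v i) := fun i hi => hG.sub (hmem i hi)
  obtain ⟨N1, hN1⟩ := hG.coplanar_of_skip (C := C) hb0 hb
  obtain ⟨N2, hN2⟩ := hG.cross_bracket_eq_zero
  obtain ⟨M, hM, hdet⟩ := exists_pdet_ne_zero hξ hG.mem hG.lt_two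
  obtain ⟨i₂, hi₂⟩ := eventually_atTop.mp ((eventually_ge_atTop i₀).and
    (((tendsto_qual hξ hG.mem hm hmono).eventually_ge_atTop N1).and
    ((tendsto_lsize hmono).eventually_gt_atTop (max N2 M))))
  have h₀ : ∀ i, i₂ ≤ i → i₀ ≤ i := fun i hi => (hi₂ i hi).1
  have hstep : ∀ j, i₂ ≤ j → (∃ c ∈ G, v (j + 1) 0 < c 0 ∧ c 0 < v (j + 2) 0) →
      (v j ⨯₃ v (j + 1)) ⬝ᵥ v (j + 2) = 0 ∧ ∃ c ∈ G, v j 0 < c 0 ∧ c 0 < v (j + 1) 0 := by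
    rintro j hj ⟨c, hc, hc1, hc2⟩
    have hj0 := h₀ j hj
    obtain ⟨-, hjq, hjl⟩ := hi₂ j hj
    have hjM : M < lsize (v (j + 1)) :=
      lt_of_le_of_lt (le_max_right _ _) (hi₂ (j + 1) (by omega)).2.2
    have hjN : N2 < lsize (v (j + 1)) :=
      lt_of_le_of_lt (le_max_left _ _) (hi₂ (j + 1) (by omega)).2.2
    have key := fun c hc hc1 hc2 => hN1 (v j) (hmem j hj0) (v (j + 1)) (hmem _ (by omega))
      (v (j + 2)) (hmem _ (by omega)) c hc (hmono j hj0) hc1 hc2 (hgap j hj0)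
      (hgap (j + 1) (by omega)) hjq
    have hcop := (key c hc hc1 hc2).2
    refine ⟨hcop, ?_⟩
    by_contra hno
    push Not at hno
    have hcons : Consec G (v j) (v (j + 1)) := ⟨hmem j hj0, hmem _ (by omega), hmono j hj0,
      fun c hc => by
        by_cases h : v j 0 < c 0
        · exact Or.inr (hno c hc h)
        · exact Or.inl (not_lt.mp h)⟩
    obtain ⟨y, hy⟩ := hG.succ (hmem (j + 1) (by omega))
    have hyc : y 0 ≤ c 0 := (hy.2.2.2 c hc).resolve_left (by omega)
    have hy2 : y 0 < v (j + 2) 0 := by omega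
    have hym := hG.sub hy.2.1
    have hm1 := hm (j + 1) (by omega)
    have hm2 := hm (j + 2) (by omega)
    have hcopy := (key y hy.2.1 hy.2.2.1 hy2).1
    have n12 : v (j + 1) ⨯₃ v (j + 2) ≠ 0 := hm1.cross_ne_zero hξ hm2 (hmono (j + 1) (by omega))
    have n01 : v j ⨯₃ v (j + 1) ≠ 0 := (hm j hj0).cross_ne_zero hξ hm1 (hmono j hj0)
    have h1 : (v j ⨯₃ v (j + 1)) ⬝ᵥ y = 0 := dot_eq_zero_of_normal n12
      (by rw [← cross_dot_rotate]; exact hcop) (cross_dot_left _ _) n01 (cross_dot_left _ _)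
      (cross_dot_right _ _) (by rw [cross_dot_exchange, hcopy, neg_zero])
    have h2 := hN2 (v j) (v (j + 1)) y hcons hy
      (hjN.le.trans (hm1.lsize_le hy.2.2.1.le)) h1
    have hd : pdet (v (j + 1)) ≠ 0 := hdet _ hm1 hjM
    have h3 := bracket_cross_eq_zero (v (j + 1)) (hm j hj0).ne_zero h2
    rw [bracket_bracket] at h3
    have h4 := hbr j hj0 hcop
    have hb0 : bracket (v (j + 1)) (v (j + 1)) (v j) ≠ 0 := bracket_ne_zero hd (hm j hj0).ne_zero
    have h5 := cross_trans hb0 (cross_comm_eq_zero h3) h4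
    have h6 : y ⨯₃ v (j + 2) = 0 := by
      rw [cross_eq_zero_iff] at h5 ⊢
      intro i k
      have h7 := h5 i k
      simp only [Pi.smul_apply, smul_eq_mul] at h7
      refine mul_left_cancel₀ (pow_ne_zero 2 hd) ?_
      linarith
    have h8 := hym.eq_of_cross hξ hm2 h6
    rw [h8] at hy2
    exact lt_irrefl _ hy2
  by_contra hcon
  have hskip : ∀ i₁, i₂ ≤ i₁ → ∃ i, i₁ ≤ i ∧ ∃ c ∈ G, v i 0 < c 0 ∧ c 0 < v (i + 1) 0 := by
    intro i₁ hi₁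
    by_contra hno
    push Not at hno
    refine hcon ⟨i₁, h₀ i₁ hi₁, fun i hi => ⟨hmem i (h₀ i (by omega)), hmem _ (h₀ _ (by omega)),
      hmono i (h₀ i (by omega)), fun c hc => ?_⟩⟩
    by_cases h : v i 0 < c 0
    · exact Or.inr (hno i hi c hc h)
    · exact Or.inl (not_lt.mp h)
  have hdown : ∀ k j, i₂ ≤ j → (∃ c ∈ G, v (j + k) 0 < c 0 ∧ c 0 < v (j + k + 1) 0) →
      ∃ c ∈ G, v j 0 < c 0 ∧ c 0 < v (j + 1) 0 := by
    intro k
    induction k with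
    | zero => intro j _ h; exact h
    | succ k ih => intro j hj h; exact ih j hj (hstep (j + k) (by omega) h).2
  obtain ⟨j, hj, hne⟩ := exists_not_coplanar hξ hG.mem hG.lt_two (v := v) (i₀ := i₂)
    (fun i hi => hm i (h₀ i hi)) (fun i hi => hmono i (h₀ i hi))
  obtain ⟨i, hi, hc⟩ := hskip (j + 1) (by omega)
  obtain ⟨k, rfl⟩ := Nat.exists_eq_add_of_le hi
  exact hne (hstep j hj (hdown k (j + 1) (by omega) hc)).1

end GoodSet

/-! ### The function `ψ` attached to a good set -/

/-- The sequence `(u i)_{i ≥ 1}` enumerates `G` by increasing first coordinates. -/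
def Enumerates (u : ℕ → Point) (G : Set Point) : Prop :=
  StrictMonoOn (fun i => u i 0) (Ici 1) ∧ u '' Ici 1 = G

namespace Enumerates

variable {ξ : ℝ} {u : ℕ → Point} {G : Set Point}

lemma mem (hu : Enumerates u G) {i : ℕ} (hi : 1 ≤ i) : u i ∈ G := hu.2 ▸ ⟨i, hi, rfl⟩

lemma lt (hu : Enumerates u G) {i j : ℕ} (hi : 1 ≤ i) (hij : i < j) : u i 0 < u j 0 :=
  hu.1 hi (show 1 ≤ j by omega) hij

lemma lt_iff (hu : Enumerates u G) {i j : ℕ} (hi : 1 ≤ i) (hj : 1 ≤ j) :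
    u i 0 < u j 0 ↔ i < j := hu.1.lt_iff_lt hi hj

lemma exists_index (hu : Enumerates u G) {w : Point} (hw : w ∈ G) : ∃ j, 1 ≤ j ∧ u j = w := by
  rw [← hu.2] at hw
  exact hw

lemma injOn (hu : Enumerates u G) {i j : ℕ} (hi : 1 ≤ i) (hj : 1 ≤ j) (h : u i = u j) : i = j :=
  hu.1.injOn hi hj (congrFun h 0)

lemma consec (hu : Enumerates u G) {i : ℕ} (hi : 1 ≤ i) : Consec G (u i) (u (i + 1)) := by
  refine ⟨hu.mem hi, hu.mem (by omega), hu.lt hi (by omega), fun c hc => ?_⟩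
  obtain ⟨j, hj, rfl⟩ := hu.exists_index hc
  rw [← not_lt, ← not_lt, hu.lt_iff hi hj, hu.lt_iff hj (by omega)]
  omega

end Enumerates

namespace GoodSet

variable {ξ b₁ : ℝ} {G : Set Point} {u : ℕ → Point}

/-- The sizes of the elements of a good set grow geometrically. -/
lemma exists_growth (hG : GoodSet ξ b₁ G) (hu : Enumerates u G) :
    ∃ ρ, 1 < ρ ∧ ∃ k₀, 1 ≤ k₀ ∧ ∀ k, k₀ ≤ k → ρ * lsize (u k) ≤ lsize (u (k + 1)) := by
  have hb2 := hG.lt_two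
  obtain ⟨κ, hκ⟩ : ∃ κ, κ = 2 - b₁ := ⟨_, rfl⟩
  have hκ0 : 0 < κ := by linarith
  obtain ⟨C, hC, hsz⟩ := hG.exists_size_gap (show 0 < κ / 4 by linarith)
  obtain ⟨k₀, hk₀⟩ := eventually_atTop.mp ((tendsto_lsize (i₀ := 1) fun i hi =>
    hu.lt hi (Nat.lt_succ_self i)).eventually_ge_atTop (4 * C / κ))
  refine ⟨1 + κ / 4, by linarith, max k₀ 1, le_max_right _ _, fun k hk => ?_⟩
  obtain ⟨h1, h2⟩ := max_le_iff.mp hk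
  have h3 := hk₀ k h1
  rw [div_le_iff₀ hκ0] at h3
  have h4 := hsz _ (hu.mem h2) _ (hu.mem (by omega : 1 ≤ k + 1)) (hu.lt h2 (by omega))
  rw [← hκ] at h4
  have h5 := (hG.sub (hu.mem h2)).lsize_lt (hu.lt h2 (show k < k + 1 by omega))
  have h6 := mul_le_mul_of_nonneg_left h5.le hκ0.le
  have h7 := (hG.sub (hu.mem h2)).lsize_nonneg
  linarith

/-- The bracket `[u_i, u_i, u_{i+1}]` is collinear to some `u_{ψ(i)}` with `ψ(i) < i`. The
difference `i - ψ(i)` is bounded because the sizes grow geometrically, while the size of `u_{ψ(i)}`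
is at least a fixed proportion of that of `u_i`. -/
lemma exists_psi (hG : GoodSet ξ b₁ G) (hu : Enumerates u G) :
    ∃ (ψ : ℕ → ℕ) (i₀ c : ℕ), (∀ n, 1 ≤ n → ψ n + 1 ≤ n) ∧ (∀ n, 1 ≤ n → n ≤ ψ n + c) ∧
      ∀ i, i₀ ≤ i → 1 ≤ ψ i ∧ u (ψ i) ⨯₃ bracket (u i) (u i) (u (i + 1)) = 0 := by
  obtain ⟨b, C, hb0, hb, hC, hgap⟩ := hG.exists_gap
  obtain ⟨ρ, hρ, k₀, hk₀, hgrow⟩ := hG.exists_growth hu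
  obtain ⟨N, hN⟩ := hG.reflect_down (η := (2 - b) / 8) (by linarith)
  have hlim := tendsto_lsize (i₀ := 1) fun i hi => hu.lt hi (Nat.lt_succ_self i)
  obtain ⟨m, hm⟩ := pow_unbounded_of_one_lt (4 / (2 - b)) hρ
  obtain ⟨i₀, hi₀⟩ := eventually_atTop.mp ((eventually_ge_atTop 1).and
    (hlim.eventually_ge_atTop (max N (8 * C / (2 - b) + 4 * lsize (u k₀) / (2 - b) + 1))))
  have key : ∀ i, i₀ ≤ i → ∃ j, 1 ≤ j ∧ j + 1 ≤ i ∧ i ≤ j + m ∧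
      u j ⨯₃ bracket (u i) (u i) (u (i + 1)) = 0 := by
    intro i hi
    obtain ⟨hi1, hil⟩ := hi₀ i hi
    obtain ⟨hl1, hl2⟩ := max_le_iff.mp hil
    have hcons := hu.consec hi1
    have hlt := (hG.sub (hu.mem hi1)).lsize_lt hcons.2.2.1
    obtain ⟨w, hw, hwu, hwc, hwl⟩ := hN _ _ hcons (hl1.trans hlt.le)
    obtain ⟨j, hj, rfl⟩ := hu.exists_index hw
    rw [hu.lt_iff hj hi1] at hwu
    refine ⟨j, hj, hwu, ?_, hwc⟩
    have hU0 := (hG.sub (hu.mem hi1)).lsize_nonneg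
    have hk0 := (hG.sub (hu.mem hk₀)).lsize_nonneg
    have c1 : 8 * C ≤ (2 - b) * lsize (u i) := by
      have h : 0 ≤ 4 * lsize (u k₀) / (2 - b) := div_nonneg (by linarith) (by linarith)
      have : 8 * C / (2 - b) ≤ lsize (u i) := by linarith
      rwa [div_le_iff₀ (by linarith), mul_comm (lsize _)] at this
    have c2 : 4 * lsize (u k₀) < (2 - b) * lsize (u i) := by
      have h : 0 ≤ 8 * C / (2 - b) := div_nonneg (by linarith) (by linarith)
      have : 4 * lsize (u k₀) / (2 - b) < lsize (u i) := by linarith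
      rwa [div_lt_iff₀ (by linarith), mul_comm (lsize _)] at this
    have g := (hgap _ _ hcons).2
    have h1 := (abs_le.mp hwl).1
    have h2 : (2 - b) / 8 * lsize (u (i + 1)) ≤ (2 - b) / 8 * (2 * lsize (u i) + C) := by
      refine mul_le_mul_of_nonneg_left (g.trans ?_) (by linarith)
      have := mul_le_mul_of_nonneg_right hb.le hU0
      linarith
    have h3 : (2 - b) / 8 * C ≤ C := mul_le_of_le_one_left hC (by linarith)
    have h4 : (2 - b) / 4 * lsize (u i) ≤ lsize (u j) := by linarith
    have hkj : k₀ ≤ j := by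
      by_contra hlt'
      have := (hG.sub (hu.mem hj)).lsize_lt (hu.lt hj (not_le.mp hlt'))
      linarith
    have hpow : ∀ n, ρ ^ n * lsize (u j) ≤ lsize (u (j + n)) := by
      intro n
      induction n with
      | zero => simp
      | succ n ih =>
        have := hgrow (j + n) (by omega)
        have h5 := mul_le_mul_of_nonneg_left ih (show 0 ≤ ρ by linarith)
        rw [pow_succ]
        rw [← add_assoc]
        linarith
    by_contra hcon
    have h6 := hpow (i - j)
    rw [show j + (i - j) = i by omega] at h6
    have h7 : 4 / (2 - b) < ρ ^ (i - j) := hm.trans_le (pow_le_pow_right₀ hρ.le (by omega))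
    rw [div_lt_iff₀ (by linarith)] at h7
    have h8 := mul_le_mul_of_nonneg_left h4 (show 0 ≤ ρ ^ (i - j) by positivity)
    have h9 : 0 < lsize (u i) := by
      have h : 0 ≤ 4 * lsize (u k₀) / (2 - b) := div_nonneg (by linarith) (by linarith)
      have h' : 0 ≤ 8 * C / (2 - b) := div_nonneg (by linarith) (by linarith)
      linarith
    have h10 := mul_lt_mul_of_pos_right h7 h9
    linarith
  classical
  choose! f hf using key
  refine ⟨fun i => if i₀ ≤ i then f i else i - 1, i₀, m + i₀ + 1, fun n hn => ?_, fun n hn => ?_,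
    fun i hi => ?_⟩
  · by_cases h : i₀ ≤ n
    · simpa only [h, if_true] using (hf n h).2.1
    · simp only [h, if_false]; omega
  · by_cases h : i₀ ≤ n
    · simp only [h, if_true]
      have := (hf n h).2.2.1
      omega
    · simp only [h, if_false]; omega
  · simp only [hi, if_true]
    exact ⟨(hf i hi).1, (hf i hi).2.2.2⟩

/-- The function `ψ` is eventually reduced: the jumps of `ψ` are the indices where the sequence
leaves a plane, and two distinct planes have at most a line in common. -/
lemma psi_mem_F (hG : GoodSet ξ b₁ G) (hu : Enumerates u G) {ψ : ℕ → ℕ} {i₀ c : ℕ}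
    (h1 : ∀ n, 1 ≤ n → ψ n + 1 ≤ n) (h2 : ∀ n, 1 ≤ n → n ≤ ψ n + c)
    (h3 : ∀ i, i₀ ≤ i → 1 ≤ ψ i ∧ u (ψ i) ⨯₃ bracket (u i) (u i) (u (i + 1)) = 0) : ψ ∈ F := by
  have hξ := hG.irr
  have hmin : ∀ {i}, 1 ≤ i → IsMinimalPoint ξ (u i) := fun hi => hG.sub (hu.mem hi)
  obtain ⟨M, hM, hdet⟩ := exists_pdet_ne_zero hξ hG.mem hG.lt_two
  obtain ⟨N, hN⟩ := hG.cross_bracket_eq_zero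
  have hlim := tendsto_lsize (i₀ := 1) fun i hi => hu.lt hi (Nat.lt_succ_self i)
  obtain ⟨i₁, hi₁⟩ := eventually_atTop.mp ((eventually_ge_atTop (max i₀ 2)).and
    (hlim.eventually_gt_atTop (max M N)))
  have hne : ∀ {i j}, 1 ≤ i → i < j → u i ⨯₃ u j ≠ 0 := fun hi hij =>
    (hmin hi).cross_ne_zero hξ (hmin (by omega)) (hu.lt hi hij)
  have hbr : ∀ i, i₁ ≤ i → bracket (u i) (u i) (u (i + 1)) ≠ 0 := by
    intro i hi
    obtain ⟨hi0, hil⟩ := hi₁ i hi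
    obtain ⟨-, hi2⟩ := max_le_iff.mp hi0
    exact bracket_ne_zero (hdet _ (hmin (by omega)) ((le_max_left _ _).trans_lt hil))
      (hmin (by omega)).ne_zero
  have F1 : ∀ i, i₁ ≤ i → (u i ⨯₃ u (i + 1)) ⬝ᵥ u (ψ i) = 0 := fun i hi =>
    dot_eq_zero_of_cross (hbr i hi)
      (cross_comm_eq_zero (h3 i ((le_max_left _ _).trans (hi₁ i hi).1)).2) (dot_bracket_self _ _)
  have F2 : ∀ i, i₁ ≤ i → (u i ⨯₃ u (i + 1)) ⬝ᵥ u (i - 1) = 0 → ψ i = i - 1 := by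
    intro i hi hcop
    obtain ⟨hi0, hil⟩ := hi₁ i hi
    obtain ⟨hi0', hi2⟩ := max_le_iff.mp hi0
    have hc1 := hu.consec (show 1 ≤ i - 1 by omega)
    rw [show i - 1 + 1 = i by omega] at hc1
    have hc2 := hu.consec (show 1 ≤ i by omega)
    have h4 := hN _ _ _ hc1 hc2 (((le_max_right _ _).trans_lt hil).le.trans
      ((hmin (by omega)).lsize_le hc2.2.2.1.le)) (by rw [cross_dot_rotate]; exact hcop)
    obtain ⟨h5, h6⟩ := h3 i hi0'
    have h7 := cross_trans (hbr i hi) h6 (cross_comm_eq_zero h4)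
    exact hu.injOn h5 (by omega) ((hmin h5).eq_of_cross hξ (hmin (by omega)) h7)
  have hnj : ∀ i, 1 ≤ i → ¬ IsJump ψ i → ψ i = i - 1 := by
    intro i hi hj
    have := h1 i hi
    unfold IsJump at hj
    omega
  have hinf : {i | IsJump ψ i}.Infinite := by
    intro hfin
    obtain ⟨B, hB⟩ := hfin.bddAbove
    obtain ⟨j, hj, hjne⟩ := exists_not_coplanar hξ hG.mem hG.lt_two (v := u)
      (i₀ := max i₁ (max B 1)) (fun i hi => hmin (by omega))
      (fun i hi => hu.lt (by omega) (Nat.lt_succ_self i))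
    have h4 : ¬ IsJump ψ (j + 1) := fun h => by
      have : j + 1 ≤ B := hB h
      omega
    have h5 := F1 (j + 1) (by omega)
    rw [hnj (j + 1) (by omega) h4, Nat.add_sub_cancel, ← cross_dot_rotate] at h5
    exact hjne h5
  refine ⟨⟨h1, Or.inr ?_⟩, ⟨c, fun i hi => ?_⟩, hinf⟩
  swap
  · have := h1 i hi
    have := h2 i hi
    omega
  have hθ : StrictMono (theta ψ) := Nat.nth_strictMono hinf
  filter_upwards [eventually_ge_atTop i₁] with k hk
  obtain ⟨i, hi⟩ : ∃ i, i = theta ψ k := ⟨_, rfl⟩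
  obtain ⟨j, hj⟩ : ∃ j, j = theta ψ (k + 1) := ⟨_, rfl⟩
  have hij : i < j := by rw [hi, hj]; exact hθ (Nat.lt_succ_self k)
  have hi1 : i₁ ≤ i := by rw [hi]; exact hk.trans (hθ.le_apply)
  have hi2 : 2 ≤ i := (le_max_right _ _).trans (hi₁ i hi1).1
  have hi0 : i₀ ≤ i := (le_max_left _ _).trans (hi₁ i hi1).1
  have hjj : IsJump ψ j := by rw [hj]; exact Nat.nth_mem_of_infinite hinf (k + 1)
  have hbetween : ∀ m, i < m → m < j → ψ m = m - 1 := by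
    intro m hm1 hm2
    refine hnj m (by omega) fun hjm => ?_
    obtain ⟨n, hn⟩ : ∃ n, theta ψ n = m := by
      have : m ∈ Set.range (Nat.nth (IsJump ψ)) := by
        rw [Nat.range_nth_of_infinite hinf]; exact hjm
      exact this
    rw [hi, ← hn, hθ.lt_iff_lt] at hm1
    rw [hj, ← hn, hθ.lt_iff_lt] at hm2
    omega
  rw [← hi, ← hj]
  have hPne : u (j - 1) ⨯₃ u j ≠ 0 := hne (by omega) (by omega)
  have hdown : ∀ n, n + i + 1 ≤ j → (u (j - 1) ⨯₃ u j) ⬝ᵥ u (j - n) = 0 ∧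
      (u (j - 1) ⨯₃ u j) ⬝ᵥ u (j - n - 1) = 0 := by
    intro n
    induction n with
    | zero => intro _; exact ⟨cross_dot_right _ _, cross_dot_left _ _⟩
    | succ n ih =>
      intro hn
      obtain ⟨ih1, ih2⟩ := ih (by omega)
      refine ⟨ih2, ?_⟩
      have e1 := F1 (j - n - 1) (by omega)
      rw [hbetween (j - n - 1) (by omega) (by omega), show j - n - 1 + 1 = j - n by omega] at e1
      have n1 := hne (i := j - n - 1) (j := j - n) (by omega) (by omega)
      exact dot_eq_zero_of_normal n1 (cross_dot_left _ _) (cross_dot_right _ _) n1 ih2 ih1 e1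
  have hP : ∀ m, i ≤ m → m ≤ j → (u (j - 1) ⨯₃ u j) ⬝ᵥ u m = 0 := by
    intro m hm1 hm2
    rcases hm2.lt_or_eq with h | h
    · have := (hdown (j - m - 1) (by omega)).2
      rwa [show j - (j - m - 1) - 1 = m by omega] at this
    · rw [h]; exact cross_dot_right _ _
  have hPi : (u (j - 1) ⨯₃ u j) ⬝ᵥ u (ψ i) = 0 := by
    have n1 := hne (i := i) (j := i + 1) (by omega) (by omega)
    exact dot_eq_zero_of_normal n1 (cross_dot_left _ _) (cross_dot_right _ _) n1
      (hP i le_rfl hij.le) (hP (i + 1) (by omega) hij) (F1 i hi1)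
  have hψj1 : 1 ≤ ψ j := (h3 j (by omega)).1
  have hψj2 : ψ j + 2 ≤ j := hjj.2
  have hPj : (u (j - 1) ⨯₃ u j) ⬝ᵥ u (ψ j) ≠ 0 := by
    intro h
    have e1 : (u j ⨯₃ u (j + 1)) ⬝ᵥ u (j - 1) = 0 :=
      dot_eq_zero_of_normal hPne h (cross_dot_right _ _) (hne hψj1 (by omega)) (F1 j (by omega))
        (cross_dot_left _ _) (cross_dot_left _ _)
    have := F2 j (by omega) e1
    omega
  refine ⟨?_, fun h => hPj (h ▸ hPi)⟩
  by_contra h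
  exact hPj (hP (ψ j) (by omega) (by omega))

end GoodSet

/-! ### Norms and exponents of sequences -/

lemma log_norm_bounds {ξ : ℝ} {x : Point} (hx : 1 ≤ x 0) (hL : L ξ x ≤ 1) :
    lsize x ≤ Real.log ‖x‖ ∧ Real.log ‖x‖ ≤ lsize x + Real.log (bnd ξ) := by
  have h1 : (1 : ℝ) ≤ x 0 := by exact_mod_cast hx
  have h2 := coord_zero_le_norm x
  have hb := one_le_bnd ξ
  refine ⟨Real.log_le_log (by linarith) h2, ?_⟩
  have h3 := Real.log_le_log (by linarith) (norm_le_bnd_mul hx hL)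
  rwa [Real.log_mul (by linarith) (by linarith), add_comm] at h3

/-- A sequence of points which, up to finitely many terms, has increasing positive first coordinates
and satisfies `L (v i) ≤ v_{i,0}^(-1+o(1))`. -/
structure ApproxSeq (ξ : ℝ) (v : ℕ → Point) : Prop where
  basic : ∃ i₀, ∀ i, i₀ ≤ i → 1 ≤ v i 0 ∧ v i 0 < v (i + 1) 0 ∧ L ξ (v i) ≤ 1
  tight : ∀ η, 0 < η → ∀ᶠ i in atTop, (1 - η) * lsize (v i) ≤ qual ξ (v i)

namespace ApproxSeq

variable {ξ : ℝ} {v : ℕ → Point}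

lemma tendsto (h : ApproxSeq ξ v) : Tendsto (fun i => lsize (v i)) atTop atTop := by
  obtain ⟨i₀, hi₀⟩ := h.basic
  exact tendsto_lsize fun i hi => (hi₀ i hi).2.1

lemma of_hasExponent (hξ : IrrationalNonQuadratic ξ) (hpos : ∀ i, 1 ≤ i → 0 < v i 0)
    (hmono : StrictMonoOn (fun i => v i 0) (Ici 1)) (hexp : HasExponentNegOne ξ v) :
    ApproxSeq ξ v := by
  obtain ⟨η, hη, hL⟩ := hexp
  have hlt : ∀ i, 1 ≤ i → v i 0 < v (i + 1) 0 := fun i hi =>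
    hmono hi (show 1 ≤ i + 1 by omega) (Nat.lt_succ_self i)
  have hq : ∀ i, 1 ≤ i → L ξ (v i) = ‖v i‖ ^ (-1 + η i) →
      qual ξ (v i) = (1 - η i) * Real.log ‖v i‖ ∧ 0 ≤ lsize (v i) ∧
        lsize (v i) ≤ Real.log ‖v i‖ := by
    intro i hi h
    have h1 : (1 : ℝ) ≤ v i 0 := by exact_mod_cast hpos i hi
    have h2 := coord_zero_le_norm (v i)
    refine ⟨?_, Real.log_nonneg h1, Real.log_le_log (by linarith) h2⟩
    rw [qual, h, Real.log_rpow (by linarith)]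
    ring
  constructor
  · obtain ⟨i₀, hi₀⟩ := eventually_atTop.mp ((hL.and (eventually_ge_atTop 1)).and
      (hη.eventually_le_const (show (0 : ℝ) < 1 by norm_num)))
    refine ⟨i₀, fun i hi => ?_⟩
    obtain ⟨⟨h1, h2⟩, h3⟩ := hi₀ i hi
    refine ⟨hpos i h2, hlt i h2, ?_⟩
    obtain ⟨h4, h5, h6⟩ := hq i h2 h1
    have hne : v i ≠ 0 := fun h => by have := hpos i h2; rw [h] at this; simp at this
    rw [← exp_neg_qual hξ hne, Real.exp_le_one_iff, h4]
    have := mul_nonneg (show 0 ≤ 1 - η i by linarith) (h5.trans h6)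
    linarith
  · intro δ hδ
    filter_upwards [hL, eventually_ge_atTop 1, hη.eventually_le_const
      (lt_min hδ one_pos : (0 : ℝ) < min δ 1)] with i h1 h2 h3
    obtain ⟨h4, h5, h6⟩ := hq i h2 h1
    rw [h4]
    have h7 := mul_le_mul_of_nonneg_left h6
      (show 0 ≤ 1 - η i by linarith [min_le_right δ 1])
    have h8 := mul_le_mul_of_nonneg_right (show 1 - δ ≤ 1 - η i by linarith [min_le_left δ 1]) h5
    linarith

/-- Such a sequence with `log v_{i+1,0} ≤ b' log v_{i,0}` provides the approximations that occur in
the definition of `betaSet`, for any `b > b'`. -/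
lemma mem_betaSet (hξ : IrrationalNonQuadratic ξ) (h : ApproxSeq ξ v) {b' b ε : ℝ} (hε : 0 < ε)
    (hb0 : 0 < b') (hb : b' < b)
    (hgap : ∀ᶠ i in atTop, lsize (v (i + 1)) ≤ b' * lsize (v i)) : b ∈ betaSet ξ ε := by
  have hbpos : 0 < b := hb0.trans hb
  obtain ⟨i₀, hi₀⟩ := h.basic
  obtain ⟨η, hη⟩ : ∃ η, η = min (1 - b' / b) ε := ⟨_, rfl⟩
  have hη0 : 0 < η := by
    rw [hη]
    refine lt_min ?_ hε
    rw [sub_pos, div_lt_one hbpos]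
    exact hb
  obtain ⟨i₁, hi₁⟩ := eventually_atTop.mp ((h.tight η hη0).and (hgap.and (eventually_ge_atTop i₀)))
  refine ⟨hbpos, ?_⟩
  filter_upwards [eventually_ge_atTop (v i₁ 0 : ℝ)] with B hB
  have hex : ∃ n, B < v (i₁ + n + 1) 0 := by
    obtain ⟨i, hi1, hi2⟩ := ((h.tendsto.eventually_gt_atTop (Real.log B)).and
      (eventually_ge_atTop (i₁ + 1))).exists
    refine ⟨i - i₁ - 1, ?_⟩
    rw [show i₁ + (i - i₁ - 1) + 1 = i by omega]
    by_contra hcon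
    have h1 : (1 : ℝ) ≤ v i 0 := by
      exact_mod_cast (hi₀ i ((hi₁ i (by omega)).2.2)).1
    have := Real.log_le_log (by linarith) (not_lt.mp hcon)
    exact absurd hi1 (not_lt.mpr this)
  classical
  obtain ⟨n, hn⟩ : ∃ n, n = Nat.find hex := ⟨_, rfl⟩
  have hn1 : B < v (i₁ + n + 1) 0 := hn ▸ Nat.find_spec hex
  have hn2 : (v (i₁ + n) 0 : ℝ) ≤ B := by
    rcases Nat.eq_zero_or_pos n with h0 | h0
    · rw [h0]; exact hB
    · have := Nat.find_min hex (m := n - 1) (by omega)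
      rw [not_lt, show i₁ + (n - 1) + 1 = i₁ + n by omega] at this
      exact this
  obtain ⟨t1, t2, t3⟩ := hi₁ (i₁ + n) (by omega)
  obtain ⟨b1, b2, b3⟩ := hi₀ _ t3
  have b1' : (1 : ℝ) ≤ v (i₁ + n) 0 := by exact_mod_cast b1
  have hs0 : 0 ≤ lsize (v (i₁ + n)) := Real.log_nonneg b1'
  have hne : v (i₁ + n) ≠ 0 := fun h => by rw [h] at b1; simp at b1
  have habs : |(v (i₁ + n) 0 : ℝ)| = v (i₁ + n) 0 := abs_of_pos (by linarith)
  refine ⟨v (i₁ + n), by rwa [habs], by rwa [habs], ?_⟩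
  rw [habs, ← exp_neg_qual hξ hne]
  apply le_min
  · rw [Real.rpow_def_of_pos (by linarith)]
    apply Real.exp_le_exp.mpr
    have hlB : Real.log B ≤ b' * lsize (v (i₁ + n)) :=
      (Real.log_le_log (by linarith) hn1.le).trans t2
    have h1 : (b' / b) * lsize (v (i₁ + n)) ≤ (1 - η) * lsize (v (i₁ + n)) :=
      mul_le_mul_of_nonneg_right (by rw [hη]; linarith [min_le_left (1 - b' / b) ε]) hs0
    have h2 : Real.log B * (1 / b) ≤ (b' / b) * lsize (v (i₁ + n)) := by
      have := mul_le_mul_of_nonneg_right hlB (show 0 ≤ 1 / b by positivity)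
      calc _ ≤ _ := this
        _ = _ := by ring
    have h3 : Real.log B * (-1 / b) = -(Real.log B * (1 / b)) := by ring
    rw [h3]
    linarith
  · rw [Real.rpow_def_of_pos (by linarith)]
    apply Real.exp_le_exp.mpr
    have h1 : (1 - ε) * lsize (v (i₁ + n)) ≤ (1 - η) * lsize (v (i₁ + n)) :=
      mul_le_mul_of_nonneg_right (by rw [hη]; linarith [min_le_right (1 - b' / b) ε]) hs0
    have h3 : Real.log (v (i₁ + n) 0) * (ε - 1) = -((1 - ε) * lsize (v (i₁ + n))) := by
      rw [lsize]; ring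
    rw [h3]
    linarith

/-- Logarithms of norms and of first coordinates are interchangeable in the limit. -/
lemma eventually_log_norm (h : ApproxSeq ξ v) {δ : ℝ} (hδ : 0 < δ) :
    ∀ᶠ i in atTop, 0 < lsize (v i) ∧ lsize (v i) ≤ Real.log ‖v i‖ ∧
      Real.log ‖v i‖ ≤ (1 + δ) * lsize (v i) := by
  obtain ⟨i₀, hi₀⟩ := h.basic
  filter_upwards [eventually_ge_atTop i₀, h.tendsto.eventually_gt_atTop 0,
    h.tendsto.eventually_ge_atTop (Real.log (bnd ξ) / δ)] with i h1 h2 h3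
  obtain ⟨b1, -, b3⟩ := hi₀ i h1
  obtain ⟨h4, h5⟩ := log_norm_bounds b1 b3
  rw [div_le_iff₀ hδ] at h3
  exact ⟨h2, h4, by linarith⟩

/-- Real bounds above the upper limit of the ratios of logarithms are gap exponents. -/
lemma eventually_lsize_le (h : ApproxSeq ξ v) {z : ℝ} (hz : limsup (logRatio v) atTop < z) :
    ∃ b, 0 < b ∧ b < z ∧ ∀ᶠ i in atTop, lsize (v (i + 1)) ≤ b * lsize (v i) := by
  obtain ⟨y, hy1, hy2⟩ := EReal.lt_iff_exists_real_btwn.mp hz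
  have hyz : y < z := by exact_mod_cast hy2
  have hev := eventually_lt_of_limsup_lt hy1
  have hnext := (tendsto_add_atTop_nat 1).eventually (h.eventually_log_norm one_pos)
  have hpos : ∀ᶠ i in atTop, 0 < y ∧ lsize (v (i + 1)) ≤ y * Real.log ‖v i‖ := by
    filter_upwards [hev, h.eventually_log_norm one_pos, hnext] with i h1 h2 h3
    have h4 : Real.log ‖v (i + 1)‖ / Real.log ‖v i‖ < y := by
      rw [logRatio] at h1; exact_mod_cast h1
    have h5 : 0 < Real.log ‖v i‖ := h2.1.trans_le h2.2.1
    have h6 : 0 < Real.log ‖v (i + 1)‖ := h3.1.trans_le h3.2.1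
    refine ⟨(div_pos h6 h5).trans h4, ?_⟩
    rw [div_lt_iff₀ h5] at h4
    exact h3.2.1.trans h4.le
  have hy0 : 0 < y := hpos.exists.choose_spec.1
  have hδ : 0 < (z - y) / (2 * y) := div_pos (by linarith) (by linarith)
  refine ⟨(y + z) / 2, by linarith, by linarith, ?_⟩
  filter_upwards [hpos, h.eventually_log_norm hδ] with i h1 h2
  have h3 := mul_le_mul_of_nonneg_left h2.2.2 hy0.le
  have h4 : y * ((1 + (z - y) / (2 * y)) * lsize (v i)) = (y + z) / 2 * lsize (v i) := by
    field_simp; ring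
  linarith [h1.2]

lemma beta_le_limsup (hξ : IrrationalNonQuadratic ξ) (h : ApproxSeq ξ v) {ε : ℝ} (hε : 0 < ε) :
    beta ξ ε ≤ limsup (logRatio v) atTop := by
  rw [← EReal.le_of_forall_lt_iff_le]
  intro z hz
  obtain ⟨b, hb0, hb, hgap⟩ := h.eventually_lsize_le hz
  exact sInf_le ⟨z, h.mem_betaSet hξ hε hb0 hb hgap, rfl⟩

lemma beta0_le_limsup (hξ : IrrationalNonQuadratic ξ) (h : ApproxSeq ξ v) :
    beta0 ξ ≤ limsup (logRatio v) atTop :=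
  iSup₂_le fun _ hε => h.beta_le_limsup hξ hε.1

lemma limsup_le (h : ApproxSeq ξ v) {b C : ℝ}
    (hgap : ∀ᶠ i in atTop, lsize (v (i + 1)) ≤ b * lsize (v i) + C) :
    limsup (logRatio v) atTop ≤ b := by
  rw [← EReal.le_of_forall_lt_iff_le]
  intro z hz
  have hz' : b < z := by exact_mod_cast hz
  refine limsup_le_of_le (by isBoundedDefault) ?_
  -- `C` and the discrepancy between norms and first coordinates are absorbed by `z - b`
  obtain ⟨δ, hδ0, hδ⟩ : ∃ δ : ℝ, 0 < δ ∧ δ * (|b| + 1) ≤ (z - b) / 2 ∧ δ ≤ 1 := by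
    refine ⟨min 1 ((z - b) / 2 / (|b| + 1)), lt_min one_pos (div_pos (by linarith) (by positivity)),
      ?_, min_le_left _ _⟩
    rw [← le_div_iff₀ (by positivity)]
    exact min_le_right _ _
  have hC : ∀ᶠ i in atTop, |C| * 4 / (z - b) ≤ lsize (v i) := h.tendsto.eventually_ge_atTop _
  filter_upwards [hgap, h.eventually_log_norm hδ0,
    (tendsto_add_atTop_nat 1).eventually (h.eventually_log_norm hδ0), hC] with i h1 h2 h3 h4
  have h5 : 0 < Real.log ‖v i‖ := h2.1.trans_le h2.2.1
  rw [logRatio]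
  have : Real.log ‖v (i + 1)‖ / Real.log ‖v i‖ ≤ z := by
    rw [div_le_iff₀ h5]
    rw [div_le_iff₀ (by linarith)] at h4
    have e1 : (1 + δ) * lsize (v (i + 1)) ≤ (1 + δ) * (b * lsize (v i) + C) :=
      mul_le_mul_of_nonneg_left h1 (by linarith)
    have e2 : δ * b * lsize (v i) ≤ δ * (|b| + 1) * lsize (v i) :=
      mul_le_mul_of_nonneg_right (mul_le_mul_of_nonneg_left (by linarith [le_abs_self b]) hδ0.le)
        h2.1.le
    have e3 := mul_le_mul_of_nonneg_right hδ.1 h2.1.le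
    have e4 : (1 + δ) * C ≤ 2 * |C| := by
      have a1 := le_abs_self C
      have a2 := mul_le_mul_of_nonneg_left a1 (show 0 ≤ 1 + δ by linarith)
      have a3 := mul_le_mul_of_nonneg_right hδ.2 (abs_nonneg C)
      linarith
    have hz0 : 0 ≤ z := by
      have a1 : 0 ≤ (1 + δ) * lsize (v (i + 1)) := mul_nonneg (by linarith) h3.1.le
      have a2 : 0 ≤ z * lsize (v i) := by linarith
      exact nonneg_of_mul_nonneg_left a2 h2.1
    have e5 := mul_le_mul_of_nonneg_left h2.2.1 hz0
    linarith [h3.2.2]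
  exact_mod_cast this

lemma one_lt_liminf (h : ApproxSeq ξ v) {ρ : ℝ} (hρ : 1 < ρ)
    (hgrow : ∀ᶠ i in atTop, ρ * lsize (v i) ≤ lsize (v (i + 1))) :
    1 < liminf (logRatio v) atTop := by
  obtain ⟨δ, hδ⟩ : ∃ δ, δ = (ρ - 1) / 2 := ⟨_, rfl⟩
  have hδ0 : 0 < δ := by rw [hδ]; linarith
  have hlt : (1 : EReal) < ((ρ / (1 + δ) : ℝ) : EReal) := by
    have : 1 < ρ / (1 + δ) := by rw [lt_div_iff₀ (by linarith)]; linarith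
    exact_mod_cast this
  refine hlt.trans_le (le_liminf_of_le (by isBoundedDefault) ?_)
  filter_upwards [hgrow, h.eventually_log_norm hδ0,
    (tendsto_add_atTop_nat 1).eventually (h.eventually_log_norm hδ0)] with i h1 h2 h3
  have h5 : 0 < Real.log ‖v i‖ := h2.1.trans_le h2.2.1
  rw [logRatio]
  have : ρ / (1 + δ) ≤ Real.log ‖v (i + 1)‖ / Real.log ‖v i‖ := by
    rw [div_le_div_iff₀ (by linarith) h5]
    have e1 := mul_le_mul_of_nonneg_left h2.2.2 (show 0 ≤ ρ by linarith)
    have e2 := mul_le_mul_of_nonneg_left (h1.trans h3.2.1) (show 0 ≤ 1 + δ by linarith)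
    linarith
  exact_mod_cast this

lemma hasExponentNegOne (hξ : IrrationalNonQuadratic ξ) (h : ApproxSeq ξ v) {C : ℝ}
    (hq : ∀ᶠ i in atTop, qual ξ (v i) ≤ lsize (v i) + C) : HasExponentNegOne ξ v := by
  refine ⟨fun i => 1 - qual ξ (v i) / Real.log ‖v i‖, ?_, ?_⟩
  · rw [Metric.tendsto_atTop']
    intro δ hδ
    obtain ⟨η, hη0, hη1, hη⟩ : ∃ η : ℝ, 0 < η ∧ η < 1 ∧ 3 * η ≤ δ :=
      ⟨min (1 / 2) (δ / 3), lt_min (by norm_num) (by linarith),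
        (min_le_left _ _).trans_lt (by norm_num), by linarith [min_le_right (1 / 2) (δ / 3)]⟩
    obtain ⟨N, hN⟩ := eventually_atTop.mp ((h.eventually_log_norm hη0).and ((h.tight η hη0).and
      (hq.and (h.tendsto.eventually_ge_atTop (|C| / η)))))
    refine ⟨N, fun i hi => ?_⟩
    obtain ⟨⟨h1, h2, h3⟩, h4, h5, h6⟩ := hN i hi.le
    have h7 : 0 < Real.log ‖v i‖ := h1.trans_le h2
    rw [div_le_iff₀ hη0] at h6
    have e1 := mul_le_mul_of_nonneg_left h2 hη0.le
    have e2 := mul_le_mul_of_nonneg_left h2 (mul_pos hη0 hη0).le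
    have e3 : 1 - qual ξ (v i) / Real.log ‖v i‖ =
        (Real.log ‖v i‖ - qual ξ (v i)) / Real.log ‖v i‖ := by field_simp
    have hδl := mul_le_mul_of_nonneg_right hη h7.le
    have hηl := mul_pos hη0 h7
    rw [Real.dist_eq, sub_zero, e3, abs_lt, lt_div_iff₀ h7, div_lt_iff₀ h7]
    constructor
    · linarith [le_abs_self C]
    · linarith
  · obtain ⟨i₀, hi₀⟩ := h.basic
    filter_upwards [h.eventually_log_norm one_pos, eventually_ge_atTop i₀] with i h1 h2
    have h3 := (hi₀ i h2).1
    have hne : v i ≠ 0 := fun h => by rw [h] at h3; simp at h3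
    have h4 : 0 < Real.log ‖v i‖ := h1.1.trans_le h1.2.1
    have h5 := one_le_norm hne
    rw [← exp_neg_qual hξ hne, Real.rpow_def_of_pos (by linarith)]
    congr 1
    field_simp
    ring

end ApproxSeq

/-! ### Exponents -/

lemma mem_betaSet_of_le {ξ ε b b' : ℝ} (hb : b ∈ betaSet ξ ε) (h : b ≤ b') : b' ∈ betaSet ξ ε := by
  obtain ⟨hb0, hev⟩ := hb
  refine ⟨hb0.trans_le h, ?_⟩
  filter_upwards [hev, eventually_ge_atTop 1] with B ⟨x, h1, h2, h3⟩ hB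
  refine ⟨x, h1, h2, h3.trans (min_le_min ?_ le_rfl)⟩
  refine Real.rpow_le_rpow_of_exponent_le hB ?_
  rw [neg_div, neg_div, neg_le_neg_iff]
  exact one_div_le_one_div_of_le hb0 h

lemma mem_betaSet_of_beta_lt {ξ ε b : ℝ} (h : beta ξ ε < b) : b ∈ betaSet ξ ε := by
  obtain ⟨_, ⟨c, hc, rfl⟩, hcb⟩ := sInf_lt_iff.mp h
  exact mem_betaSet_of_le hc (EReal.coe_le_coe_iff.mp hcb.le)

lemma beta_nonneg (ξ ε : ℝ) : 0 ≤ beta ξ ε := by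
  apply le_sInf
  rintro _ ⟨c, hc, rfl⟩
  exact EReal.coe_nonneg.mpr hc.1.le

lemma beta_antitone {ξ ε ε' : ℝ} (h : ε ≤ ε') : beta ξ ε' ≤ beta ξ ε :=
  sInf_le_sInf (image_mono (betaSet_mono h))

lemma beta_le_beta0 {ξ ε : ℝ} (h : 0 < ε) : beta ξ ε ≤ beta0 ξ := by
  have h1 : beta ξ (min ε (1 / 2)) ≤ beta0 ξ := le_iSup₂_of_le (min ε (1 / 2))
    ⟨lt_min h (by norm_num), (min_le_right _ _).trans_lt (by norm_num)⟩ le_rfl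
  exact (beta_antitone (min_le_left _ _)).trans h1

/-- Real exponents slightly above `β₁` and `β₀` for which `ε` is still admissible. -/
lemma exists_exponents {ξ ε : ℝ} (h : beta0 ξ < 2) (hε : ε < epsilon1 ξ) :
    ∃ b₁ b₀, b₁ ∈ betaSet ξ 1 ∧ b₁ < 2 ∧ b₀ < 2 ∧ (∀ η, 0 < η → η < 1 → b₀ ∈ betaSet ξ η) ∧
      ε < (2 - b₁) * (2 + b₁ - b₀ * b₁) := by
  have hreal : ∀ {x : EReal}, 0 ≤ x → x ≤ beta0 ξ →
      ((x.toReal : ℝ) : EReal) = x ∧ x.toReal < 2 := by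
    intro x h0 hx
    have h2 : x < 2 := hx.trans_lt h
    have e := EReal.coe_toReal (x := x) (ne_top_of_lt h2)
      (ne_bot_of_le_ne_bot (by simp) h0)
    refine ⟨e, ?_⟩
    rw [← e, show (2 : EReal) = ((2 : ℝ) : EReal) from rfl] at h2
    exact EReal.coe_lt_coe_iff.mp h2
  obtain ⟨e1, l1⟩ := hreal (beta_nonneg ξ 1) (beta_le_beta0 one_pos)
  obtain ⟨e0, l0⟩ := hreal ((beta_nonneg ξ 1).trans (beta_le_beta0 one_pos)) le_rfl
  obtain ⟨β₁, h₁⟩ : ∃ β, β = (beta ξ 1).toReal := ⟨_, rfl⟩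
  obtain ⟨β₀, h₀⟩ : ∃ β, β = (beta0 ξ).toReal := ⟨_, rfl⟩
  rw [epsilon1] at hε
  rw [← h₁] at e1 l1 hε
  rw [← h₀] at e0 l0 hε
  have hlim : Tendsto (fun t : ℝ => (2 - (β₁ + t)) * (2 + (β₁ + t) - (β₀ + t) * (β₁ + t)))
      (𝓝[>] 0) (𝓝 ((2 - (β₁ + 0)) * (2 + (β₁ + 0) - (β₀ + 0) * (β₁ + 0)))) := by
    refine Tendsto.mono_left (Continuous.tendsto ?_ 0) nhdsWithin_le_nhds
    fun_prop
  have hev := hlim.eventually_const_lt (u := ε) (by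
    refine hε.trans_le (le_of_eq ?_)
    ring)
  have hsmall : ∀ᶠ t : ℝ in 𝓝[>] 0, t < min (2 - β₁) (2 - β₀) :=
    (eventually_lt_nhds (lt_min (by linarith) (by linarith))).filter_mono nhdsWithin_le_nhds
  obtain ⟨t, ⟨ht1, ht2⟩, ht3⟩ := ((hev.and hsmall).and self_mem_nhdsWithin).exists
  have ht0 : 0 < t := ht3
  have m1 := min_le_left (2 - β₁) (2 - β₀)
  have m2 := min_le_right (2 - β₁) (2 - β₀)
  refine ⟨β₁ + t, β₀ + t, mem_betaSet_of_beta_lt ?_, by linarith, by linarith,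
    fun η hη _ => mem_betaSet_of_beta_lt ((beta_le_beta0 hη).trans_lt ?_), ht1⟩
  · rw [← e1]; exact_mod_cast (by linarith : β₁ < β₁ + t)
  · rw [← e0]; exact_mod_cast (by linarith : β₀ < β₀ + t)

/-! ### Minimal points in `𝓐_ε` -/

/-- The set of minimal points in `𝓐_ε`. -/
def MinimalIn (ξ ε : ℝ) : Set Point := {a | IsMinimalPoint ξ a ∧ a ∈ A ξ ε}

lemma IsMinimalPoint.mem_A_iff {ξ ε : ℝ} (hξ : IrrationalNonQuadratic ξ) {a : Point}
    (ha : IsMinimalPoint ξ a) : a ∈ A ξ ε ↔ (1 - ε) * Real.log ‖a‖ ≤ qual ξ a := by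
  have hn := one_le_norm ha.ne_zero
  have hL := L_pos hξ ha.ne_zero
  have hl := Real.log_nonneg hn
  have key : L ξ a ≤ ‖a‖ ^ (-(1 - ε)) ↔ (1 - ε) * Real.log ‖a‖ ≤ qual ξ a := by
    rw [← Real.log_le_log_iff hL (Real.rpow_pos_of_pos (by linarith) _),
      Real.log_rpow (by linarith), qual]
    constructor <;> intro h <;> linarith
  by_cases hε : ε < 1
  · rw [← key]
    exact ⟨fun h => h.2 hε, fun h => ⟨ha.ne_zero, fun _ => h⟩⟩
  · refine ⟨fun _ => ?_, fun _ => ⟨ha.ne_zero, fun h => absurd h hε⟩⟩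
    have := mul_nonneg (show 0 ≤ ε - 1 by linarith) hl
    linarith [ha.qual_nonneg]

lemma minimalIn_subset_good {ξ ε : ℝ} (hξ : IrrationalNonQuadratic ξ) :
    MinimalIn ξ ε ⊆ Good ξ ε := by
  rintro a ⟨ha, haA⟩
  refine ⟨ha, ?_⟩
  rw [ha.mem_A_iff hξ] at haA
  have h1 := (log_norm_bounds ha.one_le ha.L_le_one).1
  by_cases hε : ε < 1
  · exact (mul_le_mul_of_nonneg_left h1 (by linarith)).trans haA
  · have := mul_nonneg (show 0 ≤ ε - 1 by linarith) ha.lsize_nonneg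
    linarith [ha.qual_nonneg]

lemma exists_good_subset_minimalIn {ξ ε η : ℝ} (hξ : IrrationalNonQuadratic ξ) (h : η < ε) :
    ∃ N, ∀ a ∈ Good ξ η, N ≤ lsize a → a ∈ MinimalIn ξ ε := by
  have hb := Real.log_nonneg (one_le_bnd ξ)
  refine ⟨|1 - ε| * Real.log (bnd ξ) / (ε - η), fun a ha hN => ⟨ha.1, ?_⟩⟩
  rw [ha.1.mem_A_iff hξ]
  rw [div_le_iff₀ (by linarith)] at hN
  obtain ⟨h1, h2⟩ := log_norm_bounds ha.1.one_le ha.1.L_le_one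
  have h0 := ha.1.lsize_nonneg
  by_cases hε : ε < 1
  · have h3 := mul_le_mul_of_nonneg_left h2 (show 0 ≤ 1 - ε by linarith)
    rw [abs_of_pos (by linarith)] at hN
    linarith [ha.2]
  · have := mul_nonneg (show 0 ≤ ε - 1 by linarith) (h0.trans h1)
    linarith [ha.1.qual_nonneg]

/-- Gap bound for sets containing all large minimal points of relative defect at most `η`. -/
lemma exists_gap_of_full {ξ η b : ℝ} (hξ : IrrationalNonQuadratic ξ) (hb : b ∈ betaSet ξ η)
    {G : Set Point} (hG : G ⊆ MP ξ) (hfull : ∃ N, ∀ a ∈ Good ξ η, N ≤ lsize a → a ∈ G) :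
    ∃ C, 0 ≤ C ∧ ∀ x y, Consec G x y → lsize y ≤ b * qual ξ x + C := by
  obtain ⟨N, hN⟩ := hfull
  obtain ⟨n₀, hn₀, h⟩ := exists_of_mem_betaSet hξ hb
  obtain ⟨Q, hQ, hQb⟩ := exists_qual_bound hξ N
  have hb0 := hb.1
  have hl2 := Real.log_nonneg (show (1 : ℝ) ≤ 2 by norm_num)
  have hln : 0 ≤ Real.log n₀ := Real.log_nonneg (by exact_mod_cast (by omega : (1 : ℤ) ≤ n₀))
  have hbQ := mul_nonneg hb0.le hQ
  refine ⟨Real.log n₀ + b * Q + Real.log 2, by positivity, fun x y hxy => ?_⟩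
  have hx := hG hxy.1
  have hbx := mul_nonneg hb0.le hx.qual_nonneg
  by_cases hy : n₀ ≤ y 0
  · obtain ⟨c, hc, hcy, hlog⟩ := h (y 0) hy
    have hlog' : lsize y ≤ b * qual ξ c + Real.log 2 := hlog
    by_cases hcN : N ≤ lsize c
    · have hcx := (hxy.2.2.2 c (hN c hc hcN)).resolve_right (by omega)
      have := mul_le_mul_of_nonneg_left (hc.1.qual_le hξ hx hcx) hb0.le
      linarith
    · have := mul_le_mul_of_nonneg_left (hQb c hc.1 (not_le.mp hcN).le) hb0.le
      linarith
  · have := lsize_le_log (hG hxy.2.1).one_le (not_le.mp hy).le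
    linarith

/-- For admissible `ε`, the minimal points in `𝓐_ε` form a good set. -/
lemma goodSet_minimalIn {ξ ε b₁ b₀ : ℝ} (hξ : IrrationalNonQuadratic ξ) (hε : 0 < ε)
    (hb₁ : b₁ ∈ betaSet ξ 1) (hb₁2 : b₁ < 2) (hb₀2 : b₀ < 2)
    (hb₀ : ∀ η, 0 < η → η < 1 → b₀ ∈ betaSet ξ η) (hε1 : ε < (2 - b₁) * (2 + b₁ - b₀ * b₁)) :
    GoodSet ξ b₁ (MinimalIn ξ ε) := by
  have hη0 : 0 < min (ε / 2) (1 / 2) := lt_min (by linarith) (by norm_num)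
  have hη1 : min (ε / 2) (1 / 2) < 1 := (min_le_right _ _).trans_lt (by norm_num)
  have hfull := exists_good_subset_minimalIn hξ
    (show min (ε / 2) (1 / 2) < ε from (min_le_left _ _).trans_lt (by linarith))
  have hsub : MinimalIn ξ ε ⊆ MP ξ := fun a ha => ha.1
  refine ⟨hξ, hb₁, hb₁2, hsub, fun η hη => ?_, ⟨_, hη0, hfull⟩, ?_, fun M => ?_⟩
  · obtain ⟨N, hN⟩ := exists_good_subset hξ hb₁ hb₁2 hb₀2 hb₀ hε hε1 hη
    exact ⟨N, fun a ha h => hN a (minimalIn_subset_good hξ ha) h⟩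
  · obtain ⟨C, hC, h⟩ := exists_gap_of_full hξ (hb₀ _ hη0 hη1) hsub hfull
    exact ⟨b₀, C, hb₀2, hC, h⟩
  · obtain ⟨N, hN⟩ := hfull
    obtain ⟨c, hc, hcM⟩ := exists_lsize_ge hξ (hb₀ _ hη0 hη1) (max M N)
    exact ⟨c, hN c hc ((le_max_right _ _).trans hcM.le), (le_max_left _ _).trans_lt hcM⟩

/-- All large minimal points of relative defect at most `ε` belong to `𝓐_ε`, although the
definition of the latter involves the sup norm. -/
lemma exists_good_self_subset_minimalIn {ξ ε b₁ b₀ : ℝ} (hξ : IrrationalNonQuadratic ξ) (hε : 0 < ε)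
    (hb₁ : b₁ ∈ betaSet ξ 1) (hb₁2 : b₁ < 2) (hb₀2 : b₀ < 2)
    (hb₀ : ∀ η, 0 < η → η < 1 → b₀ ∈ betaSet ξ η) (hε1 : ε < (2 - b₁) * (2 + b₁ - b₀ * b₁)) :
    ∃ N, ∀ a ∈ Good ξ ε, N ≤ lsize a → a ∈ MinimalIn ξ ε := by
  obtain ⟨N1, hN1⟩ := exists_good_subset hξ hb₁ hb₁2 hb₀2 hb₀ hε hε1 (half_pos hε)
  obtain ⟨N2, hN2⟩ := exists_good_subset_minimalIn hξ (half_lt_self hε)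
  exact ⟨max N1 N2, fun a ha h => hN2 a (hN1 a ha ((le_max_left _ _).trans h))
    ((le_max_right _ _).trans h)⟩

/-! ### Enumerations -/

lemma isMinimalSequence_iff {ξ ε : ℝ} (hξ : IrrationalNonQuadratic ξ) {u : ℕ → Point} :
    IsMinimalSequence ξ ε u ↔ Enumerates u (MinimalIn ξ ε) := by
  refine and_congr_left fun hu => ?_
  have hm : ∀ i ∈ Ici 1, IsMinimalPoint ξ (u i) := fun i hi => by
    have : u i ∈ {a | IsMinimalPoint ξ a ∧ a ∈ A ξ ε} := hu ▸ mem_image_of_mem u hi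
    exact this.1
  constructor
  · intro h i hi j hj hij
    show u i 0 < u j 0
    by_contra hcon
    have h1 : ‖u i‖ < ‖u j‖ := h hi hj hij
    rcases (not_lt.mp hcon).lt_or_eq with h2 | h2
    · exact lt_asymm h1 ((hm j hj).norm_lt (hm i hi) h2)
    · rw [(hm j hj).eq_of_first_eq hξ (hm i hi) h2] at h1
      exact lt_irrefl _ h1
  · intro h i hi j hj hij
    exact (hm i hi).norm_lt (hm j hj) (h hi hj hij)

lemma exists_enumerates {ξ : ℝ} (hξ : IrrationalNonQuadratic ξ) {G : Set Point} (hG : G ⊆ MP ξ)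
    (hunb : ∀ M, ∃ a ∈ G, M < lsize a) : ∃ u, Enumerates u G := by
  obtain ⟨P, hP⟩ : ∃ P : ℕ → Prop, P = fun n : ℕ => ∃ a ∈ G, a 0 = (n : ℤ) := ⟨_, rfl⟩
  have hinf : {n | P n}.Infinite := by
    rw [Set.infinite_iff_exists_gt]
    intro n
    obtain ⟨a, ha, hna⟩ := hunb (Real.log n)
    have h1 := (hG ha).one_le
    refine ⟨(a 0).toNat, ?_, ?_⟩
    · rw [hP]; exact ⟨a, ha, by omega⟩
    · by_contra hcon
      have h2 := lsize_le_log h1 (n := (n : ℤ)) (by omega)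
      push_cast at h2
      linarith
  have hmem : ∀ k, P (Nat.nth P k) := Nat.nth_mem_of_infinite hinf
  have hmem' : ∀ k, ∃ a ∈ G, a 0 = (Nat.nth P k : ℤ) := fun k => by
    have := hmem k
    rw [hP] at this ⊢
    exact this
  choose f hf hf0 using hmem'
  have hmono := Nat.nth_strictMono hinf
  refine ⟨fun i => f (i - 1), ?_, ?_⟩
  · intro i hi j hj hij
    have hi' : 1 ≤ i := hi
    show f (i - 1) 0 < f (j - 1) 0
    rw [hf0, hf0]
    exact_mod_cast hmono (show i - 1 < j - 1 by omega)
  · ext a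
    constructor
    · rintro ⟨i, -, rfl⟩
      exact hf _
    · intro ha
      have h1 := (hG ha).one_le
      have h2 : (a 0).toNat ∈ Set.range (Nat.nth P) := by
        rw [Nat.range_nth_of_infinite hinf]
        show P _
        rw [hP]
        exact ⟨a, ha, by omega⟩
      obtain ⟨k, hk⟩ := h2
      refine ⟨k + 1, show 1 ≤ k + 1 by omega, ?_⟩
      have h3 : f k 0 = a 0 := by rw [hf0, hk]; omega
      show f (k + 1 - 1) = a
      rw [Nat.add_sub_cancel]
      exact (hG (hf k)).eq_of_first_eq hξ (hG ha) h3

/-- A sequence of consecutive elements of `G` is a tail of the enumeration of `G`. -/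
lemma sameTail_of_consec {ξ : ℝ} (hξ : IrrationalNonQuadratic ξ) {G : Set Point} (hG : G ⊆ MP ξ)
    {u v : ℕ → Point} (hu : Enumerates u G) {i₁ : ℕ}
    (hv : ∀ i, i₁ ≤ i → Consec G (v i) (v (i + 1))) : SameTail v u := by
  obtain ⟨j, hj, hjv⟩ := hu.exists_index (hv i₁ le_rfl).1
  refine ⟨i₁, j, fun i _ => ?_⟩
  induction i with
  | zero => exact hjv.symm
  | succ i ih =>
    have h0 : v (i₁ + i) = u (j + i) := by
      rcases Nat.eq_zero_or_pos i with h | h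
      · rw [h]; exact hjv.symm
      · exact ih h
    have h1 := hv (i₁ + i) (by omega)
    have h2 := hu.consec (show 1 ≤ j + i by omega)
    rw [← h0] at h2
    have h3 := (h1.2.2.2 _ h2.2.1).resolve_left (by have := h2.2.2.1; omega)
    have h4 := (h2.2.2.2 _ h1.2.1).resolve_left (by have := h1.2.2.1; omega)
    exact (hG h1.2.1).eq_of_first_eq hξ (hG h2.2.1) (le_antisymm h3 h4)

lemma sameTail_of_eventually_eq {ξ : ℝ} (hξ : IrrationalNonQuadratic ξ) {G G' : Set Point}
    (hG : G ⊆ MP ξ) (hG' : G' ⊆ MP ξ) {u u' : ℕ → Point} (hu : Enumerates u G)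
    (hu' : Enumerates u' G') {N : ℝ} (h : ∀ a, N ≤ lsize a → (a ∈ G ↔ a ∈ G')) :
    SameTail u u' := by
  obtain ⟨i₁, hi₁⟩ := eventually_atTop.mp ((eventually_ge_atTop 1).and
    ((tendsto_lsize (i₀ := 1) fun i hi => hu.lt hi (Nat.lt_succ_self i)).eventually_ge_atTop N))
  refine sameTail_of_consec hξ hG' hu' (i₁ := i₁) fun i hi => ?_
  obtain ⟨h1, h2⟩ := hi₁ i hi
  have hc := hu.consec h1
  refine ⟨(h _ h2).mp hc.1, (h _ (hi₁ (i + 1) (by omega)).2).mp hc.2.1, hc.2.2.1, fun c hcG => ?_⟩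
  by_cases hcu : u i 0 < c 0
  · exact hc.2.2.2 c ((h c (h2.trans ((hG hc.1).lsize_lt hcu).le)).mpr hcG)
  · exact Or.inl (not_lt.mp hcu)

/-- The class of `ψ` modulo `𝓡` only depends on the sequence up to finitely many terms. -/
lemma R_of_sameTail {ξ b₁ : ℝ} {G G' : Set Point} (hG : GoodSet ξ b₁ G) (hG' : G' ⊆ MP ξ)
    {u u' : ℕ → Point} (hu : Enumerates u G) (hu' : Enumerates u' G') (h : SameTail u u')
    {ψ ψ' : ℕ → ℕ} (hψ : ψ ∈ F) (hψ' : ψ' ∈ F) (hd : Describes ψ u) (hd' : Describes ψ' u') :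
    R ψ ψ' := by
  have hξ := hG.irr
  obtain ⟨a, b, hab⟩ := h
  obtain ⟨-, ⟨c, hc⟩, -⟩ := hψ
  obtain ⟨-, ⟨c', hc'⟩, -⟩ := hψ'
  obtain ⟨M, hM, hdet⟩ := exists_pdet_ne_zero hξ hG.mem hG.lt_two
  have hlim := tendsto_lsize (i₀ := 1) fun i hi => hu.lt hi (Nat.lt_succ_self i)
  obtain ⟨i₁, hi₁⟩ := eventually_atTop.mp (hd.and (hlim.eventually_gt_atTop M))
  obtain ⟨i₂, hi₂⟩ := eventually_atTop.mp hd'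
  refine ⟨(a : ℤ) - b, i₁ + i₂ + a + b + c.toNat + c'.toNat + 1, fun i hi => ?_⟩
  obtain ⟨m, hm⟩ : ∃ m, m = i - a + b := ⟨_, rfl⟩
  have hm' : (i : ℤ) - (a - b) = m := by omega
  have hm1 : ((i : ℤ) - (a - b)).toNat = m := by omega
  refine ⟨by omega, ?_⟩
  rw [hm1, hm']
  have hum : ∀ n, a + 1 ≤ n → u n = u' (n - a + b) := fun n hn => by
    have := hab (n - a) (by omega)
    rwa [show a + (n - a) = n by omega, show b + (n - a) = n - a + b by omega] at this
  have e1 := hc i (by omega)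
  have e2 := hc' m (by omega)
  obtain ⟨d1, d2⟩ := hi₁ i (by omega)
  have d3 := hi₂ m (by omega)
  rw [isCollinear_iff] at d1 d3
  have hmi : IsMinimalPoint ξ (u i) := hG.sub (hu.mem (by omega))
  have hmi1 : IsMinimalPoint ξ (u (i + 1)) := hG.sub (hu.mem (by omega))
  have hne := bracket_ne_zero (hdet _ hmi d2) hmi1.ne_zero
  have q1 := hum i (by omega)
  have q2 := hum (i + 1) (by omega)
  rw [← hm] at q1
  rw [show i + 1 - a + b = m + 1 by omega] at q2
  rw [← q1, ← q2] at d3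
  have q3 := cross_trans hne (cross_comm_eq_zero d1) d3
  have q4 := (hG.sub (hu.mem (show 1 ≤ ψ i by omega))).eq_of_cross hξ
    (hG' (hu'.mem (show 1 ≤ ψ' m by omega))) q3
  rw [hum (ψ i) (by omega)] at q4
  have q5 := hu'.injOn (by omega) (by omega) q4
  omega

/-! ### The two parts of the theorem -/

lemma GoodSet.approxSeq {ξ b₁ : ℝ} {G : Set Point} (hG : GoodSet ξ b₁ G) {u : ℕ → Point}
    (hu : Enumerates u G) : ApproxSeq ξ u := by
  have hm : ∀ i, 1 ≤ i → IsMinimalPoint ξ (u i) := fun i hi => hG.sub (hu.mem hi)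
  have hlim := tendsto_lsize (i₀ := 1) fun i hi => hu.lt hi (Nat.lt_succ_self i)
  refine ⟨⟨1, fun i hi => ⟨(hm i hi).one_le, hu.lt hi (Nat.lt_succ_self i), (hm i hi).L_le_one⟩⟩,
    fun η hη => ?_⟩
  obtain ⟨N, hN⟩ := hG.tight η hη
  filter_upwards [eventually_ge_atTop 1, hlim.eventually_ge_atTop N] with i h1 h2
  exact (hN _ (hu.mem h1) h2).2

lemma exists_goodSet {ξ ε : ℝ} (hξ : IrrationalNonQuadratic ξ) (h : beta0 ξ < 2) (hε : 0 < ε)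
    (hε1 : ε < epsilon1 ξ) : ∃ b₁, GoodSet ξ b₁ (MinimalIn ξ ε) ∧
      ∃ N, ∀ a ∈ Good ξ ε, N ≤ lsize a → a ∈ MinimalIn ξ ε := by
  obtain ⟨b₁, b₀, h1, h2, h3, h4, h5⟩ := exists_exponents h hε1
  exact ⟨b₁, goodSet_minimalIn hξ hε h1 h2 h3 h4 h5,
    exists_good_self_subset_minimalIn hξ hε h1 h2 h3 h4 h5⟩

lemma GoodSet.limsup_le_beta {ξ b₁ ε : ℝ} {G : Set Point} (hG : GoodSet ξ b₁ G)
    (hfull : ∃ N, ∀ a ∈ Good ξ ε, N ≤ lsize a → a ∈ G) {u : ℕ → Point} (hu : Enumerates u G) :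
    limsup (logRatio u) atTop ≤ beta ξ ε := by
  obtain ⟨C2, hC2, hqual⟩ := exists_qual_le hG.irr hG.mem hG.lt_two
  apply le_sInf
  rintro _ ⟨b, hb, rfl⟩
  obtain ⟨C, hC, h⟩ := exists_gap_of_full hG.irr hb hG.sub hfull
  refine (hG.approxSeq hu).limsup_le (C := b * C2 + C) ?_
  filter_upwards [eventually_ge_atTop 1] with i hi
  have h1 := h _ _ (hu.consec hi)
  have h2 := mul_le_mul_of_nonneg_left (hqual _ (hG.sub (hu.mem hi))) hb.1.le
  linarith

/-- The equalities of exponents in the first part. -/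
lemma GoodSet.beta0_eq {ξ b₁ ε : ℝ} {G : Set Point} (hG : GoodSet ξ b₁ G) (hε : 0 < ε)
    (hfull : ∃ N, ∀ a ∈ Good ξ ε, N ≤ lsize a → a ∈ G) {u : ℕ → Point} (hu : Enumerates u G) :
    beta0 ξ = beta ξ ε ∧ beta0 ξ = limsup (logRatio u) atTop := by
  have h1 := (hG.approxSeq hu).beta0_le_limsup hG.irr
  have h2 := hG.limsup_le_beta hfull hu
  have h3 : beta ξ ε ≤ beta0 ξ := beta_le_beta0 hε
  exact ⟨le_antisymm (h1.trans h2) h3, le_antisymm h1 (h2.trans h3)⟩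

lemma epsilon1_pos {ξ : ℝ} (h : beta0 ξ < 2) : 0 < epsilon1 ξ := by
  have hreal : ∀ {x : EReal}, 0 ≤ x → x < 2 → 0 ≤ x.toReal ∧ x.toReal < 2 := by
    intro x h0 h2
    have e := EReal.coe_toReal (x := x) (ne_top_of_lt h2) (ne_bot_of_le_ne_bot (by simp) h0)
    rw [← e, show (2 : EReal) = ((2 : ℝ) : EReal) from rfl] at h2
    exact ⟨EReal.toReal_nonneg h0, EReal.coe_lt_coe_iff.mp h2⟩
  have h10 : beta ξ 1 ≤ beta0 ξ := beta_le_beta0 one_pos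
  obtain ⟨p1, l1⟩ := hreal (beta_nonneg ξ 1) (h10.trans_lt h)
  obtain ⟨-, l0⟩ := hreal ((beta_nonneg ξ 1).trans h10) h
  have := mul_nonneg (show 0 ≤ 2 - (beta0 ξ).toReal by linarith) p1
  exact mul_pos (by linarith) (by linarith)

/-- Good sets attached to different values of `ε` have the same large elements. -/
lemma exists_mem_minimalIn_iff {ξ ε ε' b₁ b₁' : ℝ} (hε : 0 < ε) (hε' : 0 < ε')
    (hG : GoodSet ξ b₁ (MinimalIn ξ ε)) (hG' : GoodSet ξ b₁' (MinimalIn ξ ε')) :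
    ∃ N, ∀ a, N ≤ lsize a → (a ∈ MinimalIn ξ ε ↔ a ∈ MinimalIn ξ ε') := by
  obtain ⟨N1, h1⟩ := hG.tight (ε' / 2) (half_pos hε')
  obtain ⟨N2, h2⟩ := hG'.tight (ε / 2) (half_pos hε)
  obtain ⟨N3, h3⟩ := exists_good_subset_minimalIn hG.irr (half_lt_self hε)
  obtain ⟨N4, h4⟩ := exists_good_subset_minimalIn hG.irr (half_lt_self hε')
  refine ⟨max (max N1 N2) (max N3 N4), fun a ha => ?_⟩
  simp only [max_le_iff] at ha
  exact ⟨fun h => h4 a (h1 a h ha.1.1) ha.2.2, fun h => h3 a (h2 a h ha.1.2) ha.2.1⟩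

lemma SameTail.limsup_eq {u v : ℕ → Point} (h : SameTail u v) :
    limsup (logRatio u) atTop = limsup (logRatio v) atTop := by
  obtain ⟨a, b, hab⟩ := h
  rw [← limsup_nat_add (logRatio u) (a + 1), ← limsup_nat_add (logRatio v) (b + 1)]
  congr 1
  ext i
  have h1 := hab (i + 1) (by omega)
  have h2 := hab (i + 2) (by omega)
  rw [logRatio, logRatio, show i + (a + 1) = a + (i + 1) by omega,
    show i + (b + 1) = b + (i + 1) by omega, add_assoc a, add_assoc b, h1, h2]

/-- A sequence as in the converse part is a tail of any enumeration of the good set. -/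
lemma GoodSet.sameTail {ξ b₁ ε : ℝ} (hε : 0 < ε) (hG : GoodSet ξ b₁ (MinimalIn ξ ε))
    {u v : ℕ → Point} (hu : Enumerates u (MinimalIn ξ ε)) (hv : ApproxSeq ξ v)
    (hprim : ∀ i, 1 ≤ i → IsPrimitivePoint (v i)) (hlim : limsup (logRatio v) atTop < 2)
    (hbr : ∀ᶠ i in atTop, ¬ LinearIndependent ℤ ![v i, v (i + 1), v (i + 2)] →
      IsCollinear (bracket (v (i + 1)) (v (i + 1)) (v i)) (v (i + 2))) : SameTail v u := by
  have hξ := hG.irr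
  have hb2 := hG.lt_two
  obtain ⟨b, hb0, hb, hgap⟩ := hv.eventually_lsize_le (z := 2) hlim
  obtain ⟨i₀, hi₀⟩ := hv.basic
  obtain ⟨N1, hN1⟩ := exists_isMinimalPoint_of_defect hξ hG.mem hb2
  obtain ⟨N2, hN2⟩ := exists_good_subset_minimalIn hξ (half_lt_self hε)
  have hη : 0 < (2 - b) / 4 := by linarith
  have hall := (hgap.and (hbr.and (hv.tight _ hη))).and (((hv.tight _ (half_pos hε)).and
    (hv.tight ((2 - b₁) / 4) (by linarith))).and
    ((hv.tendsto.eventually_ge_atTop (max N1 N2)).and (eventually_ge_atTop (max i₀ 1))))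
  obtain ⟨i₁, hi₁⟩ := eventually_atTop.mp hall
  have hη1 : 0 < 1 - (2 - b) / 4 := by linarith
  obtain ⟨i₂, -, hcons⟩ := hG.eventually_consec (v := v) (i₀ := i₁) (b := b / (1 - (2 - b) / 4))
    (C := 0) (fun i hi => by
      obtain ⟨-, ⟨h1, h2⟩, h3, h4⟩ := hi₁ i hi
      obtain ⟨h5, h6⟩ := max_le_iff.mp h3
      obtain ⟨h7, h8⟩ := max_le_iff.mp h4
      exact hN2 _ ⟨hN1 _ (hprim i h8) (hi₀ i h7).1 h5 h2, h1⟩ h6)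
    (fun i hi => (hi₀ i ((le_max_left _ _).trans (hi₁ i hi).2.2.2)).2.1)
    (by positivity) (by rw [div_lt_iff₀ hη1]; linarith)
    (fun i hi => by
      obtain ⟨⟨h1, -, h2⟩, -⟩ := hi₁ i hi
      have h3 := mul_le_mul_of_nonneg_left h2 (show 0 ≤ b / (1 - (2 - b) / 4) by positivity)
      rw [← mul_assoc, div_mul_cancel₀ _ hη1.ne'] at h3
      linarith)
    (fun i hi h => by
      have h1 := (hi₁ i hi).1.2.1 ((not_linearIndependent_triple_iff _ _ _).mpr h)
      rwa [isCollinear_iff] at h1)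
  exact sameTail_of_consec hξ hG.sub hu hcons

end SimApprox

theorem theorem4p1 (ξ : ℝ) (hξ : IrrationalNonQuadratic ξ) :
    -- Part (a)
    (beta0 ξ < 2 →
      (∀ ε : ℝ, 0 < ε → ε < epsilon1 ξ →
        (∃ u : ℕ → Point, IsMinimalSequence ξ ε u) ∧
        ∀ u : ℕ → Point, IsMinimalSequence ξ ε u →
          HasExponentNegOne ξ u ∧
          1 < liminf (logRatio u) atTop ∧
          beta0 ξ = beta ξ ε ∧
          beta0 ξ = limsup (logRatio u) atTop ∧
          ∃ ψ ∈ F, Describes ψ u) ∧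
      -- independence from the choice of `ε`
      (∀ ε ε' : ℝ, 0 < ε → ε < epsilon1 ξ → 0 < ε' → ε' < epsilon1 ξ →
        ∀ u u' : ℕ → Point, IsMinimalSequence ξ ε u → IsMinimalSequence ξ ε' u' →
          SameTail u u' ∧
          ∀ ψ ∈ F, ∀ ψ' ∈ F, Describes ψ u → Describes ψ' u' → R ψ ψ')) ∧
    -- Part (b)
    (∀ v : ℕ → Point,
      (∀ i, 1 ≤ i → IsPrimitivePoint (v i)) →
      (∀ i, 1 ≤ i → 0 < v i 0) →
      StrictMonoOn (fun i => v i 0) (Ici 1) →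
      HasExponentNegOne ξ v →
      limsup (logRatio v) atTop < 2 →
      (∀ᶠ i in atTop, ¬ LinearIndependent ℤ ![v i, v (i + 1), v (i + 2)] →
        IsCollinear (bracket (v (i + 1)) (v (i + 1)) (v i)) (v (i + 2))) →
      beta0 ξ = limsup (logRatio v) atTop ∧
      beta0 ξ < 2 ∧
      ∀ ε : ℝ, 0 < ε → ε < epsilon1 ξ →
        ∀ u : ℕ → Point, IsMinimalSequence ξ ε u → SameTail v u) := by
  refine ⟨fun hβ => ⟨fun ε hε hε1 => ?_, fun ε ε' hε hε1 hε' hε1' u u' hu hu' => ?_⟩,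
    fun v hprim hpos hmono hexp hlim hbr => ?_⟩
  · obtain ⟨b₁, hG, hfull⟩ := exists_goodSet hξ hβ hε hε1
    obtain ⟨u₀, hu₀⟩ := exists_enumerates hξ hG.sub hG.unbounded
    refine ⟨⟨u₀, (isMinimalSequence_iff hξ).mpr hu₀⟩, fun u hu => ?_⟩
    rw [isMinimalSequence_iff hξ] at hu
    have hseq := hG.approxSeq hu
    obtain ⟨C, -, hqual⟩ := exists_qual_le hξ hG.mem hG.lt_two
    obtain ⟨ρ, hρ, k₀, -, hgrow⟩ := hG.exists_growth hu
    obtain ⟨h1, h2⟩ := hG.beta0_eq hε hfull hu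
    obtain ⟨ψ, i₀, c, p1, p2, p3⟩ := hG.exists_psi hu
    refine ⟨hseq.hasExponentNegOne hξ (C := C) ?_, hseq.one_lt_liminf hρ ?_, h1, h2, ψ,
      hG.psi_mem_F hu p1 p2 p3, ?_⟩
    · filter_upwards [eventually_ge_atTop 1] with i hi
      exact hqual _ (hG.sub (hu.mem hi))
    · filter_upwards [eventually_ge_atTop k₀] with i hi
      exact hgrow i hi
    · filter_upwards [eventually_ge_atTop i₀] with i hi
      rw [isCollinear_iff]
      exact cross_comm_eq_zero (p3 i hi).2
  · obtain ⟨b₁, hG, -⟩ := exists_goodSet hξ hβ hε hε1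
    obtain ⟨b₁', hG', -⟩ := exists_goodSet hξ hβ hε' hε1'
    rw [isMinimalSequence_iff hξ] at hu hu'
    obtain ⟨N, hN⟩ := exists_mem_minimalIn_iff hε hε' hG hG'
    have htail := sameTail_of_eventually_eq hξ hG.sub hG'.sub hu hu' hN
    exact ⟨htail, fun ψ hψ ψ' hψ' hd hd' => R_of_sameTail hG hG'.sub hu hu' htail hψ hψ' hd hd'⟩
  · have hseq := ApproxSeq.of_hasExponent hξ hpos hmono hexp
    have hβ : beta0 ξ < 2 := (hseq.beta0_le_limsup hξ).trans_lt hlim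
    have htail : ∀ ε : ℝ, 0 < ε → ε < epsilon1 ξ → ∀ u : ℕ → Point, IsMinimalSequence ξ ε u →
        SameTail v u := by
      intro ε hε hε1 u hu
      rw [isMinimalSequence_iff hξ] at hu
      obtain ⟨b₁, hG, -⟩ := exists_goodSet hξ hβ hε hε1
      exact hG.sameTail hε hu hseq hprim hlim hbr
    refine ⟨?_, hβ, htail⟩
    obtain ⟨ε, hε, hε1⟩ := exists_between (epsilon1_pos hβ)
    obtain ⟨b₁, hG, hfull⟩ := exists_goodSet hξ hβ hε hε1
    obtain ⟨u, hu⟩ := exists_enumerates hξ hG.sub hG.unbounded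
    rw [(htail ε hε hε1 u ((isMinimalSequence_iff hξ).mpr hu)).limsup_eq]
    exact (hG.beta0_eq hε hfull hu).2
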